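/- Let $\mathcal H$ be a finite-dimensional complex Hilbert space, $d_{\mathcal H}=\dim\mathcal H$, and let $(\mathcal P_t)_{t\ge0}$ be a quantum Markov semigroup on $\mathcal B(\mathcal H)$ (a continuous semigroup of completely positive unital maps) with generator $\mathcal L$, having a faithful invariant state. Let $$\mathcal N=\{X:\ \mathcal P_t(X^*X)=\mathcal P_t(X)^*\mathcal P_t(X),\ \mathcal P_t(XX^*)=\mathcal P_t(X)\mathcal P_t(X)^*\ \ \forall t\ge0\}$$ be its decoherence-free subalgebra, $E_{\mathcal N}$ the unique conditional expectation onto $\mathcal N$ that is compatible with the faithful invariant states and satisfies $\lim_{t\to\infty}\mathcal P_t(X-E_{\mathcal N}[X])=0$ for all $X$, $E_{\mathcal N*}$ its predual for the trace pairing, and $\sigma:=\sigma_{\mathrm{Tr}}:=E_{\mathcal N*}(\mathbb I/d_{\mathcal H})$. Write $\Gamma^{s}(X)=\sigma^{s/2}X\sigma^{s/2}$, $\langle X,Y\rangle_\sigma=\mathrm{Tr}[\sigma^{1/2}X^*\sigma^{1/2}Y]$, $\|X\|_{p,\sigma}=(\mathrm{Tr}|\Gamma^{1/p}(X)|^p)^{1/p}$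 (the operator norm for $p=\infty$), $I_{b,a}(X)=\Gamma^{-1/b}(|\Gamma^{1/a}(X)|^{a/b})$ and $S_p(X)=-p\,\partial_sI_{p+s,p}(X)|_{s=0}$. For real $p,q\ge1$ and $\frac1r=|\frac1q-\frac1p|$, define $$\|X\|_{(q,p),\mathcal N}=\inf_{X=AYB;\,A,B\in\mathcal N,\,Y\in\mathcal B(\mathcal H)}\|A\|_{2r,\sigma}\|B\|_{2r,\sigma}\|Y\|_{p,\sigma}\quad(q\le p),$$ $$\|X\|_{(q,p),\mathcal N}=\sup_{A,B\in\mathcal N\setminus\{0\}}\frac{\|AXB\|_{p,\sigma}}{\|A\|_{2r,\sigma}\|B\|_{2r,\sigma}}\quad(q>p).$$ For positive definite $X$, $p\ge1$ and $\frac1p+\frac1{\hat p}=1$, let $$\mathrm{Ent}_{p,\mathcal N}(X)=\langle I_{\hat p,p}(X),S_p(X)\rangle_\sigma-\tfrac1p\mathrm{Tr}\big[(\Gamma^{1/p}(X))^p\ln E_{\mathcal N}[\Gamma^{-1}((\Gamma^{1/p}(X))^p)]\big],$$ and let $\mathcal E_{p,\mathcal L}(X)=-\frac{p}{2(p-1)}\mathrm{Re}\,\langle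 I_{\hat p,p}(X),\mathcal L(X)\rangle_\sigma$ for $p>1$, $\mathcal E_{1,\mathcal L}(X)=-\frac12\mathrm{Tr}[\Gamma^1(\mathcal L(X))(\ln\Gamma^1(X)-\ln\sigma)]$, be the $\mathbb L_p$ Dirichlet form. **Theorem.** Let $q\ge1$, and let $p$ be a real function that is twice continuously differentiable and increasing (not necessarily strictly) in a neighbourhood of $0$, with $p(0)=q$. (1) Let $t\mapsto Y(t)\in\mathcal B(\mathcal H)$ be twice continuously differentiable, with $Y(t)$ positive definite, in a neighbourhood of $0$, and let $Y=Y(0)$. Then $$\frac{d}{dt}\|Y(t)\|_{(q,p(t)),\mathcal N}\Big|_{t=0}=\frac{1}{q\|Y\|_{q,\sigma}^{q-1}}\Big(p'(0)\,\mathrm{Ent}_{q,\mathcal N}(Y)+q\,\mathrm{Tr}\big([\Gamma^{1/q}(Y)]^{q-1}\Gamma^{1/q}(Y'(0))\big)\Big),$$ which for $p'(0)\ne0$ is $\frac{p'(0)}{q\|Y\|_{q,\sigma}^{q-1}}\big(\mathrm{Ent}_{q,\mathcal N}(Y)+\frac{q}{p'(0)}\mathrm{Tr}([\Gamma^{1/q}(Y)]^{q-1}\Gamma^{1/q}(Y'(0)))\big)$.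 The derivative exists as a two-sided one if $q>1$, and as a right derivative if $q=1$ (where the norms need not be defined for $t<0$, since $p(t)$ may be below $1$). (2) For every positive definite $X\in\mathcal B(\mathcal H)$, with the right derivative at $t=0$, $$\frac{d}{dt}\|\mathcal P_t(X)\|_{(q,p(t)),\mathcal N}\Big|_{t=0}=\frac{1}{q\|X\|_{q,\sigma}^{q-1}}\Big(p'(0)\,\mathrm{Ent}_{q,\mathcal N}(X)-2(q-1)\,\mathcal E_{q,\mathcal L}(X)\Big).$$ -/

import Mathlib

open Filter Set
open scoped Topology ENNReal CStarAlgebra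

noncomputable section

namespace DFNorm

/-- Bounded operators on `H`. -/
abbrev Op (H : Type*) [NormedAddCommGroup H] [InnerProductSpace ℂ H] : Type _ := H →L[ℂ] H

section Basic

variable {H : Type*} [NormedAddCommGroup H] [InnerProductSpace ℂ H]

/-- The trace of an operator. -/
def tr (X : Op H) : ℂ := LinearMap.trace ℂ H (X : H →ₗ[ℂ] H)

variable [CompleteSpace H]

/-- Complete positivity of a linear map on operators. -/
def IsCompletelyPositive (Φ : Op H →ₗ[ℂ] Op H) : Prop :=
  ∃ φ : Op H →CP Op H, φ.toLinearMap = Φ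

/-- Full-rank density operators. -/
def IsFaithfulState (σ : Op H) : Prop := IsStrictlyPositive σ ∧ tr σ = 1

/-- `Γ_σ^s (X) = σ^{s/2} X σ^{s/2}`. -/
def Gam (σ : Op H) (s : ℝ) (X : Op H) : Op H := σ ^ (s / 2) * X * σ ^ (s / 2)

/-- The inner product `⟨X, Y⟩_σ = Tr [σ^{1/2} X^* σ^{1/2} Y]`. -/
def innerσ (σ X Y : Op H) : ℂ :=
  tr (σ ^ (1 / 2 : ℝ) * star X * σ ^ (1 / 2 : ℝ) * Y)

/-- The weighted norm `‖X‖_{p,σ}`, which is the operator norm for `p = ∞`. -/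
def wnorm (σ : Op H) (p : ℝ≥0∞) (X : Op H) : ℝ :=
  if p = ∞ then ‖X‖
  else (tr (CFC.abs (Gam σ (1 / p.toReal) X) ^ p.toReal)).re ^ (1 / p.toReal)

/-- `I_{b,a}(X) = Γ_σ^{-1/b} (|Γ_σ^{1/a}(X)|^{a/b})`, where `b = ∞` is allowed (`1 / b = 0`). -/
def Imap (σ : Op H) (b : ℝ≥0∞) (a : ℝ) (X : Op H) : Op H :=
  Gam σ (-(b⁻¹).toReal) (CFC.abs (Gam σ (1 / a) X) ^ (a * (b⁻¹).toReal))

/-- The operator valued relative entropy `S_p(X) = -p ∂_s I_{p+s,p}(X)|_{s=0}`. -/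
def opEntropy (σ : Op H) (p : ℝ) (X : Op H) : Op H :=
  (-p) • deriv (fun s : ℝ => Imap σ (ENNReal.ofReal (p + s)) p X) 0

/-- The Hölder conjugate of a real `p ≥ 1`, as an extended real (`∞` for `p = 1`). -/
def holderConj (p : ℝ) : ℝ≥0∞ := (ENNReal.ofReal p).conjExponent

end Basic

section Predual

variable {H : Type*} [NormedAddCommGroup H] [InnerProductSpace ℂ H]

theorem tr_add (X Y : Op H) : tr (X + Y) = tr X + tr Y := by simp [tr]

theorem tr_smul (c : ℂ) (X : Op H) : tr (c • X) = c * tr X := by simp [tr]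

theorem tr_sum {ι : Type*} (s : Finset ι) (f : ι → Op H) :
    tr (∑ i ∈ s, f i) = ∑ i ∈ s, tr (f i) := by
  classical
  induction s using Finset.induction_on with
  | empty => simp [tr]
  | insert a s ha ih => rw [Finset.sum_insert ha, Finset.sum_insert ha, tr_add, ih]

variable [FiniteDimensional ℂ H]

/-- The predual of `Φ`, written in an orthonormal basis `(e_i)`:
`Φ_*(ρ) = ∑_{i,j} Tr [ρ Φ(|e_j⟩⟨e_i|)] |e_i⟩⟨e_j|`. See `tr_predual_mul`. -/
def predual (Φ : Op H →ₗ[ℂ] Op H) (ρ : Op H) : Op H :=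
  ∑ i, ∑ j,
    tr (ρ * Φ (InnerProductSpace.rankOne ℂ (stdOrthonormalBasis ℂ H j)
      (stdOrthonormalBasis ℂ H i))) •
      InnerProductSpace.rankOne ℂ (stdOrthonormalBasis ℂ H i) (stdOrthonormalBasis ℂ H j)

theorem tr_rankOne_mul (x y : H) (Y : Op H) :
    tr (InnerProductSpace.rankOne ℂ x y * Y) = inner ℂ y (Y x) := by
  have h : ((InnerProductSpace.rankOne ℂ x y * Y : Op H) : H →ₗ[ℂ] H)
      = ((InnerProductSpace.rankOne ℂ x y : Op H) : H →ₗ[ℂ] H) * (Y : H →ₗ[ℂ] H) := rfl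
  rw [tr, h, LinearMap.trace_mul_comm]
  have h2 : (Y : H →ₗ[ℂ] H) * ((InnerProductSpace.rankOne ℂ x y : Op H) : H →ₗ[ℂ] H)
      = ((InnerProductSpace.rankOne ℂ (Y x) y : Op H) : H →ₗ[ℂ] H) := by
    ext z
    simp
  rw [h2, InnerProductSpace.trace_rankOne]

theorem op_eq_sum (Y : Op H) :
    Y = ∑ i, ∑ j, inner ℂ (stdOrthonormalBasis ℂ H j) (Y (stdOrthonormalBasis ℂ H i)) •
      (InnerProductSpace.rankOne ℂ (stdOrthonormalBasis ℂ H j)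
        (stdOrthonormalBasis ℂ H i) : Op H) := by
  ext z
  conv_lhs => rw [← (stdOrthonormalBasis ℂ H).sum_repr' z]
  simp only [map_sum, map_smul, _root_.sum_apply, _root_.smul_apply,
    InnerProductSpace.rankOne_apply]
  refine Finset.sum_congr rfl fun i _ => ?_
  conv_lhs => rw [← (stdOrthonormalBasis ℂ H).sum_repr' (Y ((stdOrthonormalBasis ℂ H) i))]
  rw [Finset.smul_sum]
  exact Finset.sum_congr rfl fun j _ => smul_comm _ _ _

/-- The duality that characterises the predual. -/
theorem tr_predual_mul (Φ : Op H →ₗ[ℂ] Op H) (ρ Y : Op H) :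
    tr (predual Φ ρ * Y) = tr (ρ * Φ Y) := by
  conv_rhs => rw [op_eq_sum Y]
  simp only [predual, Finset.sum_mul, tr_sum, smul_mul_assoc, tr_smul, tr_rankOne_mul, map_sum,
    map_smul, Finset.mul_sum, mul_smul_comm]
  exact Finset.sum_congr rfl fun i _ => Finset.sum_congr rfl fun j _ => mul_comm _ _

end Predual

/-- A quantum Markov semigroup on `B(H)` in the Heisenberg picture: a continuous semigroup
`(P_t)_{t ≥ 0}` of completely positive unital maps. Values at `t < 0` carry no meaning. -/
structure QMS (H : Type*) [NormedAddCommGroup H] [InnerProductSpace ℂ H] [CompleteSpace H] where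
  P : ℝ → Op H →ₗ[ℂ] Op H
  zero : P 0 = LinearMap.id
  add : ∀ s t : ℝ, 0 ≤ s → 0 ≤ t → P (s + t) = P s ∘ₗ P t
  continuousOn : ∀ X : Op H, ContinuousOn (fun t => P t X) (Ici 0)
  cp : ∀ t : ℝ, 0 ≤ t → IsCompletelyPositive (P t)
  unital : ∀ t : ℝ, 0 ≤ t → P t 1 = 1

namespace QMS

variable {H : Type*} [NormedAddCommGroup H] [InnerProductSpace ℂ H] [CompleteSpace H]

/-- The generator `L(X) = lim_{t → 0+} (P_t(X) - X) / t`. -/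
def generator (S : QMS H) (X : Op H) : Op H := derivWithin (fun t => S.P t X) (Ici 0) 0

/-- `σ` is invariant: `Tr (σ P_t(X)) = Tr (σ X)` for all `t ≥ 0` and `X`. -/
def IsInvariant (S : QMS H) (σ : Op H) : Prop :=
  ∀ t : ℝ, 0 ≤ t → ∀ X : Op H, tr (σ * S.P t X) = tr (σ * X)

/-- A decohering semigroup: one that has a faithful invariant state. -/
def IsDecohering (S : QMS H) : Prop := ∃ σ : Op H, IsFaithfulState σ ∧ S.IsInvariant σ

/-- The decoherence-free subalgebra. -/
def dfAlgebra (S : QMS H) : Set (Op H) :=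
  {X | ∀ t : ℝ, 0 ≤ t → S.P t (star X * X) = star (S.P t X) * S.P t X ∧
    S.P t (X * star X) = S.P t X * star (S.P t X)}

/-- `E` is the conditional expectation onto the decoherence-free subalgebra that is compatible
with the faithful invariant states and satisfies `P_t(X - E X) → 0` for all `X`. -/
structure IsDFExpectation (S : QMS H) (E : Op H →ₗ[ℂ] Op H) : Prop where
  mem : ∀ X, E X ∈ S.dfAlgebra
  cp : IsCompletelyPositive E
  unital : E 1 = 1
  bimodule : ∀ A ∈ S.dfAlgebra, ∀ B ∈ S.dfAlgebra, ∀ X, E (A * X * B) = A * E X * B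
  compatible : ∀ σ, IsFaithfulState σ → S.IsInvariant σ → ∀ X, tr (σ * E X) = tr (σ * X)
  decoherence : ∀ X, Tendsto (fun t => S.P t (X - E X)) atTop (𝓝 0)

/-- The conditional expectation `E_N` onto the decoherence-free subalgebra. -/
def dfExp (S : QMS H) : Op H →ₗ[ℂ] Op H := Classical.epsilon S.IsDFExpectation

/-- The `L_p` Dirichlet form, with respect to a reference state `σ`;
for `p = 1` it is the limit as `p → 1`. -/
def dirichletAux (S : QMS H) (σ : Op H) (p : ℝ) (X : Op H) : ℝ :=
  if p = 1 then
    -(1 / 2) * (tr (Gam σ 1 (S.generator X) * (CFC.log (Gam σ 1 X) - CFC.log σ))).re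
  else
    -(p / (2 * (p - 1))) * (innerσ σ (Imap σ (holderConj p) p X) (S.generator X)).re

variable [FiniteDimensional ℂ H]

/-- The reference state `σ_Tr = E_{N*}(1 / d_H)`. -/
def sigmaTr (S : QMS H) : Op H :=
  predual S.dfExp (((Module.finrank ℂ H : ℂ)⁻¹) • (1 : Op H))

/-- The `L_p` Dirichlet form. -/
def dirichlet (S : QMS H) (p : ℝ) (X : Op H) : ℝ := S.dirichletAux S.sigmaTr p X

/-- The exponent `2r`, where `1/r = |1/q - 1/p|`; it is `∞` for `p = q`. -/
def twoR (q p : ℝ) : ℝ≥0∞ := 2 * (ENNReal.ofReal |1 / q - 1 / p|)⁻¹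

/-- The amalgamated norm `‖X‖_{(q,p),N}` for real `q, p ≥ 1`: an infimum over factorisations if
`q ≤ p`, a supremum if `q > p`. -/
def amalgNorm (S : QMS H) (q p : ℝ) (X : Op H) : ℝ :=
  if q ≤ p then
    sInf {x : ℝ | ∃ A ∈ S.dfAlgebra, ∃ B ∈ S.dfAlgebra, ∃ Y : Op H, X = A * Y * B ∧
      x = wnorm S.sigmaTr (twoR q p) A * wnorm S.sigmaTr (twoR q p) B *
        wnorm S.sigmaTr (ENNReal.ofReal p) Y}
  else
    sSup {x : ℝ | ∃ A ∈ S.dfAlgebra, ∃ B ∈ S.dfAlgebra, A ≠ 0 ∧ B ≠ 0 ∧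
      x = wnorm S.sigmaTr (ENNReal.ofReal p) (A * X * B) /
        (wnorm S.sigmaTr (twoR q p) A * wnorm S.sigmaTr (twoR q p) B)}

/-- The decoherence-free `L_p` relative entropy `Ent_{p,N}(X)`, for positive definite `X`. -/
def Ent (S : QMS H) (p : ℝ) (X : Op H) : ℝ :=
  (innerσ S.sigmaTr (Imap S.sigmaTr (holderConj p) p X) (opEntropy S.sigmaTr p X)).re
    - 1 / p * (tr (Gam S.sigmaTr (1 / p) X ^ p *
        CFC.log (S.dfExp (Gam S.sigmaTr (-1) (Gam S.sigmaTr (1 / p) X ^ p))))).re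

end QMS

end DFNorm

end

open Filter Set
open scoped Topology ENNReal CStarAlgebra

noncomputable section

namespace DFNorm

set_option linter.unusedSectionVars false

open Asymptotics

/-! ### Trace and functional calculus in finite dimension. -/

section TraceAndSpectrum

variable {H : Type*} [NormedAddCommGroup H] [InnerProductSpace ℂ H]

/-! Put `s = 1/q - 1/p(t)`, `M_t = Γ^{1/p(t)}(Y(t))`, `M = M_0` and `V = M^q`. The trace is tracial
and `σ` is its image under the predual of `E_N`, so `σ` commutes with `N`. Two things follow:
factors from `N` pass through `Γ`, and for nonzero `A` in `N` the operator `|A|` is, up to the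
`2r`-norm of `A`, the power `R^{|s|/2}` of a density `R ≥ 0` in `N` with `Tr σR = 1`. Thus
`‖Y(t)‖_{(q,p),N}^p` is essentially the infimum over `R, R'` of `Tr |R^{-s/2} M_t R'^{-s/2}|^p` if
`s > 0`, and the supremum of the same expression if `s < 0`.

With `R^{-s/2} = exp(-(s/2) log R)`, the first-order expansion (`trp_exp_conj_isLittleO`) is `Tr
M_t^p - (qs/2) Tr V(log R + log R')`. In both cases the optimum is `Tr M_t^p - q s max_R Tr(V log R)
+ o(s)`; this is `amalgNorm_rpow_isLittleO`. On `N` the functional `Tr(V ·)` is `Tr(σG ·)` with `G =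
E_N[Γ^{-1}(V)]`, so Gibbs' inequality (`gibbs`) gives the maximum: it is attained at `G / Tr V` and
equals `Tr(V log G) - Tr V log Tr V`.

The expansion has to be uniform in `R`, while `log R` is unbounded. Since `R ≤ R + δ` is harmless in
the direction where all `R` must be controlled, `R` is replaced there by `R + δ`, whose logarithms
are bounded; this costs only `Tr(V) δ` in the maximum (`re_tr_mul_le_of_mem_logSet`). The opposite
bound needs only the one optimal density.

Differentiating `Tr M_t^{p(t)}` and taking the `p`-th root cancels `Tr V log Tr V` and leaves the
entropy. For the semigroup, `Y'(0) = L(X)` and the trace term is the Dirichlet form; at `q = 1` it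
is `Tr σL(X)`, which vanishes because `σ` is invariant (`tr_sigmaTr_mul_generator`). The existence
of `E_N` comes from compactness of the semigroup (`exists_isDFExpectation`). -/

theorem tr_mul_comm (X Y : Op H) : tr (X * Y) = tr (Y * X) :=
  LinearMap.trace_mul_comm ℂ (X : H →ₗ[ℂ] H) (Y : H →ₗ[ℂ] H)

theorem tr_neg (X : Op H) : tr (-X) = -tr X := by simp [tr]

theorem tr_sub (X Y : Op H) : tr (X - Y) = tr X - tr Y := by simp [tr]

theorem tr_zero : tr (0 : Op H) = 0 := by simp [tr]

theorem tr_real_smul (c : ℝ) (X : Op H) : tr (c • X) = c * tr X := by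
  rw [← Complex.coe_smul, tr_smul]

variable [CompleteSpace H] [FiniteDimensional ℂ H]

theorem tr_eq_sum_inner {ι : Type*} [Fintype ι] (b : OrthonormalBasis ι ℂ H) (X : Op H) :
    tr X = ∑ i, inner ℂ (b i) (X (b i)) :=
  LinearMap.trace_eq_sum_inner _ b

theorem tr_star (X : Op H) : tr (star X) = star (tr X) := by
  rw [tr_eq_sum_inner (stdOrthonormalBasis ℂ H), tr_eq_sum_inner (stdOrthonormalBasis ℂ H),
    star_sum]
  refine Finset.sum_congr rfl fun i _ => ?_
  rw [ContinuousLinearMap.star_eq_adjoint, ContinuousLinearMap.adjoint_inner_right]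
  simp

theorem re_tr_star (X : Op H) : (tr (star X)).re = (tr X).re := by simp [tr_star]

theorem continuous_tr : Continuous (tr : Op H → ℂ) := by
  let f : Op H →ₗ[ℂ] ℂ := { toFun := tr, map_add' := tr_add, map_smul' := tr_smul }
  exact f.continuous_of_finiteDimensional

theorem finite_spectrum (P : Op H) : (spectrum ℝ P).Finite := by
  have h1 : (spectrum ℂ P).Finite := by
    have h := Module.End.finite_spectrum (P : H →ₗ[ℂ] H)
    rwa [← AlgEquiv.spectrum_eq (Module.End.toContinuousLinearMap H)] at h
  have h2 : spectrum ℝ P ⊆ (fun x : ℝ => (x : ℂ)) ⁻¹' (spectrum ℂ P) := by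
    intro x hx
    exact spectrum.algebraMap_mem ℂ hx
  exact (h1.preimage (Complex.ofReal_injective.injOn)).subset h2

/-- The spectrum is finite, so the functional calculus applies to arbitrary real functions without
continuity conditions. -/
theorem continuousOn_spectrum (P : Op H) (f : ℝ → ℝ) : ContinuousOn f (spectrum ℝ P) :=
  (finite_spectrum P).continuousOn f

/-- Lagrange interpolation on the finite spectrum. It reduces statements on `cfc`, such as
membership in an algebra, to polynomials. -/
theorem cfc_eq_aeval {P : Op H} (hP : IsSelfAdjoint P) (f : ℝ → ℝ) :
    ∃ g : Polynomial ℝ, (∀ x ∈ spectrum ℝ P, g.eval x = f x) ∧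
      cfc f P = Polynomial.aeval P g := by
  classical
  let s := (finite_spectrum P).toFinset
  let g := Lagrange.interpolate s id f
  have hg : ∀ x ∈ spectrum ℝ P, g.eval x = f x := fun x hx =>
    Lagrange.eval_interpolate_at_node f Function.injective_id.injOn (i := x) (by simpa [s] using hx)
  refine ⟨g, hg, ?_⟩
  rw [← cfc_polynomial g P]
  exact cfc_congr fun x hx => (hg x hx).symm

theorem aeval_apply_eigenvector {P : Op H} {v : H} {c : ℝ} (h : P v = c • v)
    (g : Polynomial ℝ) : (Polynomial.aeval P g) v = g.eval c • v := by
  induction g using Polynomial.induction_on' with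
  | add p q hp hq => simp [hp, hq, add_smul]
  | monomial n a =>
    have : ∀ n : ℕ, (P ^ n) v = c ^ n • v := by
      intro n
      induction n with
      | zero => simp
      | succ n ih => rw [pow_succ', mul_apply_eq_comp, ih,
        LinearMapClass.map_smul_of_tower, h, smul_smul, pow_succ]
    simp [Polynomial.aeval_monomial, Algebra.algebraMap_eq_smul_one, this, smul_smul]

theorem mem_spectrum_of_eigenvector {P : Op H} {v : H} {c : ℝ} (h : P v = c • v) (hv : v ≠ 0) :
    c ∈ spectrum ℝ P := by
  intro hu
  obtain ⟨u, hu⟩ := hu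
  have h1 : (u : Op H) v = 0 := by simp [hu, h, Algebra.algebraMap_eq_smul_one]
  have h2 : ((u⁻¹ : (Op H)ˣ) : Op H) ((u : Op H) v) = v := by
    rw [← mul_apply_eq_comp]; simp
  rw [h1, map_zero] at h2
  exact hv h2.symm

theorem cfc_apply_eigenvector {P : Op H} (hP : IsSelfAdjoint P) (f : ℝ → ℝ) {v : H} {c : ℝ}
    (h : P v = c • v) (hv : v ≠ 0) : (cfc f P) v = f c • v := by
  obtain ⟨g, hg, h1⟩ := cfc_eq_aeval hP f
  rw [h1, aeval_apply_eigenvector h, hg c (mem_spectrum_of_eigenvector h hv)]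

theorem exists_eigenbasis {P : Op H} (hP : IsSelfAdjoint P) :
    ∃ (b : OrthonormalBasis (Fin (Module.finrank ℂ H)) ℂ H) (c : Fin (Module.finrank ℂ H) → ℝ),
      (∀ i, c i ∈ spectrum ℝ P) ∧ ∀ f : ℝ → ℝ, ∀ i, (cfc f P) (b i) = f (c i) • b i := by
  have hs : (P : H →ₗ[ℂ] H).IsSymmetric := hP.isSymmetric
  refine ⟨hs.eigenvectorBasis rfl, hs.eigenvalues rfl, fun i => ?_, fun f i => ?_⟩
  · exact mem_spectrum_of_eigenvector (hs.apply_eigenvectorBasis rfl i)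
      ((hs.eigenvectorBasis rfl).orthonormal.ne_zero i)
  · exact cfc_apply_eigenvector hP f (hs.apply_eigenvectorBasis rfl i)
      ((hs.eigenvectorBasis rfl).orthonormal.ne_zero i)

/-- The joint spectral weights of two self-adjoint operators, linked by a third operator. -/
theorem exists_joint_weights {P Q : Op H} (hP : IsSelfAdjoint P) (hQ : IsSelfAdjoint Q)
    (C : Op H) : ∃ (a b : Fin (Module.finrank ℂ H) → ℝ)
      (w : Fin (Module.finrank ℂ H) → Fin (Module.finrank ℂ H) → ℝ),
      (∀ i, a i ∈ spectrum ℝ P) ∧ (∀ j, b j ∈ spectrum ℝ Q) ∧ (∀ i j, 0 ≤ w i j) ∧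
      ∀ g h : ℝ → ℝ, tr (cfc g P * C * cfc h Q * star C) =
        ((∑ i, ∑ j, g (a i) * h (b j) * w i j : ℝ) : ℂ) := by
  obtain ⟨e, a, ha, he⟩ := exists_eigenbasis hP
  obtain ⟨f, b, hb, hf⟩ := exists_eigenbasis hQ
  -- The weights are squared matrix entries of `C` between an eigenbasis of `P` and one of `Q`.
  refine ⟨a, b, fun i j => ‖(inner ℂ (e i) (C (f j)) : ℂ)‖ ^ 2, ha, hb, fun i j => by positivity,
    fun g h => ?_⟩
  rw [tr_mul_comm, tr_eq_sum_inner f, Finset.sum_comm]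
  simp only [Complex.ofReal_sum, Complex.ofReal_mul, Complex.ofReal_pow]
  refine Finset.sum_congr rfl fun j _ => ?_
  have h1 : (star C * (cfc g P * C * cfc h Q)) (f j) =
      (h (b j) : ℂ) • (star C) ((cfc g P) (C (f j))) := by
    simp [hf, ← Complex.coe_smul]
  rw [h1, inner_smul_right, ContinuousLinearMap.star_eq_adjoint,
    ContinuousLinearMap.adjoint_inner_right, ← e.sum_inner_mul_inner, Finset.mul_sum]
  refine Finset.sum_congr rfl fun i _ => ?_
  have h2 : inner ℂ (e i) ((cfc g P) (C (f j))) = (g (a i) : ℂ) * inner ℂ (e i) (C (f j)) := by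
    have h3 : IsSelfAdjoint (cfc g P) := cfc_predicate g P
    rw [← ContinuousLinearMap.adjoint_inner_left, ← ContinuousLinearMap.star_eq_adjoint, h3.star_eq,
      he, ← Complex.coe_smul, inner_smul_left]
    simp
  rw [h2, ← inner_conj_symm (C (f j)) (e i), ← Complex.conj_mul']
  ring

end TraceAndSpectrum

/-! ### Trace inequalities: Klein, Gibbs, and monotonicity of Schatten functionals. -/

section Inequalities

variable {H : Type*} [NormedAddCommGroup H] [InnerProductSpace ℂ H] [CompleteSpace H]
  [FiniteDimensional ℂ H]

theorem re_tr_nonneg {X : Op H} (h : 0 ≤ X) : 0 ≤ (tr X).re := by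
  rw [tr_eq_sum_inner (stdOrthonormalBasis ℂ H), Complex.re_sum]
  refine Finset.sum_nonneg fun i _ => ?_
  exact ((ContinuousLinearMap.nonneg_iff_isPositive X).1 h).re_inner_nonneg_right _

theorem re_tr_mono {X Y : Op H} (h : X ≤ Y) : (tr X).re ≤ (tr Y).re := by
  have := re_tr_nonneg (sub_nonneg.2 h)
  rw [tr_sub, Complex.sub_re] at this
  linarith

theorem re_tr_mul_nonneg {X Y : Op H} (hX : 0 ≤ X) (hY : 0 ≤ Y) : 0 ≤ (tr (X * Y)).re := by
  obtain ⟨B, rfl⟩ := CStarAlgebra.nonneg_iff_eq_star_mul_self.1 hY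
  rw [← mul_assoc, tr_mul_comm, ← mul_assoc]
  exact re_tr_nonneg (star_right_conjugate_nonneg hX B)

theorem eq_zero_of_re_tr_star_mul_self {X : Op H} (h : (tr (star X * X)).re ≤ 0) : X = 0 := by
  rw [tr_eq_sum_inner (stdOrthonormalBasis ℂ H), Complex.re_sum] at h
  have h1 : ∀ i, (inner ℂ (stdOrthonormalBasis ℂ H i)
      ((star X * X) (stdOrthonormalBasis ℂ H i))).re = ‖X (stdOrthonormalBasis ℂ H i)‖ ^ 2 := by
    intro i
    rw [mul_apply_eq_comp, ContinuousLinearMap.star_eq_adjoint,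
      ContinuousLinearMap.adjoint_inner_right, inner_self_eq_norm_sq_to_K]
    norm_cast
  simp only [h1] at h
  have h2 := (Finset.sum_eq_zero_iff_of_nonneg (fun i _ => by positivity)).1
    (le_antisymm h (Finset.sum_nonneg fun i _ => by positivity))
  ext v
  rw [← (stdOrthonormalBasis ℂ H).sum_repr' v]
  simp only [map_sum, map_smul]
  refine (Finset.sum_eq_zero fun i hi => ?_).trans (by simp)
  have := h2 i hi
  rw [norm_eq_zero.1 (pow_eq_zero_iff (two_ne_zero) |>.1 this), smul_zero]

theorem eq_zero_of_re_tr_eq_zero {X : Op H} (hX : 0 ≤ X) (h : (tr X).re ≤ 0) : X = 0 := by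
  obtain ⟨B, rfl⟩ := CStarAlgebra.nonneg_iff_eq_star_mul_self.1 hX
  rw [eq_zero_of_re_tr_star_mul_self h]; simp

theorem cfc_const_one {P : Op H} (hP : IsSelfAdjoint P) : cfc (fun _ : ℝ => (1 : ℝ)) P = 1 :=
  _root_.cfc_const_one ℝ P

/-- Klein's inequality. -/
theorem klein {P Q : Op H} (hP : IsSelfAdjoint P) (hQ : IsSelfAdjoint Q) (f f' : ℝ → ℝ)
    (h : ∀ a ∈ spectrum ℝ P, ∀ b ∈ spectrum ℝ Q, f b + f' b * (a - b) ≤ f a) :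
    (tr (cfc f Q)).re + (tr (cfc f' Q * (P - Q))).re ≤ (tr (cfc f P)).re := by
  -- Every trace becomes a double sum against the same nonnegative weights, so the scalar tangent
  -- inequality can be summed termwise.
  obtain ⟨a, b, w, ha, hb, hw, H1⟩ := exists_joint_weights hP hQ 1
  simp only [mul_one, star_one] at H1
  have e1 := H1 f (fun _ => 1)
  have e2 := H1 (fun _ => 1) f
  have e3 := H1 id f'
  have e4 := H1 (fun _ => 1) (fun x => f' x * x)
  rw [cfc_const_one hQ, mul_one] at e1
  rw [cfc_const_one hP, one_mul] at e2
  rw [cfc_id ℝ P, tr_mul_comm] at e3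
  rw [cfc_const_one hP, one_mul, cfc_mul f' (fun x => x) Q (continuousOn_spectrum _ _)
    (continuousOn_spectrum _ _), cfc_id' ℝ Q] at e4
  rw [mul_sub, tr_sub, e1, e2, e3, e4, Complex.sub_re]
  simp only [Complex.ofReal_re]
  rw [← Finset.sum_sub_distrib, ← Finset.sum_add_distrib]
  refine Finset.sum_le_sum fun i _ => ?_
  rw [← Finset.sum_sub_distrib, ← Finset.sum_add_distrib]
  refine Finset.sum_le_sum fun j _ => ?_
  have := mul_le_mul_of_nonneg_right (h _ (ha i) _ (hb j)) (hw i j)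
  simp only [id]
  linarith

theorem spectrum_pos {P : Op H} (hP : IsStrictlyPositive P) {x : ℝ} (hx : x ∈ spectrum ℝ P) :
    0 < x :=
  (CStarAlgebra.isStrictlyPositive_iff_isSelfAdjoint_and_spectrum_pos.1 hP).2 x hx

theorem spectrum_nonneg {P : Op H} (hP : 0 ≤ P) {x : ℝ} (hx : x ∈ spectrum ℝ P) : 0 ≤ x :=
  spectrum_nonneg_of_nonneg hP hx

/-- Gibbs' variational inequality, with a weight that commutes with the state. -/
theorem gibbs {G R C : Op H} (hG : 0 ≤ G) (hR : IsStrictlyPositive R)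
    (hC : IsSelfAdjoint C) (hCG : Commute C G) :
    (tr (C * C * (G * CFC.log R))).re - (tr (C * C * (G * CFC.log G))).re
      ≤ (tr (C * C * R)).re - (tr (C * C * G)).re := by
  have hGs : IsSelfAdjoint G := hG.isSelfAdjoint
  have hRs : IsSelfAdjoint R := hR.nonneg.isSelfAdjoint
  obtain ⟨a, b, w, ha, hb, hw, H1⟩ := exists_joint_weights hGs hRs C
  -- Because `C` commutes with functions of `G`, the weight `C * C` can be split to stand on both
  -- sides of `cfc h R`.
  have key : ∀ g h : ℝ → ℝ, tr (C * C * (cfc g G * cfc h R)) =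
      ((∑ i, ∑ j, g (a i) * h (b j) * w i j : ℝ) : ℂ) := by
    intro g h
    rw [← H1, hC.star_eq]
    have c1 : Commute C (cfc g G) := (hCG.symm.cfc_real g).symm
    rw [tr_mul_comm (cfc g G * C * cfc h R) C]
    simp only [mul_assoc]
    rw [← mul_assoc C (cfc g G), c1.eq, mul_assoc]
  have e1 := key id Real.log
  have e2 := key (fun x => x * Real.log x) (fun _ => 1)
  have e3 := key (fun _ => 1) id
  have e4 := key id (fun _ => 1)
  rw [cfc_id ℝ G] at e1
  rw [cfc_mul (fun x => x) Real.log G (continuousOn_spectrum _ _)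
    (continuousOn_spectrum _ _), cfc_id' ℝ G, cfc_const_one hRs, mul_one] at e2
  rw [cfc_const_one hGs, one_mul, cfc_id ℝ R] at e3
  rw [cfc_id ℝ G, cfc_const_one hRs, mul_one] at e4
  rw [CFC.log, CFC.log, e1, e2, e3, e4]
  simp only [Complex.ofReal_re]
  rw [← Finset.sum_sub_distrib, ← Finset.sum_sub_distrib]
  refine Finset.sum_le_sum fun i _ => ?_
  rw [← Finset.sum_sub_distrib, ← Finset.sum_sub_distrib]
  refine Finset.sum_le_sum fun j _ => ?_
  rw [← sub_mul, ← sub_mul]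
  refine mul_le_mul_of_nonneg_right ?_ (hw i j)
  have hb' := spectrum_pos hR (hb j)
  have ha' := spectrum_nonneg hG (ha i)
  simp only [id, one_mul, mul_one]
  rcases ha'.eq_or_lt with h0 | h0
  -- A zero eigenvalue of `G` is allowed: there `0 * log` vanishes and only `0 ≤ b j` remains.
  · rw [← h0]; simp [hb'.le]
  · have h1 := Real.log_le_sub_one_of_pos (div_pos hb' h0)
    rw [Real.log_div hb'.ne' h0.ne'] at h1
    have h2 := mul_le_mul_of_nonneg_left h1 ha'
    have h3 : a i * (b j / a i - 1) = b j - a i := by field_simp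
    linarith

theorem rpow_eq_cfc {P : Op H} (hP : 0 ≤ P) (y : ℝ) : P ^ y = cfc (fun x : ℝ => x ^ y) P :=
  CFC.rpow_eq_cfc_real

/-- Bernoulli's inequality at `a / b - 1`, scaled by `b ^ θ`. At `b = 0` the convention `0 ^ 0 = 1`
gives equality for `θ = 1`. -/
theorem rpow_tangent_convex {θ a b : ℝ} (hθ : 1 ≤ θ) (ha : 0 ≤ a) (hb : 0 ≤ b) :
    b ^ θ + θ * b ^ (θ - 1) * (a - b) ≤ a ^ θ := by
  rcases hb.eq_or_lt with rfl | hb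
  · rcases hθ.eq_or_lt with rfl | h
    · simp
    · rw [Real.zero_rpow (by linarith), Real.zero_rpow (by linarith)]
      simpa using Real.rpow_nonneg ha θ
  · have h1 := one_add_mul_self_le_rpow_one_add (s := a / b - 1)
      (by have := div_nonneg ha hb.le; linarith) hθ
    have h2 := mul_le_mul_of_nonneg_left h1 (Real.rpow_nonneg hb.le θ)
    rw [add_sub_cancel, Real.div_rpow ha hb.le, mul_div_cancel₀ _ (Real.rpow_pos_of_pos hb θ).ne'] at h2
    rw [Real.rpow_sub_one hb.ne']
    refine le_trans (le_of_eq ?_) h2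
    field_simp
    
theorem rpow_tangent_concave {θ a b : ℝ} (hθ : 0 ≤ θ) (hθ1 : θ ≤ 1) (ha : 0 ≤ a) (hb : 0 < b) :
    a ^ θ ≤ b ^ θ + θ * b ^ (θ - 1) * (a - b) := by
  have h1 := rpow_one_add_le_one_add_mul_self (s := a / b - 1)
    (by have := div_nonneg ha hb.le; linarith) hθ hθ1
  have h2 := mul_le_mul_of_nonneg_left h1 (Real.rpow_nonneg hb.le θ)
  rw [add_sub_cancel, Real.div_rpow ha hb.le, mul_div_cancel₀ _ (Real.rpow_pos_of_pos hb θ).ne'] at h2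
  rw [Real.rpow_sub_one hb.ne']
  refine le_trans h2 (le_of_eq ?_)
  field_simp

theorem cfc_const_mul_rpow {Q : Op H} (hQ : 0 ≤ Q) (θ y : ℝ) :
    cfc (fun x : ℝ => θ * x ^ y) Q = θ • Q ^ y := by
  rw [rpow_eq_cfc hQ, ← cfc_const_mul θ (fun x : ℝ => x ^ y) Q (continuousOn_spectrum _ _)]

theorem klein_rpow_convex {P Q : Op H} (hP : 0 ≤ P) (hQ : 0 ≤ Q) {θ : ℝ} (hθ : 1 ≤ θ) :
    (tr (Q ^ θ)).re + θ * (tr (Q ^ (θ - 1) * (P - Q))).re ≤ (tr (P ^ θ)).re := by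
  have h := klein hP.isSelfAdjoint hQ.isSelfAdjoint (fun x => x ^ θ) (fun x => θ * x ^ (θ - 1))
    fun a ha b hb => rpow_tangent_convex hθ (spectrum_nonneg hP ha) (spectrum_nonneg hQ hb)
  rw [cfc_const_mul_rpow hQ, ← rpow_eq_cfc hQ, ← rpow_eq_cfc hP, smul_mul_assoc,
    tr_real_smul, Complex.re_ofReal_mul] at h
  exact h

theorem klein_rpow_concave {P Q : Op H} (hP : 0 ≤ P) (hQ : IsStrictlyPositive Q) {θ : ℝ}
    (hθ : 0 ≤ θ) (hθ1 : θ ≤ 1) :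
    (tr (P ^ θ)).re ≤ (tr (Q ^ θ)).re + θ * (tr (Q ^ (θ - 1) * (P - Q))).re := by
  have h := klein hP.isSelfAdjoint hQ.nonneg.isSelfAdjoint (fun x => -1 * x ^ θ)
    (fun x => -θ * x ^ (θ - 1)) fun a ha b hb => by
      have := rpow_tangent_concave hθ hθ1 (spectrum_nonneg hP ha) (spectrum_pos hQ hb)
      linarith
  rw [cfc_const_mul_rpow hQ.nonneg, cfc_const_mul_rpow hQ.nonneg, cfc_const_mul_rpow hP,
    smul_mul_assoc, tr_real_smul, tr_real_smul, tr_real_smul, Complex.re_ofReal_mul,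
    Complex.re_ofReal_mul, Complex.re_ofReal_mul] at h
  linarith

/-- For `θ > 1` the power is not operator monotone, but under the trace Klein's inequality suffices;
for `θ ≤ 1` this is Löwner–Heinz. -/
theorem tr_rpow_mono {A B : Op H} (hA : 0 ≤ A) (hAB : A ≤ B) {θ : ℝ} (hθ : 0 ≤ θ) :
    (tr (A ^ θ)).re ≤ (tr (B ^ θ)).re := by
  rcases le_total 1 θ with h | h
  · have h1 := klein_rpow_convex (hA.trans hAB) hA h
    have h2 := re_tr_mul_nonneg (CFC.rpow_nonneg (a := A) (y := θ - 1)) (sub_nonneg.2 hAB)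
    nlinarith
  · exact re_tr_mono (CFC.rpow_le_rpow ⟨hθ, h⟩ hAB)

theorem abs_rpow (K : Op H) {p : ℝ} (hp : 0 ≤ p) : CFC.abs K ^ p = (star K * K) ^ (p / 2) := by
  rw [CFC.abs, CFC.sqrt_eq_rpow, CFC.rpow_rpow_of_exponent_nonneg _ _ _ (by norm_num) hp]
  congr 1; ring

theorem mul_aeval_star_mul_self (K : Op H) (g : Polynomial ℝ) :
    K * Polynomial.aeval (star K * K) g = Polynomial.aeval (K * star K) g * K := by
  induction g using Polynomial.induction_on' with
  | add p q hp hq => simp [mul_add, add_mul, hp, hq]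
  | monomial n a =>
    have : ∀ n : ℕ, K * (star K * K) ^ n = (K * star K) ^ n * K := by
      intro n
      induction n with
      | zero => simp
      | succ n ih => rw [pow_succ, ← mul_assoc, ih, pow_succ]; simp only [mul_assoc]
    simp [Polynomial.aeval_monomial, Algebra.algebraMap_eq_smul_one, this]

/-- The identity `K g(K^*K) = g(KK^*) K` and cyclicity handle any function divisible by `x`; the
condition `f 0 = 0` is what allows interpolation by `X * g`. -/
theorem tr_cfc_star_mul_self (K : Op H) (f : ℝ → ℝ) (hf : f 0 = 0) :
    tr (cfc f (star K * K)) = tr (cfc f (K * star K)) := by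
  classical
  have hs1 : IsSelfAdjoint (star K * K) := .star_mul_self K
  have hs2 : IsSelfAdjoint (K * star K) := .mul_star_self K
  let s := (finite_spectrum (star K * K)).toFinset ∪ (finite_spectrum (K * star K)).toFinset
  let g := Lagrange.interpolate s id (fun x => f x / x)
  have hg : ∀ x ∈ s, (Polynomial.X * g).eval x = f x := by
    intro x hx
    have := Lagrange.eval_interpolate_at_node (fun x => f x / x) Function.injective_id.injOn hx
    simp only [id] at this
    rw [Polynomial.eval_mul, Polynomial.eval_X, this]
    rcases eq_or_ne x 0 with rfl | h
    · simp [hf]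
    · field_simp
  have e1 : cfc f (star K * K) = Polynomial.aeval (star K * K) (Polynomial.X * g) := by
    rw [← cfc_polynomial _ (star K * K)]
    exact cfc_congr fun x hx => (hg x (by simp [s, hx])).symm
  have e2 : cfc f (K * star K) = Polynomial.aeval (K * star K) (Polynomial.X * g) := by
    rw [← cfc_polynomial _ (K * star K)]
    exact cfc_congr fun x hx => (hg x (by simp [s, hx])).symm
  rw [e1, e2, map_mul, map_mul, Polynomial.aeval_X, Polynomial.aeval_X, mul_assoc,
    mul_aeval_star_mul_self, tr_mul_comm, mul_assoc, tr_mul_comm]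

/-- The unnormalised Schatten functional `Tr |K|^p`. -/
def trp (p : ℝ) (K : Op H) : ℝ := (tr (CFC.abs K ^ p)).re

theorem trp_eq {p : ℝ} (hp : 0 ≤ p) (K : Op H) : trp p K = (tr ((star K * K) ^ (p / 2))).re := by
  rw [trp, abs_rpow K hp]

theorem trp_star {p : ℝ} (hp : 0 < p) (K : Op H) : trp p (star K) = trp p K := by
  rw [trp_eq hp.le, trp_eq hp.le, star_star, rpow_eq_cfc (star_mul_self_nonneg K),
    rpow_eq_cfc (mul_star_self_nonneg K), tr_cfc_star_mul_self K (fun x : ℝ => x ^ (p / 2)) (Real.zero_rpow (by positivity))]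

theorem trp_nonneg (p : ℝ) (K : Op H) : 0 ≤ trp p K := re_tr_nonneg CFC.rpow_nonneg

theorem trp_of_nonneg {p : ℝ} {K : Op H} (hK : 0 ≤ K) : trp p K = (tr (K ^ p)).re := by
  rw [trp, CFC.abs_of_nonneg K hK]

theorem trp_mono {p : ℝ} (hp : 0 ≤ p) {K L : Op H} (h : star K * K ≤ star L * L) :
    trp p K ≤ trp p L := by
  rw [trp_eq hp, trp_eq hp]
  exact tr_rpow_mono (star_mul_self_nonneg K) h (by positivity)

/-- `Tr |AK|^p` is monotone in `A^* A`. -/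
theorem trp_mul_mono_left {p : ℝ} (hp : 0 ≤ p) {A B : Op H} (h : star A * A ≤ star B * B)
    (K : Op H) : trp p (A * K) ≤ trp p (B * K) := by
  refine trp_mono hp ?_
  have := star_left_conjugate_le_conjugate h K
  simpa only [star_mul, mul_assoc] using this

/-- `Tr |KA|^p` is monotone in `A A^*`. -/
theorem trp_mul_mono_right {p : ℝ} (hp : 0 < p) {A B : Op H} (h : A * star A ≤ B * star B)
    (K : Op H) : trp p (K * A) ≤ trp p (K * B) := by
  rw [← trp_star hp, ← trp_star hp (K * B), star_mul, star_mul]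
  exact trp_mul_mono_left hp.le (by simpa using h) _

theorem trp_real_smul {p : ℝ} (hp : 0 < p) {c : ℝ} (hc : 0 ≤ c) (K : Op H) :
    trp p (c • K) = c ^ p * trp p K := by
  have h1 : star (c • K) * (c • K) = (c ^ 2) • (star K * K) := by
    simp [smul_smul, sq]
  have hn : 0 ≤ star K * K := star_mul_self_nonneg K
  rw [trp_eq hp.le, trp_eq hp.le, h1, rpow_eq_cfc (smul_nonneg (sq_nonneg c) hn), rpow_eq_cfc hn,
    ← cfc_comp_const_mul (c ^ 2) (fun x : ℝ => x ^ (p / 2)) (star K * K)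
      ((((finite_spectrum (star K * K)).image _).continuousOn _))]
  have h2 : cfc (fun x : ℝ => (c ^ 2 * x) ^ (p / 2)) (star K * K) =
      cfc (fun x : ℝ => c ^ p * x ^ (p / 2)) (star K * K) := by
    refine cfc_congr fun x hx => ?_
    rw [Real.mul_rpow (sq_nonneg c) (spectrum_nonneg hn hx), ← Real.rpow_natCast,
      ← Real.rpow_mul hc]
    congr 2
    push_cast; ring
  rw [h2, cfc_const_mul_rpow hn, ← rpow_eq_cfc hn, tr_real_smul, Complex.re_ofReal_mul]

end Inequalities

/-! ### First-order expansions of `Tr |K|^p`. -/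

section Perturbation

variable {H : Type*} [NormedAddCommGroup H] [InnerProductSpace ℂ H] [CompleteSpace H]
  [FiniteDimensional ℂ H]

theorem exists_tr_bound : ∃ C : ℝ, 0 < C ∧ ∀ X : Op H, |(tr X).re| ≤ C * ‖X‖ := by
  let f : Op H →ₗ[ℂ] ℂ := { toFun := tr, map_add' := tr_add, map_smul' := tr_smul }
  obtain ⟨C, hC, h⟩ := (LinearMap.toContinuousLinearMap f).bound
  exact ⟨C, hC, fun X => (Complex.abs_re_le_norm _).trans (h X)⟩

theorem re_tr_isBigO {ι : Type*} {l : Filter ι} (X : ι → Op H) :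
    (fun i => (tr (X i)).re) =O[l] X := by
  obtain ⟨C, -, h⟩ := exists_tr_bound (H := H)
  exact IsBigO.of_bound C (Eventually.of_forall fun i => h _)

theorem rpow_eq_exp {K : Op H} (hK : IsStrictlyPositive K) (y : ℝ) :
    K ^ y = NormedSpace.exp (y • CFC.log K) := by
  have hl : IsSelfAdjoint (cfc (fun x : ℝ => y * Real.log x) K) := cfc_predicate _ K
  have h1 : cfc Real.exp (cfc (fun x : ℝ => y * Real.log x) K) =
      cfc (fun x : ℝ => Real.exp (y * Real.log x)) K :=
    (cfc_comp' Real.exp (fun x : ℝ => y * Real.log x) K Real.continuous_exp.continuousOn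
      (continuousOn_spectrum K _) hK.nonneg.isSelfAdjoint).symm
  have h2 : y • CFC.log K = cfc (fun x : ℝ => y * Real.log x) K :=
    (cfc_const_mul y Real.log K (continuousOn_spectrum K _)).symm
  rw [h2, ← CFC.real_exp_eq_normedSpace_exp hl, h1, rpow_eq_cfc hK.nonneg]
  refine cfc_congr fun x hx => ?_
  rw [Real.rpow_def_of_pos (spectrum_pos hK hx), mul_comm]

theorem continuous_exp : Continuous (NormedSpace.exp : Op H → Op H) := by
  let _ : NormedAlgebra ℚ (Op H) := NormedAlgebra.restrictScalars ℚ ℝ (Op H)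
  exact NormedSpace.exp_continuous

theorem strictlyPositive_exp {L : Op H} (hL : IsSelfAdjoint L) :
    IsStrictlyPositive (NormedSpace.exp L) := by
  let _ : NormedAlgebra ℚ (Op H) := NormedAlgebra.restrictScalars ℚ ℝ (Op H)
  exact IsUnit.isStrictlyPositive (NormedSpace.isUnit_exp L) hL.exp_nonneg

/-- Joint continuity in base and exponent, from `K ^ y = exp (y log K)`. -/
theorem tendsto_rpow {ι : Type*} {l : Filter ι} {K : ι → Op H} {K₀ : Op H} {y : ι → ℝ} {y₀ : ℝ}
    (hK : Tendsto K l (𝓝 K₀)) (hK₀ : IsStrictlyPositive K₀)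
    (hpos : ∀ᶠ i in l, IsStrictlyPositive (K i)) (hy : Tendsto y l (𝓝 y₀)) :
    Tendsto (fun i => K i ^ y i) l (𝓝 (K₀ ^ y₀)) := by
  have h1 : Tendsto (fun i => CFC.log (K i)) l (𝓝 (CFC.log K₀)) := by
    have hc := CFC.continuousOn_log (A := Op H) K₀ ⟨hK₀.nonneg.isSelfAdjoint, hK₀.isUnit⟩
    refine hc.tendsto.comp (tendsto_nhdsWithin_iff.2 ⟨hK, hpos.mono fun i hi => ?_⟩)
    exact ⟨hi.nonneg.isSelfAdjoint, hi.isUnit⟩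
  have h2 := (continuous_exp.tendsto _).comp (hy.smul h1)
  rw [rpow_eq_exp hK₀]
  exact h2.congr' (hpos.mono fun i hi => (rpow_eq_exp hi _).symm)

theorem eventually_strictlyPositive {ι : Type*} {l : Filter ι} {K : ι → Op H} {K₀ : Op H}
    (hK : Tendsto K l (𝓝 K₀)) (hK₀ : IsUnit K₀) (h : ∀ᶠ i in l, 0 ≤ K i) :
    ∀ᶠ i in l, IsStrictlyPositive (K i) := by
  filter_upwards [h, hK (Units.isOpen.mem_nhds hK₀)] with i h1 h2
  exact IsUnit.isStrictlyPositive h2 h1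

theorem strictlyPositive_star_mul_self {K : Op H} (hK : IsUnit K) :
    IsStrictlyPositive (star K * K) :=
  IsUnit.isStrictlyPositive (hK.star.mul hK) (star_mul_self_nonneg K)

/-- First order expansion of the trace of a power. -/
theorem tr_rpow_sub_isLittleO {ι : Type*} {l : Filter ι} {P Q : ι → Op H} {Q₀ : Op H}
    {θ : ι → ℝ} {θ₀ : ℝ} (hP : Tendsto P l (𝓝 Q₀)) (hQ : Tendsto Q l (𝓝 Q₀))
    (hQ₀ : IsStrictlyPositive Q₀) (hPpos : ∀ᶠ i in l, IsStrictlyPositive (P i))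
    (hQpos : ∀ᶠ i in l, IsStrictlyPositive (Q i)) (hθ : Tendsto θ l (𝓝 θ₀)) (hθ₀ : 0 < θ₀) :
    (fun i => (tr (P i ^ θ i)).re - (tr (Q i ^ θ i)).re
      - θ i * (tr (Q i ^ (θ i - 1) * (P i - Q i))).re) =o[l] fun i => P i - Q i := by
  have hθ1 : Tendsto (fun i => θ i - 1) l (𝓝 (θ₀ - 1)) := hθ.sub_const 1
  have h0 : Tendsto (fun i => P i ^ (θ i - 1) - Q i ^ (θ i - 1)) l (𝓝 0) := by
    simpa using (tendsto_rpow hP hQ₀ hPpos hθ1).sub (tendsto_rpow hQ hQ₀ hQpos hθ1)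
  have h1 : (fun i => θ i * (tr ((P i ^ (θ i - 1) - Q i ^ (θ i - 1)) * (P i - Q i))).re)
      =o[l] fun i => P i - Q i := by
    have ha : (fun i => (tr ((P i ^ (θ i - 1) - Q i ^ (θ i - 1)) * (P i - Q i))).re)
        =o[l] fun i => P i - Q i := by
      refine (re_tr_isBigO _).trans_isLittleO ?_
      have hb : (fun i => (P i ^ (θ i - 1) - Q i ^ (θ i - 1)) * (P i - Q i)) =O[l]
          fun i => ‖P i ^ (θ i - 1) - Q i ^ (θ i - 1)‖ * ‖P i - Q i‖ :=
        IsBigO.of_bound 1 (Eventually.of_forall fun i => by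
          rw [one_mul, Real.norm_of_nonneg (by positivity)]; exact norm_mul_le _ _)
      refine hb.trans_isLittleO ?_
      have hc : (fun i => ‖P i ^ (θ i - 1) - Q i ^ (θ i - 1)‖) =o[l] fun _ => (1 : ℝ) :=
        (isLittleO_one_iff ℝ).2 (by simpa using h0.norm)
      simpa using (hc.mul_isBigO (isBigO_refl (fun i => ‖P i - Q i‖) l)).norm_right
    simpa using ((hθ.isBigO_one ℝ).mul_isLittleO ha.norm_right).norm_right
  -- Klein's inequality with base point `Q` and again with base point `P` traps the remainder
  -- between `0` and `θ Tr((P^{θ-1} - Q^{θ-1})(P - Q))`. Thus continuity of the power suffices and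
  -- no operator derivative is needed. The signs flip with the convexity of `x ^ θ`.
  refine IsBigO.trans_isLittleO (IsBigO.of_bound 1 ?_) h1
  filter_upwards [hPpos, hQpos, hθ.eventually_const_lt hθ₀] with i hPi hQi hi
  rw [one_mul, Real.norm_eq_abs, Real.norm_eq_abs, sub_mul, tr_sub, Complex.sub_re]
  set D := (tr (P i ^ θ i)).re - (tr (Q i ^ θ i)).re
  have hneg : (tr (P i ^ (θ i - 1) * (Q i - P i))).re = -(tr (P i ^ (θ i - 1) * (P i - Q i))).re := by
    rw [← neg_sub (P i), mul_neg, tr_neg, Complex.neg_re]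
  set a := (tr (Q i ^ (θ i - 1) * (P i - Q i))).re
  set b := (tr (P i ^ (θ i - 1) * (P i - Q i))).re
  rcases le_total 1 (θ i) with h | h
  · have e1 := klein_rpow_convex hPi.nonneg hQi.nonneg h
    have e2 := klein_rpow_convex hQi.nonneg hPi.nonneg h
    rw [hneg] at e2
    rw [abs_of_nonneg (by linarith), abs_of_nonneg (by linarith)]
    linarith
  · have e1 := klein_rpow_concave hPi.nonneg hQi hi.le h
    have e2 := klein_rpow_concave hQi.nonneg hPi hi.le h
    rw [hneg] at e2
    rw [abs_of_nonpos (by linarith), abs_of_nonpos (by linarith)]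
    linarith

/-- The change of exponent at fixed base is an exponential derivative; the change of base at
exponent `p t` is the Klein expansion. -/
theorem hasDerivWithinAt_trp {T : Set ℝ} (h0 : (0 : ℝ) ∈ T) {M : ℝ → Op H} {M' : Op H} {p : ℝ → ℝ} {p' : ℝ}
    (hM : HasDerivWithinAt M M' T 0) (hp : HasDerivWithinAt p p' T 0)
    (hpos : ∀ᶠ t in 𝓝[T] 0, IsStrictlyPositive (M t)) (hp0 : 0 < p 0) :
    HasDerivWithinAt (fun t => trp (p t) (M t))
      (p' * (tr (M 0 ^ p 0 * CFC.log (M 0))).re + p 0 * (tr (M 0 ^ (p 0 - 1) * M')).re) T 0 := by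
  have hM0 : IsStrictlyPositive (M 0) := hpos.self_of_nhdsWithin h0
  have hMt : Tendsto M (𝓝[T] 0) (𝓝 (M 0)) := hM.continuousWithinAt
  have hpt : Tendsto p (𝓝[T] 0) (𝓝 (p 0)) := hp.continuousWithinAt
  have e1 := tr_rpow_sub_isLittleO hMt tendsto_const_nhds hM0 hpos
    (Eventually.of_forall fun _ => hM0) hpt hp0
  have hO : (fun t => M t - M 0) =O[𝓝[T] 0] fun t => t - 0 :=
    hM.isBigO_sub.comp_tendsto (tendsto_id.prodMk tendsto_const_pure)
  have e2 := e1.trans_isBigO hO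
  have hexp : HasDerivAt (fun y : ℝ => M 0 ^ y) (M 0 ^ p 0 * CFC.log (M 0)) (p 0) := by
    have := hasDerivAt_exp_smul_const (𝕂 := ℝ) (CFC.log (M 0)) (p 0)
    simpa only [← rpow_eq_exp hM0] using this
  let trL : Op H →L[ℝ] ℝ := LinearMap.toContinuousLinearMap
    { toFun := fun X : Op H => (tr X).re
      map_add' := fun X Y => by simp [tr_add]
      map_smul' := fun c X => by simp [tr_real_smul] }
  have htr : ∀ X, trL X = (tr X).re := fun X => rfl
  have d1 : HasDerivWithinAt (fun t => (tr (M 0 ^ p t)).re)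
      (p' * (tr (M 0 ^ p 0 * CFC.log (M 0))).re) T 0 := by
    have := trL.hasFDerivAt.comp_hasDerivWithinAt (0 : ℝ) (hexp.scomp_hasDerivWithinAt (0 : ℝ) hp)
    simpa [htr, Function.comp_def, tr_real_smul] using this
  -- The factor `M t - M 0` vanishes at `0`, so the derivatives of the other factors do not
  -- contribute.
  have d2 : HasDerivWithinAt (fun t => p t * (tr (M 0 ^ (p t - 1) * (M t - M 0))).re)
      (p 0 * (tr (M 0 ^ (p 0 - 1) * M')).re) T 0 := by
    have hB : HasDerivWithinAt (fun t => M 0 ^ (p t - 1)) (p' • (M 0 ^ (p 0 - 1) * CFC.log (M 0))) T 0 := by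
      have := hasDerivAt_exp_smul_const (𝕂 := ℝ) (CFC.log (M 0)) (p 0 - 1)
      simp only [← rpow_eq_exp hM0] at this
      exact this.scomp_hasDerivWithinAt (0 : ℝ) (hp.sub_const 1)
    have := hp.mul (trL.hasFDerivAt.comp_hasDerivWithinAt (0 : ℝ) (hB.mul (hM.sub_const (M 0))))
    simpa [htr, Function.comp_def, tr_zero, Pi.mul_def] using this
  have d3 := d1.add d2
  rw [hasDerivWithinAt_iff_isLittleO] at d3 ⊢
  refine (d3.add e2).congr' ?_ (by rfl)
  filter_upwards [hpos] with t ht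
  simp only [Pi.add_apply, trp_of_nonneg ht.nonneg, trp_of_nonneg hM0.nonneg, sub_self, mul_zero, tr_zero, Complex.zero_re, smul_eq_mul]
  ring

end Perturbation

section Perturbation

variable {H : Type*} [NormedAddCommGroup H] [InnerProductSpace ℂ H] [CompleteSpace H]
  [FiniteDimensional ℂ H]

theorem rpow_mul_rpow {M : Op H} (hM : IsStrictlyPositive M) (x y : ℝ) :
    M ^ x * M ^ y = M ^ (x + y) := (CFC.rpow_add hM.isUnit).symm

theorem rpow_mul_self {M : Op H} (hM : IsStrictlyPositive M) (x : ℝ) :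
    M ^ x * M = M ^ (x + 1) := by
  rw [← rpow_mul_rpow hM, CFC.rpow_one M hM.nonneg]

theorem self_mul_rpow {M : Op H} (hM : IsStrictlyPositive M) (x : ℝ) :
    M * M ^ x = M ^ (x + 1) := by
  rw [add_comm, ← rpow_mul_rpow hM, CFC.rpow_one M hM.nonneg]

theorem mul_self_rpow {M : Op H} (hM : IsStrictlyPositive M) (x : ℝ) :
    (M * M) ^ x = M ^ (2 * x) := by
  have h : M * M = M ^ (2 : ℝ) := by
    rw [← one_add_one_eq_two, ← rpow_mul_rpow hM, CFC.rpow_one M hM.nonneg]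
  rw [h, CFC.rpow_rpow M 2 x two_ne_zero hM]

theorem norm_mul_isBigO {ι : Type*} {l : Filter ι} (X Y : ι → Op H) :
    (fun i => X i * Y i) =O[l] fun i => ‖X i‖ * ‖Y i‖ :=
  IsBigO.of_bound 1 (Eventually.of_forall fun i => by
    rw [one_mul, Real.norm_of_nonneg (by positivity)]; exact norm_mul_le _ _)

/-- First order expansion of `Tr |K|^p` at a positive definite operator, where `K` need not be
self-adjoint. -/
theorem trp_sub_isLittleO {ι : Type*} {l : Filter ι} {K M : ι → Op H} {M₀ : Op H}
    {p : ι → ℝ} {q : ℝ} (hK : Tendsto K l (𝓝 M₀)) (hM : Tendsto M l (𝓝 M₀))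
    (hM₀ : IsStrictlyPositive M₀) (hpos : ∀ᶠ i in l, IsStrictlyPositive (M i))
    (hp : Tendsto p l (𝓝 q)) (hq : 0 < q) :
    (fun i => trp (p i) (K i) - trp (p i) (M i)
      - p i * (tr (M i ^ (p i - 1) * (K i - M i))).re) =o[l] fun i => K i - M i := by
  have hMM : IsStrictlyPositive (M₀ * M₀) := by
    have := strictlyPositive_star_mul_self hM₀.isUnit
    rwa [hM₀.nonneg.isSelfAdjoint.star_eq] at this
  have hKK : Tendsto (fun i => star (K i) * K i) l (𝓝 (M₀ * M₀)) := by
    have := hK.star.mul hK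
    rwa [hM₀.nonneg.isSelfAdjoint.star_eq] at this
  have hKpos : ∀ᶠ i in l, IsStrictlyPositive (star (K i) * K i) :=
    eventually_strictlyPositive hKK hMM.isUnit (Eventually.of_forall fun i => star_mul_self_nonneg _)
  have hMpos : ∀ᶠ i in l, IsStrictlyPositive (M i * M i) := hpos.mono fun i hi => by
    have := strictlyPositive_star_mul_self hi.isUnit
    rwa [hi.nonneg.isSelfAdjoint.star_eq] at this
  -- As `|K|^p = (K^*K)^{p/2}`, the positive case applies to `K^*K` and `M²` with exponent `p/2`.
  have e1 := tr_rpow_sub_isLittleO hKK (hM.mul hM) hMM hKpos hMpos (hp.div_const 2) (half_pos hq)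
  have hD : Tendsto (fun i => K i - M i) l (𝓝 0) := by simpa using hK.sub hM
  have hDo : (fun i => ‖K i - M i‖) =o[l] fun _ => (1 : ℝ) :=
    (isLittleO_one_iff ℝ).2 (by simpa using hD.norm)
  have e2 : (fun i => star (K i) * K i - M i * M i) =O[l] fun i => K i - M i := by
    have h1 : (fun i => star (K i) * (K i - M i)) =O[l] fun i => K i - M i := by
      refine (norm_mul_isBigO _ _).trans ?_
      simpa using ((hK.star.norm.isBigO_one ℝ).mul (isBigO_refl (fun i => ‖K i - M i‖) l)).norm_right
    have h2 : (fun i => star (K i - M i) * M i) =O[l] fun i => K i - M i := by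
      refine (norm_mul_isBigO _ _).trans ?_
      simp only [norm_star]
      simpa using ((isBigO_refl (fun i => ‖K i - M i‖) l).mul (hM.norm.isBigO_one ℝ)).norm_right
    refine (h1.add h2).congr' ?_ (by rfl)
    filter_upwards [hpos] with i hi
    rw [star_sub, hi.nonneg.isSelfAdjoint.star_eq]
    noncomm_ring
  have e3 : (fun i => p i / 2 * (tr (M i ^ (p i - 2) * (star (K i - M i) * (K i - M i)))).re)
      =o[l] fun i => K i - M i := by
    have h1 : (fun i => (tr (M i ^ (p i - 2) * (star (K i - M i) * (K i - M i)))).re)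
        =o[l] fun i => K i - M i := by
      refine (re_tr_isBigO _).trans_isLittleO ((norm_mul_isBigO _ _).trans_isLittleO ?_)
      have h2 : (fun i => ‖star (K i - M i) * (K i - M i)‖) =o[l] fun i => K i - M i := by
        refine ((norm_mul_isBigO _ _).norm_left).trans_isLittleO ?_
        simp only [norm_star]
        simpa using (hDo.mul_isBigO (isBigO_refl (fun i => ‖K i - M i‖) l)).norm_right
      have h3 := (tendsto_rpow hM hM₀ hpos (hp.sub_const 2)).norm.isBigO_one ℝ
      simpa using (h3.mul_isLittleO h2.norm_right).norm_right
    simpa using (((hp.div_const 2).isBigO_one ℝ).mul_isLittleO h1.norm_right).norm_right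
  refine ((e1.trans_isBigO e2).add e3).congr' ?_ (by rfl)
  filter_upwards [hpos, hp.eventually_const_lt hq] with i hi hpi
  have hs : star (M i) = M i := hi.nonneg.isSelfAdjoint.star_eq
  have a1 : trp (p i) (M i) = (tr ((M i * M i) ^ (p i / 2))).re := by
    rw [trp_eq hpi.le, hs]
  have a2 : (M i * M i) ^ (p i / 2 - 1) = M i ^ (p i - 2) := by
    rw [mul_self_rpow hi]; congr 1; ring
  have a3 : star (K i) * K i - M i * M i = star (K i - M i) * M i + M i * (K i - M i)
      + star (K i - M i) * (K i - M i) := by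
    rw [star_sub, hs]; noncomm_ring
  have a4 : (tr (M i ^ (p i - 2) * (M i * (K i - M i)))).re =
      (tr (M i ^ (p i - 1) * (K i - M i))).re := by
    rw [← mul_assoc, rpow_mul_self hi]; congr 4; ring
  -- Taking real parts lets the adjoint be removed, so the two linear terms of `K^*K - M²` agree and
  -- compensate the factor `1/2` in the exponent.
  have a5 : (tr (M i ^ (p i - 2) * (star (K i - M i) * M i))).re =
      (tr (M i ^ (p i - 1) * (K i - M i))).re := by
    rw [← mul_assoc, tr_mul_comm, ← mul_assoc, self_mul_rpow hi, ← re_tr_star, star_mul, star_star,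
      (CFC.rpow_nonneg (a := M i)).isSelfAdjoint.star_eq, tr_mul_comm]
    congr 4; ring
  simp only [a2]
  rw [a1, trp_eq hpi.le, a3, mul_add, mul_add, tr_add, tr_add, Complex.add_re, Complex.add_re, a4,
    a5]
  ring

theorem exp_sub_one_isLittleO {ι : Type*} {l : Filter ι} {s : ι → ℝ} {L : ι → Op H} {C : ℝ}
    (hs : Tendsto s l (𝓝 0)) (hL : ∀ᶠ i in l, ‖L i‖ ≤ C) :
    (fun i => NormedSpace.exp (s i • L i) - 1 - s i • L i) =o[l] s := by
  have hO : (fun i => s i • L i) =O[l] s := IsBigO.of_bound C (hL.mono fun i hi => by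
    rw [norm_smul, mul_comm]; gcongr)
  have ht : Tendsto (fun i => s i • L i) l (𝓝 0) := hO.trans_tendsto hs
  have h := (hasFDerivAt_iff_isLittleO.1 (hasFDerivAt_exp_zero (𝕂 := ℝ) (𝔸 := Op H))).comp_tendsto ht
  refine IsLittleO.trans_isBigO (h.congr_left fun i => ?_) (hO.congr_left fun i => ?_)
  · simp
  · simp

/-- The effect of a small two-sided multiplicative perturbation on `Tr |M|^p`, uniformly for
generators in a bounded set. -/
theorem trp_exp_conj_isLittleO {ι : Type*} {l : Filter ι} {M L L' : ι → Op H} {M₀ : Op H}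
    {p s : ι → ℝ} {q C : ℝ} (hM : Tendsto M l (𝓝 M₀))
    (hM₀ : IsStrictlyPositive M₀) (hpos : ∀ᶠ i in l, IsStrictlyPositive (M i))
    (hp : Tendsto p l (𝓝 q)) (hq : 0 < q) (hs : Tendsto s l (𝓝 0))
    (hL : ∀ᶠ i in l, ‖L i‖ ≤ C) (hL' : ∀ᶠ i in l, ‖L' i‖ ≤ C) :
    (fun i => trp (p i) (NormedSpace.exp (s i • L i) * M i * NormedSpace.exp (s i • L' i))
      - trp (p i) (M i) - q * s i * (tr (M₀ ^ q * (L i + L' i))).re) =o[l] s := by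
  set K := fun i => NormedSpace.exp (s i • L i) * M i * NormedSpace.exp (s i • L' i) with hKdef
  have hb : ∀ {X : ι → Op H}, (∀ᶠ i in l, ‖X i‖ ≤ C) → X =O[l] fun _ => (1 : ℝ) := fun h =>
    IsBigO.of_bound C (h.mono fun i hi => by simpa using hi)
  have r1 := exp_sub_one_isLittleO hs hL
  have r2 := exp_sub_one_isLittleO hs hL'
  have b1 := hb hL
  have b2 := hb hL'
  have mulO : ∀ {X Y : ι → Op H} {f g : ι → ℝ}, X =O[l] f → Y =O[l] g →
      (fun i => X i * Y i) =O[l] fun i => f i * g i := fun h1 h2 =>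
    (norm_mul_isBigO _ _).trans (h1.norm_left.mul h2.norm_left)
  have mulo : ∀ {X Y : ι → Op H} {f g : ι → ℝ}, X =o[l] f → Y =O[l] g →
      (fun i => X i * Y i) =o[l] fun i => f i * g i := fun h1 h2 =>
    (norm_mul_isBigO _ _).trans_isLittleO (h1.norm_left.mul_isBigO h2.norm_left)
  have mulo' : ∀ {X Y : ι → Op H} {f g : ι → ℝ}, X =O[l] f → Y =o[l] g →
      (fun i => X i * Y i) =o[l] fun i => f i * g i := fun h1 h2 =>
    (norm_mul_isBigO _ _).trans_isLittleO (h1.norm_left.mul_isLittleO h2.norm_left)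
  have sO : ∀ {X : ι → Op H}, X =O[l] (fun _ => (1 : ℝ)) → (fun i => s i • X i) =O[l] s := fun h => by
    simpa using (isBigO_refl s l).smul h
  have so : ∀ {X : ι → Op H}, X =o[l] (fun _ => (1 : ℝ)) → (fun i => s i • X i) =o[l] s := fun h => by
    simpa using (isBigO_refl s l).smul_isLittleO h
  have hMb : M =O[l] fun _ => (1 : ℝ) := hM.isBigO_one ℝ
  have hMo : (fun i => M i - M₀) =o[l] fun _ => (1 : ℝ) :=
    (isLittleO_one_iff ℝ).2 (by simpa using hM.sub_const M₀)
  have hso : s =o[l] fun _ => (1 : ℝ) := (isLittleO_one_iff ℝ).2 hs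
  have E1 : (fun i => NormedSpace.exp (s i • L i) - 1) =O[l] s :=
    (r1.isBigO.add (sO b1)).congr_left fun i => by abel
  have E2 : (fun i => NormedSpace.exp (s i • L' i) - 1) =O[l] s :=
    (r2.isBigO.add (sO b2)).congr_left fun i => by abel
  -- The error is a sum of five pieces: the product of both exponential increments, the two
  -- second-order remainders, and the two errors from replacing `M i` by `M₀` in the linear terms.
  have hΔ : (fun i => K i - M i - s i • (L i * M₀ + M₀ * L' i)) =o[l] s := by
    have t1 : (fun i => (NormedSpace.exp (s i • L i) - 1) * M i *
        (NormedSpace.exp (s i • L' i) - 1)) =o[l] s := by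
      have h1 := mulO E1 hMb
      have h2 : (fun i => NormedSpace.exp (s i • L' i) - 1) =o[l] fun _ => (1 : ℝ) :=
        E2.trans_isLittleO hso
      simpa using mulo' h1 h2
    have t2 : (fun i => (NormedSpace.exp (s i • L i) - 1 - s i • L i) * M i) =o[l] s := by
      simpa using mulo r1 hMb
    have t3 : (fun i => M i * (NormedSpace.exp (s i • L' i) - 1 - s i • L' i)) =o[l] s := by
      simpa using mulo' hMb r2
    have t4 : (fun i => s i • (L i * (M i - M₀))) =o[l] s := so (by simpa using mulo' b1 hMo)
    have t5 : (fun i => s i • ((M i - M₀) * L' i)) =o[l] s := so (by simpa using mulo hMo b2)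
    refine ((((t1.add t2).add t3).add t4).add t5).congr_left fun i => ?_
    simp only [hKdef, smul_add, mul_sub, sub_mul, smul_sub, mul_smul_comm, smul_mul_assoc, one_mul,
      mul_one]
    abel
  have hBb : (fun i => L i * M₀ + M₀ * L' i) =O[l] fun _ => (1 : ℝ) := by
    have c : (fun _ => M₀) =O[l] fun _ => (1 : ℝ) := isBigO_const_const _ one_ne_zero _
    simpa using (mulO b1 c).add (mulO c b2)
  have hΔO : (fun i => K i - M i) =O[l] s :=
    (hΔ.isBigO.add (sO hBb)).congr_left fun i => by abel
  have hK : Tendsto K l (𝓝 M₀) := by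
    have := (hΔO.trans_tendsto hs).add hM
    simpa using this
  have e1 := (trp_sub_isLittleO hK hM hM₀ hpos hp hq).trans_isBigO hΔO
  have hMp := tendsto_rpow hM hM₀ hpos (hp.sub_const 1)
  have e2 : (fun i => p i * (tr (M i ^ (p i - 1) *
      (K i - M i - s i • (L i * M₀ + M₀ * L' i)))).re) =o[l] s := by
    have h1 := (re_tr_isBigO _).trans_isLittleO (mulo' (hMp.isBigO_one ℝ) hΔ)
    simpa using (hp.isBigO_one ℝ).mul_isLittleO h1
  have e3 : (fun i => s i * (tr ((p i • M i ^ (p i - 1) - q • M₀ ^ (q - 1)) *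
      (L i * M₀ + M₀ * L' i))).re) =o[l] s := by
    have h0 : (fun i => p i • M i ^ (p i - 1) - q • M₀ ^ (q - 1)) =o[l] fun _ => (1 : ℝ) :=
      (isLittleO_one_iff ℝ).2 (by simpa using (hp.smul hMp).sub_const (q • M₀ ^ (q - 1)))
    have h1 := (re_tr_isBigO _).trans_isLittleO (mulo h0 hBb)
    simpa using (isBigO_refl s l).mul_isLittleO h1
  refine ((e1.add e2).add e3).congr_left fun i => ?_
  have a1 : (tr (M₀ ^ (q - 1) * (L i * M₀ + M₀ * L' i))).re = (tr (M₀ ^ q * (L i + L' i))).re := by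
    rw [mul_add, mul_add, tr_add, tr_add, ← mul_assoc, tr_mul_comm, ← mul_assoc, ← mul_assoc,
      self_mul_rpow hM₀, rpow_mul_self hM₀, sub_add_cancel]
  simp only [mul_sub, sub_mul, tr_sub, Complex.sub_re, mul_smul_comm, smul_mul_assoc, tr_real_smul,
    Complex.re_ofReal_mul, a1]
  ring

end Perturbation

/-! ### Kadison–Schwarz inequality and multiplicative domains. -/

section CompletelyPositive

variable {H : Type*} [NormedAddCommGroup H] [InnerProductSpace ℂ H] [CompleteSpace H]

theorem exists_eq_star_mul_self {A : Type*} [CStarAlgebra A] [PartialOrder A] [StarOrderedRing A]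
    {a : A} (ha : 0 ≤ a) : ∃ b, a = star b * b :=
  CStarAlgebra.nonneg_iff_eq_star_mul_self.1 ha

theorem isClosed_nonneg {A : Type*} [CStarAlgebra A] [PartialOrder A] [StarOrderedRing A] :
    IsClosed {a : A | 0 ≤ a} := isClosed_Ici

/-- Positivity of the image of the 2×2 matrix with entries `v_i^* v_j`, `v = (1, X)`:
self-adjointness of the image gives the first claim, and its Schur complement gives the second. -/
theorem IsCompletelyPositive.schwarz_aux {Φ : Op H →ₗ[ℂ] Op H} (h : IsCompletelyPositive Φ)
    (h1 : Φ 1 = 1) (X : Op H) :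
    star (Φ X) = Φ (star X) ∧ star (Φ X) * Φ X ≤ Φ (star X * X) := by
  obtain ⟨φ, rfl⟩ := h
  let v : Fin 2 → Op H := ![1, X]
  let N : CStarMatrix (Fin 2) (Fin 2) (Op H) :=
    CStarMatrix.ofMatrix (Matrix.of fun i j => if i = 0 then v j else 0)
  have hN : 0 ≤ star N * N := star_mul_self_nonneg N
  have hM := φ.map_cstarMatrix_nonneg' 2 _ hN
  have hent : ∀ i j, ((star N * N).map φ.toLinearMap) i j = φ.toLinearMap (star (v i) * v j) := by
    intro i j
    rw [CStarMatrix.map_apply, CStarMatrix.mul_apply, Fin.sum_univ_two, CStarMatrix.star_apply,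
      CStarMatrix.star_apply]
    simp [N, CStarMatrix.ofMatrix_apply]
  have hstar : star (φ.toLinearMap X) = φ.toLinearMap (star X) := by
    have hsa := hM.isSelfAdjoint.star_eq
    have := congrFun (congrFun hsa 1) 0
    rw [CStarMatrix.star_apply, hent, hent] at this
    simpa [v] using this
  refine ⟨hstar, ?_⟩
  obtain ⟨B, hB⟩ := exists_eq_star_mul_self hM
  have hentB : ∀ i j, φ.toLinearMap (star (v i) * v j) =
      star (B 0 i) * B 0 j + star (B 1 i) * B 1 j := by
    intro i j
    rw [← hent, hB, CStarMatrix.mul_apply, Fin.sum_univ_two, CStarMatrix.star_apply,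
      CStarMatrix.star_apply]
  have e00 := hentB 0 0
  have e01 := hentB 0 1
  have e10 := hentB 1 0
  have e11 := hentB 1 1
  simp only [v, Matrix.cons_val_zero, Matrix.cons_val_one, star_one, one_mul, mul_one, h1]
    at e00 e01 e10 e11
  set T := φ.toLinearMap X
  -- With the image written as `B^*B` and upper left entry `1`, the Schur complement is this sum of
  -- squares.
  have hpos : 0 ≤ star (B 0 1 - B 0 0 * T) * (B 0 1 - B 0 0 * T) +
      star (B 1 1 - B 1 0 * T) * (B 1 1 - B 1 0 * T) :=
    add_nonneg (star_mul_self_nonneg _) (star_mul_self_nonneg _)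
  rw [← sub_nonneg]
  convert hpos using 1
  have hx : star (B 0 1 - B 0 0 * T) * (B 0 1 - B 0 0 * T) +
      star (B 1 1 - B 1 0 * T) * (B 1 1 - B 1 0 * T) =
      (star (B 0 1) * B 0 1 + star (B 1 1) * B 1 1) -
      (star (B 0 1) * B 0 0 + star (B 1 1) * B 1 0) * T -
      star T * (star (B 0 0) * B 0 1 + star (B 1 0) * B 1 1) +
      star T * (star (B 0 0) * B 0 0 + star (B 1 0) * B 1 0) * T := by
    simp only [star_sub, star_mul]; noncomm_ring
  rw [hx, ← e00, ← e01, ← e10, ← e11, ← hstar]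
  noncomm_ring

theorem IsCompletelyPositive.map_star {Φ : Op H →ₗ[ℂ] Op H} (h : IsCompletelyPositive Φ)
    (h1 : Φ 1 = 1) (X : Op H) : Φ (star X) = star (Φ X) := (h.schwarz_aux h1 X).1.symm

/-- The Kadison–Schwarz inequality. -/
theorem IsCompletelyPositive.kadison_schwarz {Φ : Op H →ₗ[ℂ] Op H} (h : IsCompletelyPositive Φ)
    (h1 : Φ 1 = 1) (X : Op H) : star (Φ X) * Φ X ≤ Φ (star X * X) := (h.schwarz_aux h1 X).2

theorem IsCompletelyPositive.map_nonneg {Φ : Op H →ₗ[ℂ] Op H} (h : IsCompletelyPositive Φ)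
    (h1 : Φ 1 = 1) {X : Op H} (hX : 0 ≤ X) : 0 ≤ Φ X := by
  obtain ⟨B, rfl⟩ := CStarAlgebra.nonneg_iff_eq_star_mul_self.1 hX
  exact (star_mul_self_nonneg _).trans (h.kadison_schwarz h1 B)

theorem IsCompletelyPositive.norm_map_le {Φ : Op H →ₗ[ℂ] Op H} (h : IsCompletelyPositive Φ)
    (h1 : Φ 1 = 1) (X : Op H) : ‖Φ X‖ ≤ ‖X‖ := by
  have e1 : star X * X ≤ algebraMap ℝ (Op H) (‖X‖ ^ 2) := CStarAlgebra.star_mul_le_algebraMap_norm_sq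
  have e2 : Φ (star X * X) ≤ algebraMap ℝ (Op H) (‖X‖ ^ 2) := by
    have := h.map_nonneg h1 (sub_nonneg.2 e1)
    rw [map_sub, Algebra.algebraMap_eq_smul_one, LinearMapClass.map_smul_of_tower, h1] at this
    rw [Algebra.algebraMap_eq_smul_one]
    exact sub_nonneg.1 this
  have e3 := (h.kadison_schwarz h1 X).trans e2
  have e4 := (CStarAlgebra.norm_le_iff_le_algebraMap _ (sq_nonneg ‖X‖) (star_mul_self_nonneg _)).2 e3
  rw [CStarRing.norm_star_mul_self, ← sq] at e4
  exact (sq_le_sq₀ (norm_nonneg _) (norm_nonneg _)).1 e4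

/-- Elements that saturate the Kadison–Schwarz inequality are in the multiplicative domain. -/
theorem IsCompletelyPositive.map_mul_of_schwarz_eq {Φ : Op H →ₗ[ℂ] Op H}
    (h : IsCompletelyPositive Φ) (h1 : Φ 1 = 1) {A : Op H}
    (hA : Φ (star A * A) = star (Φ A) * Φ A) (Y : Op H) : Φ (Y * A) = Φ Y * Φ A := by
  set X := star Y
  have hY : Y = star X := by simp [X]
  rw [hY, h.map_star h1]
  set D := Φ (star X * A) - star (Φ X) * Φ A with hD
  have hDs : star D = Φ (star A * X) - star (Φ A) * Φ X := by
    rw [hD, star_sub, ← h.map_star h1]; simp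
  -- In the Schwarz inequality for `X + c A` the `|c|²` terms cancel since `A` saturates it. What
  -- remains is affine in `c` over the reals and bounded below, which forces `D = 0`.
  have key : ∀ c : ℂ, 0 ≤ (Φ (star X * X) - star (Φ X) * Φ X) + (c • D + star (c • D)) := by
    intro c
    have := sub_nonneg.2 (h.kadison_schwarz h1 (X + c • A))
    convert this using 1
    rw [star_smul, hDs, hD]
    simp only [star_smul, star_add, map_add, map_smul, mul_add, add_mul, smul_mul_assoc,
      mul_smul_comm, smul_sub, smul_add, hA]
    abel
  rw [← sub_eq_zero, ← hD]
  refine ContinuousLinearMap.coe_injective ?_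
  refine (inner_map_self_eq_zero _).1 fun v => ?_
  by_contra hne
  set b : ℂ := inner ℂ v (D v) with hb
  have hb0 : b ≠ 0 := by
    intro h0
    apply hne
    have : inner ℂ ((D : H →ₗ[ℂ] H) v) v = star b := by rw [hb]; simp
    rw [this, h0, star_zero]
  set a := (inner ℂ v ((Φ (star X * X) - star (Φ X) * Φ X) v) : ℂ).re
  have key2 : ∀ c : ℂ, 0 ≤ a + 2 * (c * b).re := by
    intro c
    have := ((ContinuousLinearMap.nonneg_iff_isPositive _).1 (key c)).re_inner_nonneg_right v
    rw [_root_.add_apply, inner_add_right, _root_.add_apply, inner_add_right] at this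
    have hadj : inner ℂ v ((star (c • D)) v) = inner ℂ ((c • D) v) v := by
      rw [ContinuousLinearMap.star_eq_adjoint, ContinuousLinearMap.adjoint_inner_right]
    rw [hadj, ← inner_conj_symm ((c • D) v) v] at this
    simp only [_root_.smul_apply, inner_smul_right, ← hb] at this
    simp only [RCLike.re_to_complex, Complex.add_re, Complex.conj_re] at this
    simp only [a]
    linarith
  -- This `c` makes `c * b` equal to `-(|a| + 1)`.
  have h3 := key2 (-((|a| + 1 : ℝ) : ℂ) * (star b / (‖b‖ ^ 2 : ℝ)))
  have h4 : star b * b = ((‖b‖ ^ 2 : ℝ) : ℂ) := by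
    have := Complex.conj_mul' b
    push_cast
    exact this
  have h5 : (-((|a| + 1 : ℝ) : ℂ) * (star b / (‖b‖ ^ 2 : ℝ))) * b = ((-(|a| + 1) : ℝ) : ℂ) := by
    rw [mul_assoc, div_mul_eq_mul_div, h4, div_self, mul_one, Complex.ofReal_neg]
    exact_mod_cast (pow_pos (norm_pos_iff.2 hb0) 2).ne'
  rw [h5, Complex.ofReal_re] at h3
  have := le_abs_self a
  have := abs_nonneg a
  linarith

theorem isCompletelyPositive_of_tendsto {Ψ : ℕ → Op H →ₗ[ℂ] Op H} {Φ : Op H →ₗ[ℂ] Op H}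
    (h : ∀ k, IsCompletelyPositive (Ψ k))
    (hlim : ∀ X, Tendsto (fun k => Ψ k X) atTop (𝓝 (Φ X))) : IsCompletelyPositive Φ := by
  refine ⟨{ Φ with map_cstarMatrix_nonneg' := fun n M hM => ?_ }, rfl⟩
  have hcl : IsClosed {x : CStarMatrix (Fin n) (Fin n) (Op H) | 0 ≤ x} :=
    DFNorm.isClosed_nonneg
  have ht : Tendsto (fun k => M.map (Ψ k)) atTop (𝓝 (M.map Φ)) :=
    tendsto_pi_nhds.2 fun i => tendsto_pi_nhds.2 fun j => hlim _
  refine hcl.mem_of_tendsto ht (Eventually.of_forall fun k => ?_)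
  · obtain ⟨φ, hφ⟩ := h k
    rw [← hφ]
    exact φ.map_cstarMatrix_nonneg' n M hM

end CompletelyPositive

/-! ### Faithfulness and the GNS norm. -/

section Faithful

variable {H : Type*} [NormedAddCommGroup H] [InnerProductSpace ℂ H] [CompleteSpace H]
  [FiniteDimensional ℂ H]

theorem eq_zero_of_re_tr_mul {ω D : Op H} (hω : IsStrictlyPositive ω) (hD : 0 ≤ D)
    (h : (tr (ω * D)).re ≤ 0) : D = 0 := by
  obtain ⟨B, rfl⟩ := CStarAlgebra.nonneg_iff_eq_star_mul_self.1 hD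
  obtain ⟨C, rfl⟩ := CStarAlgebra.nonneg_iff_eq_star_mul_self.1 hω.nonneg
  have h1 : (tr (star (C * star B) * (C * star B))).re ≤ 0 := by
    convert h using 2
    rw [star_mul, star_star, tr_mul_comm (star C * C)]
    simp only [mul_assoc]
    rw [tr_mul_comm (star B)]
    simp only [mul_assoc]
  have h2 : star C * C * star B = 0 := by
    rw [mul_assoc, eq_zero_of_re_tr_star_mul_self h1, mul_zero]
  have h3 : star B = 0 := (hω.isUnit.mul_right_eq_zero).1 h2
  rw [h3, zero_mul]

/-- The square of the GNS norm. -/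
def gns (ω X : Op H) : ℝ := (tr (ω * (star X * X))).re

theorem continuous_gns (ω : Op H) : Continuous (gns ω) := by
  unfold gns
  exact Complex.continuous_re.comp (continuous_tr.comp (by fun_prop))

theorem eq_zero_of_gns {ω X : Op H} (hω : IsStrictlyPositive ω) (h : gns ω X ≤ 0) : X = 0 := by
  have := eq_zero_of_re_tr_mul hω (star_mul_self_nonneg X) h
  exact (CStarRing.star_mul_self_eq_zero_iff X).1 this

end Faithful

/-! ### The decoherence-free algebra and its conditional expectation. -/

namespace QMS

section DFAlgebra

variable {H : Type*} [NormedAddCommGroup H] [InnerProductSpace ℂ H] [CompleteSpace H]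
  [FiniteDimensional ℂ H] (S : QMS H)

variable {S}

theorem map_star {t : ℝ} (ht : 0 ≤ t) (X : Op H) : S.P t (star X) = star (S.P t X) :=
  (S.cp t ht).map_star (S.unital t ht) X

theorem norm_map_le {t : ℝ} (ht : 0 ≤ t) (X : Op H) : ‖S.P t X‖ ≤ ‖X‖ :=
  (S.cp t ht).norm_map_le (S.unital t ht) X

theorem add_apply {s t : ℝ} (hs : 0 ≤ s) (ht : 0 ≤ t) (X : Op H) :
    S.P (s + t) X = S.P s (S.P t X) := by rw [S.add s t hs ht]; rfl

theorem star_mem {X : Op H} (hX : X ∈ S.dfAlgebra) : star X ∈ S.dfAlgebra := fun t ht => by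
  rw [map_star ht, star_star, star_star]
  exact ⟨(hX t ht).2, (hX t ht).1⟩

theorem map_mul_right {X : Op H} (hX : X ∈ S.dfAlgebra) {t : ℝ} (ht : 0 ≤ t) (Y : Op H) :
    S.P t (Y * X) = S.P t Y * S.P t X :=
  (S.cp t ht).map_mul_of_schwarz_eq (S.unital t ht) (hX t ht).1 Y

theorem map_mul_left {X : Op H} (hX : X ∈ S.dfAlgebra) {t : ℝ} (ht : 0 ≤ t) (Y : Op H) :
    S.P t (X * Y) = S.P t X * S.P t Y := by
  have h := map_mul_right (star_mem hX) ht (star Y)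
  rw [← star_mul, map_star ht, map_star ht, map_star ht, ← star_mul] at h
  exact star_injective h

theorem map_mem {X : Op H} (hX : X ∈ S.dfAlgebra) {s : ℝ} (hs : 0 ≤ s) :
    S.P s X ∈ S.dfAlgebra := fun t ht => by
  have h1 := hX (t + s) (add_nonneg ht hs)
  rw [add_apply ht hs, add_apply ht hs, add_apply ht hs] at h1
  rw [← (hX s hs).1, ← (hX s hs).2]
  exact h1

variable (S) in
/-- The decoherence-free subalgebra as a subspace. -/
def dfSubmodule : Submodule ℂ (Op H) where
  carrier := S.dfAlgebra
  zero_mem' := fun t _ => by simp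
  add_mem' := fun {X Y} hX hY t ht => by
    rw [star_add, add_mul, mul_add, mul_add, add_mul, mul_add, mul_add]
    simp only [map_add]
    rw [map_mul_right hX ht, map_mul_right hX ht, map_mul_right hY ht, map_mul_right hY ht,
      map_mul_left hX ht, map_mul_left hX ht, map_mul_left hY ht, map_mul_left hY ht,
      map_star ht, map_star ht, star_add]
    constructor <;> noncomm_ring
  smul_mem' := fun c X hX t ht => by
    rw [star_smul, smul_mul_smul_comm, smul_mul_smul_comm, map_smul, map_smul, map_smul,
      (hX t ht).1, (hX t ht).2, star_smul, smul_mul_smul_comm, smul_mul_smul_comm]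
    exact ⟨rfl, rfl⟩

theorem mem_dfSubmodule {X : Op H} : X ∈ S.dfSubmodule ↔ X ∈ S.dfAlgebra := Iff.rfl

theorem one_mem : (1 : Op H) ∈ S.dfAlgebra := fun t ht => by simp [S.unital t ht]

theorem mul_mem {X Y : Op H} (hX : X ∈ S.dfAlgebra) (hY : Y ∈ S.dfAlgebra) :
    X * Y ∈ S.dfAlgebra := fun t ht => by
  have e1 : star (X * Y) * (X * Y) = star Y * (star X * X * Y) := by
    rw [star_mul]; simp only [mul_assoc]
  have e2 : X * Y * star (X * Y) = X * (Y * star Y * star X) := by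
    rw [star_mul]; simp only [mul_assoc]
  rw [e1, e2, map_mul_left (star_mem hY) ht, map_mul_right hY ht, (hX t ht).1, map_mul_left hX ht,
    map_mul_left hX ht, map_mul_right (star_mem hX) ht, (hY t ht).2, star_mul, map_star ht,
    map_star ht]
  simp only [mul_assoc, and_self]

theorem gns_map_le {ω : Op H} (hω : IsStrictlyPositive ω) (hinv : S.IsInvariant ω) {t : ℝ}
    (ht : 0 ≤ t) (X : Op H) : gns ω (S.P t X) ≤ gns ω X := by
  have h := re_tr_mul_nonneg hω.nonneg
    (sub_nonneg.2 ((S.cp t ht).kadison_schwarz (S.unital t ht) X))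
  rw [mul_sub, tr_sub, hinv t ht, Complex.sub_re] at h
  exact sub_nonneg.1 h

theorem gns_map_of_mem {ω : Op H} (hinv : S.IsInvariant ω) {t : ℝ}
    (ht : 0 ≤ t) {X : Op H} (hX : X ∈ S.dfAlgebra) : gns ω (S.P t X) = gns ω X := by
  rw [gns, gns, ← (hX t ht).1, hinv t ht]

theorem star_mul_self_eq_of_gns {ω : Op H} (hω : IsStrictlyPositive ω) (hinv : S.IsInvariant ω)
    {t : ℝ} (ht : 0 ≤ t) {X : Op H} (h : gns ω X ≤ gns ω (S.P t X)) :
    S.P t (star X * X) = star (S.P t X) * S.P t X := by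
  rw [← sub_eq_zero]
  refine eq_zero_of_re_tr_mul hω
    (sub_nonneg.2 ((S.cp t ht).kadison_schwarz (S.unital t ht) X)) ?_
  rw [mul_sub, tr_sub, hinv t ht, Complex.sub_re]
  exact sub_nonpos.2 h

/-- Limit points of the semigroup at infinity take values in the decoherence-free subalgebra. -/
theorem limit_mem {ω : Op H} (hω : IsStrictlyPositive ω) (hinv : S.IsInvariant ω) {d : ℕ → ℝ}
    (hd : Tendsto d atTop atTop) (hd0 : ∀ k, 0 ≤ d k) {L : Op H →ₗ[ℂ] Op H}
    (hL : ∀ X, Tendsto (fun k => S.P (d k) X) atTop (𝓝 (L X))) (X : Op H) :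
    L X ∈ S.dfAlgebra := by
  -- The GNS norm decreases along the semigroup, so a limit point already has the least value on its
  -- orbit and `P_s` cannot lower it. By faithfulness of `ω` the Schwarz defect then vanishes.
  have key : ∀ X, ∀ s : ℝ, 0 ≤ s → gns ω (L X) ≤ gns ω (S.P s (L X)) := by
    intro X s hs
    have hc : Continuous (S.P s) := (S.P s).continuous_of_finiteDimensional
    have h1 : Tendsto (fun k => gns ω (S.P s (S.P (d k) X))) atTop (𝓝 (gns ω (S.P s (L X)))) :=
      (((continuous_gns ω).comp hc).tendsto _).comp (hL X)
    have h2 : Tendsto (fun k => gns ω (S.P (d k) X)) atTop (𝓝 (gns ω (L X))) :=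
      ((continuous_gns ω).tendsto _).comp (hL X)
    refine ge_of_tendsto' h1 fun k => ?_
    refine le_of_tendsto h2 ?_
    filter_upwards [hd.eventually_ge_atTop (s + d k)] with m hm
    have h3 : d m = (d m - (s + d k)) + (s + d k) := by ring
    rw [← add_apply hs (hd0 k), h3, add_apply (by linarith) (add_nonneg hs (hd0 k))]
    exact gns_map_le hω hinv (by linarith) _
  have hstar : L (star X) = star (L X) := by
    refine tendsto_nhds_unique (hL (star X)) ?_
    simp only [map_star (hd0 _)]
    exact (hL X).star
  intro t ht
  refine ⟨star_mul_self_eq_of_gns hω hinv ht (key X t ht), ?_⟩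
  have := star_mul_self_eq_of_gns hω hinv ht (key (star X) t ht)
  rw [hstar, star_star, map_star ht, star_star] at this
  exact this

/-- The maps `P_t` are contractions, hence lie in a compact ball. -/
theorem exists_limit (d : ℕ → ℝ) (hd0 : ∀ k, 0 ≤ d k) : ∃ (φ : ℕ → ℕ) (L : Op H →ₗ[ℂ] Op H),
    StrictMono φ ∧ ∀ X, Tendsto (fun k => S.P (d (φ k)) X) atTop (𝓝 (L X)) := by
  have : ProperSpace (Op H →L[ℂ] Op H) := FiniteDimensional.proper ℂ _
  let f : ℕ → (Op H →L[ℂ] Op H) := fun k => LinearMap.toContinuousLinearMap (S.P (d k))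
  have hf : ∀ k, f k ∈ Metric.closedBall (0 : Op H →L[ℂ] Op H) 1 := fun k => by
    rw [mem_closedBall_zero_iff]
    refine ContinuousLinearMap.opNorm_le_bound _ zero_le_one fun X => ?_
    rw [one_mul]
    exact norm_map_le (hd0 k) X
  obtain ⟨L, -, φ, hφ, hL⟩ := (isCompact_closedBall (0 : Op H →L[ℂ] Op H) 1).tendsto_subseq hf
  exact ⟨φ, L, hφ, fun X => ((ContinuousLinearMap.apply ℂ (Op H) X).continuous.tendsto L).comp hL⟩

/-- The conditional expectation onto the decoherence-free subalgebra exists. -/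
theorem exists_isDFExpectation (hS : S.IsDecohering) : ∃ E, S.IsDFExpectation E := by
  obtain ⟨ω, hωf, hinv⟩ := hS
  have hω := hωf.1
  obtain ⟨φ, Q, hφ, hQ⟩ := exists_limit (S := S) (fun k => (k : ℝ)) fun k => k.cast_nonneg
  -- Differences of the chosen times tend to infinity, and `P_{φ(2k)} = P_{d(k)} P_{φ(k)}` yields `E
  -- ∘ Q = Q` in the limit.
  let d : ℕ → ℕ := fun k => φ (2 * k) - φ k
  have hdφ : ∀ k, φ k + k ≤ φ (2 * k) := fun k => by
    have := hφ.add_le_nat k k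
    rwa [← two_mul, add_comm] at this
  have hd : ∀ k, k ≤ d k := fun k => by have := hdφ k; simp only [d]; omega
  obtain ⟨ψ, E, hψ, hE⟩ := exists_limit (S := S) (fun k => (d k : ℝ)) fun k => (d k).cast_nonneg
  have hdt : Tendsto (fun k => (d (ψ k) : ℝ)) atTop atTop :=
    tendsto_natCast_atTop_atTop.comp
      ((tendsto_atTop_mono hd tendsto_id).comp hψ.tendsto_atTop)
  have hφt : Tendsto (fun k => (φ k : ℝ)) atTop atTop :=
    tendsto_natCast_atTop_atTop.comp hφ.tendsto_atTop
  have hmemE := limit_mem hω hinv hdt (fun k => Nat.cast_nonneg _) hE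
  have hmemQ := limit_mem hω hinv hφt (fun k => Nat.cast_nonneg _) hQ
  have hEQ : ∀ X, E (Q X) = Q X := by
    intro X
    have h1 : Tendsto (fun k => S.P (φ (2 * ψ k)) X) atTop (𝓝 (Q X)) :=
      (hQ X).comp (Tendsto.const_mul_atTop' (two_pos) hψ.tendsto_atTop)
    have h2 : Tendsto (fun k => S.P (φ (ψ k)) X) atTop (𝓝 (Q X)) := (hQ X).comp hψ.tendsto_atTop
    have h3 : Tendsto (fun k => S.P (d (ψ k)) (S.P (φ (ψ k)) X - Q X)) atTop (𝓝 0) := by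
      have h4 : Tendsto (fun k => ‖S.P (φ (ψ k)) X - Q X‖) atTop (𝓝 0) := by
        simpa using (h2.sub_const (Q X)).norm
      exact squeeze_zero_norm (fun k => norm_map_le (Nat.cast_nonneg _) _) h4
    have h5 := h3.add (hE (Q X))
    rw [zero_add] at h5
    refine tendsto_nhds_unique (h5.congr fun k => ?_) h1
    have h6 : ((φ (2 * ψ k) : ℕ) : ℝ) = d (ψ k) + φ (ψ k) := by
      have := hdφ (ψ k)
      simp only [d]
      rw [Nat.cast_sub (by omega)]
      ring
    rw [h6, add_apply (Nat.cast_nonneg _) (Nat.cast_nonneg _), map_sub, sub_add_cancel]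
  have hEN : ∀ X ∈ S.dfAlgebra, E X = X := by
    -- On the algebra `Q` preserves the GNS norm, so it is injective, hence surjective in finite
    -- dimension; `E ∘ Q = Q` then makes `E` the identity there.
    let Q' : S.dfSubmodule →ₗ[ℂ] S.dfSubmodule :=
      Q.restrict (p := S.dfSubmodule) (q := S.dfSubmodule) fun X _ => hmemQ X
    have hinj : Function.Injective Q' := by
      rw [← LinearMap.ker_eq_bot, LinearMap.ker_eq_bot']
      intro X hX
      have hX' : Q X = 0 := congrArg Subtype.val hX
      have h1 : Tendsto (fun k => gns ω (S.P (φ k) X)) atTop (𝓝 (gns ω (Q X))) :=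
        ((continuous_gns ω).tendsto _).comp (hQ X)
      simp only [gns_map_of_mem hinv (Nat.cast_nonneg _) X.2, hX'] at h1
      have h2 := tendsto_nhds_unique h1 tendsto_const_nhds
      refine Subtype.ext (eq_zero_of_gns hω (h2.symm.trans ?_).le)
      simp [gns, tr_zero]
    intro X hX
    obtain ⟨Z, hZ⟩ := LinearMap.injective_iff_surjective.1 hinj ⟨X, hX⟩
    have : Q Z = X := congrArg Subtype.val hZ
    rw [← this, hEQ]
  have hunit : E 1 = 1 := hEN 1 one_mem
  refine ⟨E, hmemE, ?_, hunit, fun A hA B hB X => ?_, fun σ _ hσinv X => ?_, fun X => ?_⟩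
  · exact isCompletelyPositive_of_tendsto (fun k => S.cp _ (Nat.cast_nonneg (d (ψ k)))) hE
  · have h1 := hE (A * X * B)
    have h2 := ((hE A).mul (hE X)).mul (hE B)
    rw [hEN A hA, hEN B hB] at h2
    refine tendsto_nhds_unique h1 (h2.congr fun k => ?_)
    rw [map_mul_right hB (Nat.cast_nonneg _), map_mul_left hA (Nat.cast_nonneg _)]
  · have h1 : Tendsto (fun k => tr (σ * S.P (d (ψ k)) X)) atTop (𝓝 (tr (σ * E X))) :=
      (continuous_tr.tendsto _).comp ((hE X).const_mul σ)
    simp only [hσinv _ (Nat.cast_nonneg _)] at h1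
    exact tendsto_nhds_unique h1 tendsto_const_nhds |>.symm ▸ rfl
  · set Z := X - E X
    have hZ : E Z = 0 := by rw [map_sub, hEN _ (hmemE X), sub_self]
    have h1 := hE Z
    rw [hZ, Metric.tendsto_atTop] at h1
    rw [Metric.tendsto_atTop]
    intro ε hε
    obtain ⟨N, hN⟩ := h1 ε hε
    -- By contractivity, one time at which the norm is below `ε` settles all later times.
    refine ⟨d (ψ N), fun t ht => ?_⟩
    have h2 := hN N le_rfl
    rw [dist_zero_right] at h2 ⊢
    have h3 : t = (t - d (ψ N)) + d (ψ N) := by ring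
    rw [h3, add_apply (by linarith) (Nat.cast_nonneg _)]
    exact (norm_map_le (by linarith) _).trans_lt h2

theorem dfExp_spec (hS : S.IsDecohering) : S.IsDFExpectation S.dfExp :=
  Classical.epsilon_spec (exists_isDFExpectation hS)

end DFAlgebra

end QMS

section

variable {H : Type*} [NormedAddCommGroup H] [InnerProductSpace ℂ H] [CompleteSpace H]
  [FiniteDimensional ℂ H]

theorem exists_pos_smul_one_le {K : Op H} (hK : IsStrictlyPositive K) :
    ∃ r : ℝ, 0 < r ∧ r • (1 : Op H) ≤ K := by
  cases subsingleton_or_nontrivial (Op H) with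
  | inl h => exact ⟨1, one_pos, (Subsingleton.elim _ _).le⟩
  | inr h =>
    obtain ⟨r, hr, h⟩ := (CFC.exists_pos_algebraMap_le_iff hK.nonneg.isSelfAdjoint).2
      fun x hx => spectrum_pos hK hx
    exact ⟨r, hr, by rwa [← Algebra.algebraMap_eq_smul_one]⟩

theorem strictlyPositive_smul_one {r : ℝ} (hr : 0 < r) : IsStrictlyPositive (r • (1 : Op H)) := by
  refine IsUnit.isStrictlyPositive ?_ (smul_nonneg hr.le zero_le_one)
  rw [← Algebra.algebraMap_eq_smul_one]
  exact (isUnit_iff_ne_zero.2 hr.ne').map _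

theorem IsCompletelyPositive.map_strictlyPositive {Φ : Op H →ₗ[ℂ] Op H}
    (h : IsCompletelyPositive Φ) (h1 : Φ 1 = 1) {X : Op H} (hX : IsStrictlyPositive X) :
    IsStrictlyPositive (Φ X) := by
  obtain ⟨r, hr, hle⟩ := exists_pos_smul_one_le hX
  refine (strictlyPositive_smul_one hr).of_le ?_
  have := h.map_nonneg h1 (sub_nonneg.2 hle)
  rw [map_sub, LinearMapClass.map_smul_of_tower, h1] at this
  exact sub_nonneg.1 this

theorem isUnit_of_injective {X : Op H} (h : ∀ v, X v = 0 → v = 0) : IsUnit X := by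
  have h1 : IsUnit (X : H →ₗ[ℂ] H) := by
    rw [LinearMap.isUnit_iff_ker_eq_bot, LinearMap.ker_eq_bot']
    exact h
  exact h1.map (Module.End.toContinuousLinearMap H)

theorem eq_of_tr_mul_eq {X Y : Op H} (h : ∀ Z, tr (X * Z) = tr (Y * Z)) : X = Y := by
  rw [← sub_eq_zero]
  have h1 : star (X - Y) = 0 := by
    apply eq_zero_of_re_tr_star_mul_self
    rw [star_star, sub_mul, tr_sub, h, sub_self, Complex.zero_re]
  exact star_eq_zero.1 h1

end

/-! ### The reference state. -/

namespace QMS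

section Sigma

variable {H : Type*} [NormedAddCommGroup H] [InnerProductSpace ℂ H] [CompleteSpace H]
  [FiniteDimensional ℂ H] {S : QMS H}

theorem dfExp_of_mem (hS : S.IsDecohering) {X : Op H} (hX : X ∈ S.dfAlgebra) :
    S.dfExp X = X := by
  have hE := dfExp_spec hS
  have := hE.bimodule X hX 1 one_mem 1
  rwa [hE.unital, mul_one, mul_one] at this

theorem dfExp_mul_left (hS : S.IsDecohering) {A : Op H} (hA : A ∈ S.dfAlgebra) (X : Op H) :
    S.dfExp (A * X) = A * S.dfExp X := by
  simpa using (dfExp_spec hS).bimodule A hA 1 one_mem X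

theorem dfExp_mul_right (hS : S.IsDecohering) {A : Op H} (hA : A ∈ S.dfAlgebra) (X : Op H) :
    S.dfExp (X * A) = S.dfExp X * A := by
  simpa using (dfExp_spec hS).bimodule 1 one_mem A hA X

theorem tr_sigmaTr_mul (X : Op H) :
    tr (S.sigmaTr * X) = (Module.finrank ℂ H : ℂ)⁻¹ * tr (S.dfExp X) := by
  rw [sigmaTr, tr_predual_mul, smul_mul_assoc, one_mul, tr_smul]

theorem finrank_pos (hS : S.IsDecohering) : 0 < Module.finrank ℂ H := by
  obtain ⟨ω, hω, -⟩ := hS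
  by_contra h
  have h0 : Module.finrank ℂ H = 0 := by omega
  have := Module.finrank_zero_iff.1 h0
  have h1 : ω = 0 := ContinuousLinearMap.ext fun v => Subsingleton.elim _ _
  have h2 := hω.2
  rw [h1, tr_zero] at h2
  exact zero_ne_one h2

theorem tr_sigmaTr (hS : S.IsDecohering) : tr S.sigmaTr = 1 := by
  have := tr_sigmaTr_mul (S := S) 1
  rw [mul_one, (dfExp_spec hS).unital] at this
  rw [this]
  have h1 : tr (1 : Op H) = Module.finrank ℂ H := LinearMap.trace_one ℂ H
  rw [h1, inv_mul_cancel₀]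
  exact_mod_cast (finrank_pos hS).ne'

theorem tr_eq_re_of_nonneg {X : Op H} (hX : 0 ≤ X) : tr X = ((tr X).re : ℂ) := by
  have := tr_star X
  rw [hX.isSelfAdjoint.star_eq] at this
  exact (Complex.conj_eq_iff_re.1 this.symm).symm

/-- The form `⟨v, σv⟩` is `Tr E(|v⟩⟨v|) / d`. If it vanishes then `E(|v⟩⟨v|) = 0`, and compatibility
with a faithful invariant state forces `v = 0`. -/
theorem sigmaTr_strictlyPositive (hS : S.IsDecohering) : IsStrictlyPositive S.sigmaTr := by
  have hE := dfExp_spec hS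
  have hd : (0 : ℝ) < (Module.finrank ℂ H : ℝ)⁻¹ := inv_pos.2 (by exact_mod_cast finrank_pos hS)
  have hv : ∀ v : H, inner ℂ v (S.sigmaTr v) =
      (((Module.finrank ℂ H : ℝ)⁻¹ *
        (tr (S.dfExp (InnerProductSpace.rankOne ℂ v v))).re : ℝ) : ℂ) := by
    intro v
    have hp : 0 ≤ (InnerProductSpace.rankOne ℂ v v : Op H) :=
      (ContinuousLinearMap.nonneg_iff_isPositive _).2 (InnerProductSpace.isPositive_rankOne_self v)
    rw [← tr_rankOne_mul, tr_mul_comm, tr_sigmaTr_mul,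
      tr_eq_re_of_nonneg (hE.cp.map_nonneg hE.unital hp)]
    push_cast
    rfl
  have hp : ∀ v : H, 0 ≤ (InnerProductSpace.rankOne ℂ v v : Op H) := fun v =>
    (ContinuousLinearMap.nonneg_iff_isPositive _).2 (InnerProductSpace.isPositive_rankOne_self v)
  refine IsUnit.isStrictlyPositive (isUnit_of_injective fun v h0 => ?_) ?_
  · have h1 := hv v
    rw [h0, inner_zero_right, eq_comm, Complex.ofReal_eq_zero, mul_eq_zero] at h1
    have h2 := h1.resolve_left hd.ne'
    have h3 := eq_zero_of_re_tr_eq_zero (hE.cp.map_nonneg hE.unital (hp v)) h2.le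
    obtain ⟨ω, hω, hinv⟩ := hS
    have h4 := hE.compatible ω hω hinv (InnerProductSpace.rankOne ℂ v v)
    rw [h3, mul_zero, tr_zero] at h4
    have h5 := eq_zero_of_re_tr_mul hω.1 (hp v) (by rw [← h4]; simp)
    have h6 : (InnerProductSpace.rankOne ℂ v v : Op H) v = 0 := by rw [h5]; rfl
    rw [InnerProductSpace.rankOne_apply, smul_eq_zero, inner_self_eq_zero, or_self] at h6
    exact h6
  · rw [ContinuousLinearMap.nonneg_iff_isPositive, ContinuousLinearMap.isPositive_iff_complex]
    intro v
    have h1 : inner ℂ (S.sigmaTr v) v = inner ℂ v (S.sigmaTr v) := by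
      rw [← inner_conj_symm, hv, Complex.conj_ofReal]
    rw [h1, hv]
    simp only [RCLike.re_to_complex, Complex.ofReal_re]
    exact ⟨trivial, mul_nonneg hd.le (re_tr_nonneg (hE.cp.map_nonneg hE.unital (hp v)))⟩

/-- Both `Tr(σAZ)` and `Tr(σZA)` equal `Tr(A E(Z)) / d`, by the bimodule property and cyclicity. -/
theorem commute_sigmaTr (hS : S.IsDecohering) {A : Op H} (hA : A ∈ S.dfAlgebra) :
    Commute S.sigmaTr A := by
  refine eq_of_tr_mul_eq fun Z => ?_
  rw [mul_assoc, tr_sigmaTr_mul, dfExp_mul_left hS hA, mul_assoc, tr_mul_comm A (S.sigmaTr * Z), mul_assoc,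
    tr_sigmaTr_mul, dfExp_mul_right hS hA, tr_mul_comm A]

theorem commute_sigmaTr_rpow (hS : S.IsDecohering) {A : Op H} (hA : A ∈ S.dfAlgebra) (y : ℝ) :
    Commute (S.sigmaTr ^ y) A := by
  rw [rpow_eq_cfc (sigmaTr_strictlyPositive hS).nonneg]
  exact (commute_sigmaTr hS hA).cfc_real _

theorem tr_sigmaTr_mul_dfExp (hS : S.IsDecohering) {A : Op H} (hA : A ∈ S.dfAlgebra) (X : Op H) :
    tr (S.sigmaTr * (A * S.dfExp X)) = tr (S.sigmaTr * (A * X)) := by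
  rw [tr_sigmaTr_mul, tr_sigmaTr_mul, dfExp_mul_left hS hA, dfExp_mul_left hS hA,
    dfExp_of_mem hS ((dfExp_spec hS).mem X)]

theorem aeval_mem {A : Op H} (hA : A ∈ S.dfAlgebra) (g : Polynomial ℝ) :
    Polynomial.aeval A g ∈ S.dfAlgebra := by
  have hpow : ∀ n : ℕ, A ^ n ∈ S.dfAlgebra := by
    intro n
    induction n with
    | zero => rw [pow_zero]; exact one_mem
    | succ n ih => rw [pow_succ]; exact mul_mem ih hA
  rw [← mem_dfSubmodule]
  induction g using Polynomial.induction_on' with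
  | add p q hp hq => rw [map_add]; exact S.dfSubmodule.add_mem hp hq
  | monomial n a =>
    rw [Polynomial.aeval_monomial, Algebra.algebraMap_eq_smul_one, smul_mul_assoc, one_mul,
      ← Complex.coe_smul]
    exact S.dfSubmodule.smul_mem _ (hpow n)

theorem cfc_mem {A : Op H} (hA : A ∈ S.dfAlgebra) (f : ℝ → ℝ) : cfc f A ∈ S.dfAlgebra := by
  by_cases hs : IsSelfAdjoint A
  · obtain ⟨g, -, hg⟩ := cfc_eq_aeval hs f
    rw [hg]
    exact aeval_mem hA g
  · rw [cfc_apply_of_not_predicate A hs]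
    exact S.dfSubmodule.zero_mem

theorem rpow_mem {A : Op H} (hA : A ∈ S.dfAlgebra) (hA0 : 0 ≤ A) (y : ℝ) :
    A ^ y ∈ S.dfAlgebra := by
  rw [rpow_eq_cfc hA0]; exact cfc_mem hA _

theorem real_smul_mem {A : Op H} (hA : A ∈ S.dfAlgebra) (c : ℝ) : c • A ∈ S.dfAlgebra := by
  rw [← Complex.coe_smul]; exact S.dfSubmodule.smul_mem _ hA

/-- The element `E P_t(X - E X)` lies in the algebra and its orbit decays, while the semigroup
preserves the GNS norm on the algebra; so it is zero. -/
theorem dfExp_map (hS : S.IsDecohering) {t : ℝ} (ht : 0 ≤ t) (X : Op H) :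
    S.dfExp (S.P t X) = S.P t (S.dfExp X) := by
  have hE := dfExp_spec hS
  set Z := S.P t (X - S.dfExp X) with hZ
  have h1 : Tendsto (fun s => S.P s Z) atTop (𝓝 0) := by
    have := (hE.decoherence X).comp (tendsto_atTop_add_const_right atTop t tendsto_id)
    refine this.congr' ?_
    filter_upwards [eventually_ge_atTop 0] with s hs
    exact add_apply hs ht _
  have h2 : Tendsto (fun s => S.P s (S.dfExp Z)) atTop (𝓝 0) := by
    have := h1.sub (hE.decoherence Z)
    simpa using this
  have h3 : S.dfExp Z = 0 := by
    obtain ⟨ω, hω, hinv⟩ := hS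
    have h4 := ((continuous_gns ω).tendsto _).comp h2
    have h5 : Tendsto (fun s => gns ω (S.P s (S.dfExp Z))) atTop (𝓝 (gns ω (S.dfExp Z))) := by
      refine tendsto_const_nhds.congr' ?_
      filter_upwards [eventually_ge_atTop 0] with s hs
      exact (gns_map_of_mem hinv hs (hE.mem Z)).symm
    refine eq_zero_of_gns hω.1 (tendsto_nhds_unique h5 h4 |>.trans ?_).le
    simp [gns, tr_zero]
  rw [hZ, map_sub, map_sub, dfExp_of_mem hS (map_mem (hE.mem X) ht)] at h3
  exact sub_eq_zero.1 h3

end Sigma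

end QMS

/-! ### Differentiability of the semigroup and invariance of the reference state. -/

namespace QMS

section Generator

variable {H : Type*} [NormedAddCommGroup H] [InnerProductSpace ℂ H] [CompleteSpace H]
  [FiniteDimensional ℂ H] {S : QMS H}

variable (S) in
/-- The semigroup as a continuous path of operators, extended by the identity to negative times. -/
def path (t : ℝ) : Op H →L[ℂ] Op H := LinearMap.toContinuousLinearMap (S.P (max t 0))

theorem path_apply {t : ℝ} (ht : 0 ≤ t) (X : Op H) : S.path t X = S.P t X := by
  simp [path, max_eq_left ht]

theorem continuous_path : Continuous S.path := by
  rw [continuous_clm_apply]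
  intro X
  have : Continuous fun t : ℝ => (⟨max t 0, le_max_right t 0⟩ : Ici (0 : ℝ)) := by fun_prop
  exact (continuousOn_iff_continuous_domRestrict.1 (S.continuousOn X)).comp this

theorem path_zero : S.path 0 = 1 := by
  ext X : 1
  rw [path_apply le_rfl, S.zero]; rfl

theorem path_mul {s t : ℝ} (hs : 0 ≤ s) (ht : 0 ≤ t) : S.path s * S.path t = S.path (s + t) := by
  ext X : 1
  rw [mul_apply_eq_comp, path_apply ht, path_apply hs, path_apply (add_nonneg hs ht),
    add_apply hs ht]

/-- With `V(h) = ∫_0^h P_s ds`, the semigroup law gives `P_t V(h) = V(t+h) - V(t)`. For small `h >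
0` the operator `V(h)` is invertible because `V(h)/h → 1`, so `P_t` inherits differentiability from
`V`. -/
theorem differentiableWithinAt_path : DifferentiableWithinAt ℝ S.path (Ici 0) 0 := by
  have : IsScalarTower ℝ (Op H →L[ℂ] Op H) (Op H →L[ℂ] Op H) :=
    ⟨fun r A B => by ext X : 1; simp⟩
  have : SMulCommClass ℝ (Op H →L[ℂ] Op H) (Op H →L[ℂ] Op H) :=
    ⟨fun r A B => by ext X : 1; simp⟩
  let V : ℝ → (Op H →L[ℂ] Op H) := fun h => ∫ s in (0 : ℝ)..h, S.path s
  have hV : ∀ h, HasDerivAt V (S.path h) h := fun h =>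
    (continuous_path.integral_hasStrictDerivAt 0 h).hasDerivAt
  have hV0 : V 0 = 0 := intervalIntegral.integral_same
  obtain ⟨h, hh, hu⟩ : ∃ h : ℝ, 0 < h ∧ IsUnit (V h) := by
    have h1 := hasDerivAt_iff_tendsto_slope_zero.1 (hV 0)
    rw [path_zero] at h1
    have h2 : ∀ᶠ t in 𝓝[≠] (0 : ℝ), IsUnit (t⁻¹ • (V (0 + t) - V 0)) :=
      h1 (Units.isOpen.mem_nhds isUnit_one)
    have h3 : ∀ᶠ t in 𝓝[>] (0 : ℝ), IsUnit (t⁻¹ • (V (0 + t) - V 0)) :=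
      h2.filter_mono (nhdsWithin_mono _ fun t ht => ne_of_gt ht)
    obtain ⟨t, ht, ht0⟩ := (h3.and self_mem_nhdsWithin).exists
    refine ⟨t, ht0, ?_⟩
    rw [zero_add, hV0, sub_zero] at ht
    have h4 : t • (t⁻¹ • V t) = V t := by rw [smul_smul, mul_inv_cancel₀ (ne_of_gt ht0), one_smul]
    rw [← h4]
    exact ht.smul (Units.mk0 t (ne_of_gt ht0))
  obtain ⟨u, hu⟩ := hu
  have key : ∀ t ∈ Ici (0 : ℝ), S.path t = (V (t + h) - V t) * (u⁻¹ : (Op H →L[ℂ] Op H)ˣ) := by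
    intro t ht
    rw [Units.eq_mul_inv_iff_mul_eq, hu]
    have e1 : S.path t * V h = ∫ s in (0 : ℝ)..h, S.path t * S.path s :=
      ((ContinuousLinearMap.mul ℝ (Op H →L[ℂ] Op H) (S.path t)).intervalIntegral_comp_comm
        (continuous_path.intervalIntegrable 0 h)).symm
    have e2 : ∫ s in (0 : ℝ)..h, S.path t * S.path s = ∫ s in (0 : ℝ)..h, S.path (t + s) := by
      refine intervalIntegral.integral_congr fun s hs => ?_
      rw [uIcc_of_le hh.le] at hs
      exact path_mul ht hs.1
    rw [e1, e2, intervalIntegral.integral_comp_add_left, add_zero,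
      intervalIntegral.integral_interval_sub_left (continuous_path.intervalIntegrable _ _)
        (continuous_path.intervalIntegrable _ _)]
  have hd : DifferentiableAt ℝ (fun t => (V (t + h) - V t) *
      ((u⁻¹ : (Op H →L[ℂ] Op H)ˣ) : Op H →L[ℂ] Op H)) 0 := by
    have h1 : HasDerivAt (fun t => V (t + h)) (S.path (0 + h)) 0 := (hV (0 + h)).comp_add_const 0 h
    exact ((((ContinuousLinearMap.mul ℝ (Op H →L[ℂ] Op H)).flip
      ((u⁻¹ : (Op H →L[ℂ] Op H)ˣ) : Op H →L[ℂ] Op H)).hasFDerivAt).comp_hasDerivAt 0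
      (h1.sub (hV 0))).differentiableAt
  exact hd.differentiableWithinAt.congr key (key 0 self_mem_Ici)

/-- A uniformly continuous semigroup is differentiable. -/
theorem hasDerivWithinAt_map (X : Op H) :
    HasDerivWithinAt (fun t => S.P t X) (S.generator X) (Ici 0) 0 := by
  refine DifferentiableWithinAt.hasDerivWithinAt ?_
  have h1 : DifferentiableWithinAt ℝ (fun t => S.path t X) (Ici 0) 0 :=
    (((ContinuousLinearMap.apply ℂ (Op H) X).restrictScalars ℝ).differentiableAt
      (x := S.path 0)).comp_differentiableWithinAt (0 : ℝ) differentiableWithinAt_path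
  exact h1.congr (fun t ht => (path_apply ht X).symm) (path_apply le_rfl X).symm

theorem generator_eq {X L : Op H} (h : HasDerivWithinAt (fun t => S.P t X) L (Ici 0) 0) :
    S.generator X = L :=
  h.derivWithin (uniqueDiffOn_Ici 0 0 self_mem_Ici)

theorem generator_add (X Y : Op H) : S.generator (X + Y) = S.generator X + S.generator Y :=
  generator_eq (by simpa [Pi.add_def] using (hasDerivWithinAt_map X).add (hasDerivWithinAt_map Y))

theorem generator_smul (c : ℂ) (X : Op H) : S.generator (c • X) = c • S.generator X :=
  generator_eq (by simpa [Pi.smul_def] using (hasDerivWithinAt_map X).const_smul c)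

theorem generator_one : S.generator 1 = 0 := by
  refine generator_eq ((hasDerivWithinAt_const (0 : ℝ) (Ici 0) (1 : Op H)).congr (fun t ht => ?_) ?_)
  · exact S.unital t ht
  · exact S.unital 0 le_rfl

/-- Multiplicativity of `P_t` on the algebra differentiates to a Leibniz rule. -/
theorem generator_mul {A B : Op H} (hA : A ∈ S.dfAlgebra) :
    S.generator (A * B) = S.generator A * B + A * S.generator B := by
  have h := (hasDerivWithinAt_map (S := S) A).mul (hasDerivWithinAt_map (S := S) B)
  simp only [S.zero, LinearMap.id_apply] at h
  exact generator_eq (h.congr (fun t ht => map_mul_left hA ht B) (map_mul_left hA le_rfl B))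

/-- The Leibniz rule under a cyclic trace acts as the ordinary chain rule. -/
theorem tr_generator_aeval {A : Op H} (hA : A ∈ S.dfAlgebra) (g : Polynomial ℝ) :
    tr (S.generator (Polynomial.aeval A g)) =
      tr (S.generator A * Polynomial.aeval A (Polynomial.derivative g)) := by
  have hpow : ∀ n k : ℕ, tr (S.generator (A ^ (n + 1)) * A ^ k) =
      (n + 1 : ℂ) * tr (S.generator A * A ^ (n + k)) := by
    intro n
    induction n with
    | zero => intro k; simp
    | succ n ih =>
      intro k
      rw [pow_succ' A (n + 1), generator_mul hA, add_mul, tr_add, mul_assoc, mul_assoc, ← pow_add,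
        tr_mul_comm A, mul_assoc, ← pow_succ, ih]
      have : n + (k + 1) = n + 1 + k := by ring
      rw [this]
      push_cast
      ring
  induction g using Polynomial.induction_on' with
  | add p q hp hq => rw [map_add, generator_add, tr_add, hp, hq, map_add, map_add, mul_add, tr_add]
  | monomial n a =>
    rw [Polynomial.derivative_monomial, Polynomial.aeval_monomial, Polynomial.aeval_monomial,
      Algebra.algebraMap_eq_smul_one, Algebra.algebraMap_eq_smul_one, smul_mul_assoc, one_mul,
      smul_mul_assoc, one_mul, ← Complex.coe_smul, generator_smul, tr_smul, mul_smul_comm,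
      tr_real_smul]
    cases n with
    | zero => simp [generator_one, tr_zero]
    | succ n =>
      have := hpow n 0
      rw [pow_zero, mul_one, add_zero] at this
      rw [this, Nat.add_sub_cancel]
      push_cast
      ring

/-- With `m` the product of `X - x` over the spectrum and `a m + b m' = 1`, the polynomial `X - m b`
equals `X` and has derivative `0` modulo `m`. Applied to the chain rule for `Tr L(g(A))`, it shows
that `Tr L(A) = 0`. -/
theorem exists_flat_polynomial {A : Op H} (hs : IsSelfAdjoint A) : ∃ g : Polynomial ℝ,
    Polynomial.aeval A g = A ∧ Polynomial.aeval A (Polynomial.derivative g) = 0 := by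
  classical
  let s := (finite_spectrum A).toFinset
  let m : Polynomial ℝ := ∏ x ∈ s, (Polynomial.X - Polynomial.C x)
  have hm : Polynomial.aeval A m = 0 := by
    rw [← cfc_polynomial m A]
    rw [cfc_congr (g := fun _ => (0 : ℝ)) fun x hx => ?_, cfc_const_zero]
    simp only [m, Polynomial.eval_prod]
    exact Finset.prod_eq_zero (i := x) (by simpa [s] using hx) (by simp)
  have hsep : m.Separable := Polynomial.separable_prod_X_sub_C_iff'.2 fun x _ y _ h => h
  obtain ⟨a, b, hab⟩ := hsep
  refine ⟨Polynomial.X - m * b, ?_, ?_⟩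
  · rw [map_sub, map_mul, hm, zero_mul, sub_zero, Polynomial.aeval_X]
  · have h1 : Polynomial.derivative (Polynomial.X - m * b) =
        m * (a - Polynomial.derivative b) := by
      rw [Polynomial.derivative_sub, Polynomial.derivative_X, Polynomial.derivative_mul, ← hab]
      ring
    rw [h1, map_mul, hm, zero_mul]

theorem tr_generator_of_mem {A : Op H} (hA : A ∈ S.dfAlgebra) : tr (S.generator A) = 0 := by
  have hsa : ∀ B ∈ S.dfAlgebra, IsSelfAdjoint B → tr (S.generator B) = 0 := by
    intro B hB hs
    obtain ⟨g, hg, hg'⟩ := exists_flat_polynomial hs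
    have := tr_generator_aeval hB g
    rwa [hg, hg', mul_zero, tr_zero] at this
  have h1 : A = ((1 / 2 : ℂ) • (A + star A)) + ((1 / 2 : ℂ) * Complex.I) • (-Complex.I • (A - star A)) := by
    rw [smul_smul]
    have : (1 / 2 : ℂ) * Complex.I * -Complex.I = 1 / 2 := by
      linear_combination (-1 / 2 : ℂ) * Complex.I_mul_I
    rw [this, ← smul_add]
    have h2 : A + star A + (A - star A) = (2 : ℂ) • A := by rw [two_smul]; abel
    rw [h2, smul_smul]; norm_num
  have m1 : A + star A ∈ S.dfAlgebra := S.dfSubmodule.add_mem hA (star_mem hA)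
  have m2 : -Complex.I • (A - star A) ∈ S.dfAlgebra :=
    S.dfSubmodule.smul_mem _ (S.dfSubmodule.sub_mem hA (star_mem hA))
  have s1 : IsSelfAdjoint (A + star A) := IsSelfAdjoint.add_star_self A
  have s2 : IsSelfAdjoint (-Complex.I • (A - star A)) := by
    rw [isSelfAdjoint_iff, star_smul, star_sub, star_star]
    simp [smul_sub]
    abel
  rw [h1, generator_add, generator_smul, generator_smul, tr_add, tr_smul, tr_smul, hsa _ m1 s1,
    hsa _ m2 s2]
  simp

/-- The reference state is invariant, in infinitesimal form. -/
theorem tr_sigmaTr_mul_generator (hS : S.IsDecohering) (X : Op H) :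
    tr (S.sigmaTr * S.generator X) = 0 := by
  have h1 : S.dfExp (S.generator X) = S.generator (S.dfExp X) := by
    refine (generator_eq ?_).symm
    have h2 := ((LinearMap.toContinuousLinearMap S.dfExp).restrictScalars ℝ).hasFDerivAt
      (x := S.P 0 X) |>.comp_hasDerivWithinAt (0 : ℝ) (hasDerivWithinAt_map X)
    exact h2.congr (fun t ht => (dfExp_map hS ht X).symm) (dfExp_map hS le_rfl X).symm
  rw [tr_sigmaTr_mul, h1, tr_generator_of_mem ((dfExp_spec hS).mem X), mul_zero]

end Generator

end QMS

/-! ### Powers of commuting operators. -/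

section CommutingPowers

variable {H : Type*} [NormedAddCommGroup H] [InnerProductSpace ℂ H] [CompleteSpace H]
  [FiniteDimensional ℂ H]

theorem commute_log {P Q : Op H} (h : Commute P Q) : Commute (CFC.log P) (CFC.log Q) :=
  ((h.cfc_real Real.log).symm.cfc_real Real.log).symm

theorem exp_add_of_commute {X Y : Op H} (h : Commute X Y) :
    NormedSpace.exp (X + Y) = NormedSpace.exp X * NormedSpace.exp Y := by
  let _ : NormedAlgebra ℚ (Op H) := NormedAlgebra.restrictScalars ℚ ℝ (Op H)
  exact NormedSpace.exp_add_of_commute h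

theorem strictlyPositive_mul_of_commute {P Q : Op H} (hP : IsStrictlyPositive P)
    (hQ : IsStrictlyPositive Q) (h : Commute P Q) : IsStrictlyPositive (P * Q) :=
  IsUnit.isStrictlyPositive (hP.isUnit.mul hQ.isUnit) (h.mul_nonneg hP.nonneg hQ.nonneg)

theorem log_mul_of_commute {P Q : Op H} (hP : IsStrictlyPositive P) (hQ : IsStrictlyPositive Q)
    (h : Commute P Q) : CFC.log (P * Q) = CFC.log P + CFC.log Q := by
  have hs : IsSelfAdjoint (CFC.log P + CFC.log Q) :=
    (IsSelfAdjoint.log (a := P)).add (IsSelfAdjoint.log (a := Q))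
  rw [← CFC.log_exp (CFC.log P + CFC.log Q) hs, exp_add_of_commute (commute_log h),
    CFC.exp_log P hP, CFC.exp_log Q hQ]

theorem mul_rpow_of_commute_of_pos {P Q : Op H} (hP : IsStrictlyPositive P)
    (hQ : IsStrictlyPositive Q) (h : Commute P Q) (y : ℝ) : (P * Q) ^ y = P ^ y * Q ^ y := by
  rw [rpow_eq_exp (strictlyPositive_mul_of_commute hP hQ h), rpow_eq_exp hP, rpow_eq_exp hQ,
    log_mul_of_commute hP hQ h, smul_add,
    exp_add_of_commute (((commute_log h).smul_left y).smul_right y)]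

theorem continuousOn_rpow_nonneg {y : ℝ} (hy : 0 < y) :
    ContinuousOn (fun Q : Op H => Q ^ y) {Q | 0 ≤ Q} := by
  have h := CFC.continuousOn_nnrpow (A := Op H) ⟨y, hy.le⟩
  refine h.congr fun Q _ => ?_
  exact (CFC.nnrpow_eq_rpow (x := ⟨y, hy.le⟩) hy).symm

/-- By approximation of `Q` by `Q + 1/(n+1)`; the singular case is needed since elements of the
algebra need not be invertible. -/
theorem mul_rpow_of_commute {P Q : Op H} (hP : IsStrictlyPositive P) (hQ : 0 ≤ Q)
    (h : Commute P Q) {y : ℝ} (hy : 0 < y) : (P * Q) ^ y = P ^ y * Q ^ y := by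
  have hc := continuousOn_rpow_nonneg (H := H) hy
  let u : ℕ → Op H := fun n => Q + (1 / ((n : ℝ) + 1)) • (1 : Op H)
  have hu : Tendsto u atTop (𝓝 Q) := by
    have := (tendsto_one_div_add_atTop_nhds_zero_nat (𝕜 := ℝ)).smul_const (1 : Op H)
    simpa [u] using this.const_add Q
  have hupos : ∀ n, IsStrictlyPositive (u n) := fun n =>
    IsStrictlyPositive.nonneg_add hQ (strictlyPositive_smul_one (by positivity))
  have hcomm : ∀ n, Commute P (u n) := fun n =>
    h.add_right ((Commute.one_right P).smul_right _)
  have h1 : Tendsto (fun n => (P * u n) ^ y) atTop (𝓝 ((P * Q) ^ y)) :=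
    (hc (P * Q) (h.mul_nonneg hP.nonneg hQ)).tendsto.comp (tendsto_nhdsWithin_iff.2
      ⟨hu.const_mul P, Eventually.of_forall fun n =>
        (strictlyPositive_mul_of_commute hP (hupos n) (hcomm n)).nonneg⟩)
  have h2 : Tendsto (fun n => P ^ y * u n ^ y) atTop (𝓝 (P ^ y * Q ^ y)) :=
    ((hc Q hQ).tendsto.comp (tendsto_nhdsWithin_iff.2
      ⟨hu, Eventually.of_forall fun n => (hupos n).nonneg⟩)).const_mul _
  exact tendsto_nhds_unique h1
    (h2.congr fun n => (mul_rpow_of_commute_of_pos hP (hupos n) (hcomm n) y).symm)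

/-- The trace of the product of `R` with the positive operator `‖v‖² - |v⟩⟨v|` is nonnegative. -/
theorem le_tr_smul_one {R : Op H} (hR : 0 ≤ R) : R ≤ (tr R).re • (1 : Op H) := by
  rw [← sub_nonneg, ContinuousLinearMap.nonneg_iff_isPositive,
    ContinuousLinearMap.isPositive_iff_complex]
  intro v
  have hreal : inner ℂ ((((tr R).re • (1 : Op H) - R)) v) v =
      ((((tr R).re * ‖v‖ ^ 2 - (inner ℂ v (R v)).re : ℝ)) : ℂ) := by
    have h1 : inner ℂ (R v) v = (((inner ℂ v (R v) : ℂ).re : ℝ) : ℂ) := by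
      have h3 : inner ℂ (R v) v = inner ℂ v (R v) := by
        rw [← ContinuousLinearMap.adjoint_inner_right, ← ContinuousLinearMap.star_eq_adjoint,
          hR.isSelfAdjoint.star_eq]
      have h4 := inner_conj_symm (𝕜 := ℂ) v (R v)
      rw [h3] at h4
      rw [h3]
      exact (Complex.conj_eq_iff_re.1 h4).symm
    rw [_root_.sub_apply, inner_sub_left, h1, _root_.smul_apply, ← Complex.coe_smul,
      inner_smul_left, Complex.conj_ofReal, one_apply_eq_self, inner_self_eq_norm_sq_to_K]
    push_cast
    rfl
  rw [hreal]
  simp only [RCLike.re_to_complex, Complex.ofReal_re, true_and]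
  have hv : 0 ≤ (‖v‖ ^ 2) • (1 : Op H) - InnerProductSpace.rankOne ℂ v v := by
    rw [ContinuousLinearMap.nonneg_iff_isPositive, ContinuousLinearMap.isPositive_iff_complex]
    intro w
    have h1 : inner ℂ (((‖v‖ ^ 2) • (1 : Op H) - InnerProductSpace.rankOne ℂ v v) w) w =
        ((‖v‖ ^ 2 * ‖w‖ ^ 2 - ‖(inner ℂ v w : ℂ)‖ ^ 2 : ℝ) : ℂ) := by
      rw [_root_.sub_apply, inner_sub_left, _root_.smul_apply, ← Complex.coe_smul,
        inner_smul_left, Complex.conj_ofReal, one_apply_eq_self, inner_self_eq_norm_sq_to_K,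
        InnerProductSpace.rankOne_apply, inner_smul_left, Complex.conj_mul']
      push_cast
      rfl
    rw [h1]
    simp only [RCLike.re_to_complex, Complex.ofReal_re, true_and]
    have h2 := norm_inner_le_norm (𝕜 := ℂ) v w
    have h3 := norm_nonneg (inner ℂ v w : ℂ)
    nlinarith
  have h5 := re_tr_mul_nonneg hR hv
  rw [mul_sub, tr_sub, mul_smul_comm, mul_one, tr_real_smul, tr_mul_comm R, tr_rankOne_mul,
    Complex.sub_re, Complex.re_ofReal_mul] at h5
  linarith

end CommutingPowers

/-! ### Weighted norms. -/

section WeightedNorm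

variable {H : Type*} [NormedAddCommGroup H] [InnerProductSpace ℂ H] [CompleteSpace H]
  [FiniteDimensional ℂ H]

theorem wnorm_ofReal (σ X : Op H) {p : ℝ} (hp : 0 < p) :
    wnorm σ (ENNReal.ofReal p) X = trp p (Gam σ (1 / p) X) ^ (1 / p) := by
  rw [wnorm, if_neg ENNReal.ofReal_ne_top, ENNReal.toReal_ofReal hp.le, trp]

theorem wnorm_nonneg (σ : Op H) (p : ℝ≥0∞) (X : Op H) : 0 ≤ wnorm σ p X := by
  unfold wnorm
  split_ifs
  · exact norm_nonneg X
  · exact Real.rpow_nonneg (re_tr_nonneg CFC.rpow_nonneg) _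

theorem wnorm_rpow (σ X : Op H) {p : ℝ} (hp : 0 < p) :
    wnorm σ (ENNReal.ofReal p) X ^ p = trp p (Gam σ (1 / p) X) := by
  rw [wnorm_ofReal σ X hp, ← Real.rpow_mul (trp_nonneg _ _), one_div, inv_mul_cancel₀ hp.ne',
    Real.rpow_one]

theorem star_Gam (σ : Op H) (s : ℝ) (X : Op H) :
    star (Gam σ s X) = Gam σ s (star X) := by
  rw [Gam, Gam, star_mul, star_mul, (CFC.rpow_nonneg (a := σ)).isSelfAdjoint.star_eq, mul_assoc]

theorem wnorm_star (σ X : Op H) {p : ℝ} (hp : 0 < p) :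
    wnorm σ (ENNReal.ofReal p) (star X) = wnorm σ (ENNReal.ofReal p) X := by
  rw [wnorm_ofReal σ _ hp, wnorm_ofReal σ _ hp, ← star_Gam, trp_star hp]

theorem isUnit_rpow {σ : Op H} (hσ : IsStrictlyPositive σ) (y : ℝ) : IsUnit (σ ^ y) := by
  rw [rpow_eq_exp hσ]
  exact (strictlyPositive_exp (by rw [isSelfAdjoint_iff, star_smul,
    (IsSelfAdjoint.log (a := σ)).star_eq, star_trivial])).isUnit

theorem strictlyPositive_rpow {σ : Op H} (hσ : IsStrictlyPositive σ) (y : ℝ) :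
    IsStrictlyPositive (σ ^ y) :=
  IsUnit.isStrictlyPositive (isUnit_rpow hσ y) CFC.rpow_nonneg

theorem strictlyPositive_Gam {σ X : Op H} (hσ : IsStrictlyPositive σ) (hX : IsStrictlyPositive X)
    (s : ℝ) : IsStrictlyPositive (Gam σ s X) := by
  have hs : star (σ ^ (s / 2)) = σ ^ (s / 2) :=
    (CFC.rpow_nonneg (a := σ)).isSelfAdjoint.star_eq
  refine IsUnit.isStrictlyPositive (((isUnit_rpow hσ _).mul hX.isUnit).mul (isUnit_rpow hσ _)) ?_
  have := star_right_conjugate_nonneg hX.nonneg (σ ^ (s / 2))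
  rwa [hs] at this

end WeightedNorm

section

variable {H : Type*} [NormedAddCommGroup H] [InnerProductSpace ℂ H] [CompleteSpace H]
  [FiniteDimensional ℂ H]

theorem smul_rpow {Q : Op H} (hQ : 0 ≤ Q) {c : ℝ} (hc : 0 < c) (y : ℝ) :
    (c • Q) ^ y = c ^ y • Q ^ y := by
  rw [rpow_eq_cfc (smul_nonneg hc.le hQ), rpow_eq_cfc hQ,
    ← cfc_comp_const_mul c (fun x : ℝ => x ^ y) Q
      (((finite_spectrum Q).image _).continuousOn _) hQ.isSelfAdjoint,
    ← cfc_const_mul (c ^ y) (fun x : ℝ => x ^ y) Q (continuousOn_spectrum _ _)]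
  exact cfc_congr fun x hx => Real.mul_rpow hc.le (spectrum_nonneg hQ hx)

/-- Holds for every exponent `y ≥ 0`, because `R` and `R + δ` commute and the comparison is
pointwise on the spectrum. -/
theorem rpow_le_add_rpow {R : Op H} (hR : 0 ≤ R) {δ y : ℝ} (hδ : 0 < δ) (hy : 0 ≤ y) :
    R ^ y ≤ (R + δ • (1 : Op H)) ^ y := by
  have h0 : 0 ≤ R + δ • (1 : Op H) := add_nonneg hR (smul_nonneg hδ.le zero_le_one)
  have h1 : R + δ • (1 : Op H) = cfc (fun x : ℝ => x + δ) R := by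
    rw [cfc_add_const δ (fun x : ℝ => x) R, cfc_id' ℝ R, Algebra.algebraMap_eq_smul_one]
  rw [rpow_eq_cfc h0, rpow_eq_cfc hR, h1,
    ← cfc_comp' (fun x : ℝ => x ^ y) (fun x : ℝ => x + δ) R
      ((finite_spectrum R).image _ |>.continuousOn _)]
  refine cfc_mono (fun x hx => ?_) (continuousOn_spectrum _ _) (continuousOn_spectrum _ _)
  exact Real.rpow_le_rpow (spectrum_nonneg hR hx) (by linarith) hy

theorem star_mul_self_le_of_mul_star_self_le {C : Op H} {n : ℝ}
    (h : C * star C ≤ n ^ 2 • (1 : Op H)) : star C * C ≤ n ^ 2 • (1 : Op H) := by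
  have h1 : ‖C * star C‖ ≤ n ^ 2 := by
    rw [CStarAlgebra.norm_le_iff_le_algebraMap _ (sq_nonneg n) (mul_star_self_nonneg C),
      Algebra.algebraMap_eq_smul_one]
    exact h
  have h2 : ‖star C * C‖ ≤ n ^ 2 := by
    rwa [CStarRing.norm_star_mul_self, ← CStarRing.norm_self_mul_star]
  rwa [CStarAlgebra.norm_le_iff_le_algebraMap _ (sq_nonneg n) (star_mul_self_nonneg C),
    Algebra.algebraMap_eq_smul_one] at h2

theorem norm_log_le {T : Op H} {a b : ℝ} (ha : 0 < a) (h1 : a • (1 : Op H) ≤ T)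
    (h2 : T ≤ b • (1 : Op H)) : ‖CFC.log T‖ ≤ max |Real.log a| |Real.log b| := by
  have hT : IsSelfAdjoint T := by
    have : 0 ≤ T := le_trans (smul_nonneg ha.le zero_le_one) h1
    exact this.isSelfAdjoint
  rw [← Algebra.algebraMap_eq_smul_one, algebraMap_le_iff_le_spectrum hT] at h1
  rw [← Algebra.algebraMap_eq_smul_one, le_algebraMap_iff_spectrum_le hT] at h2
  refine norm_cfc_le (le_max_of_le_left (abs_nonneg _)) fun x hx => ?_
  have hx1 := h1 x hx
  have hx2 := h2 x hx
  exact abs_le_max_abs_abs (Real.log_le_log ha hx1) (Real.log_le_log (ha.trans_le hx1) hx2)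

theorem Gam_of_commute {σ A : Op H} (hσ : IsStrictlyPositive σ) (s : ℝ)
    (hA : ∀ y : ℝ, Commute (σ ^ y) A) : Gam σ s A = σ ^ s * A := by
  rw [Gam, mul_assoc, ← (hA _).eq, ← mul_assoc, rpow_mul_rpow hσ, add_halves]

theorem Gam_mul_mul {σ A B : Op H} (s : ℝ) (hA : ∀ y : ℝ, Commute (σ ^ y) A)
    (hB : ∀ y : ℝ, Commute (σ ^ y) B) (X : Op H) :
    Gam σ s (A * X * B) = A * Gam σ s X * B := by
  simp only [Gam, mul_assoc]
  rw [← (hB _).eq]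
  simp only [← mul_assoc]
  rw [(hA _).eq]

end

/-! ### Densities of the algebra and their regularised logarithms. -/

namespace QMS

variable {H : Type*} [NormedAddCommGroup H] [InnerProductSpace ℂ H] [CompleteSpace H]
  [FiniteDimensional ℂ H] {S : QMS H}

/-- Since `σ` commutes with `A`, the modulus of `σ^{1/m} A` to the power `m` is `σ |A|^m`. -/
theorem trp_Gam_of_mem (hS : S.IsDecohering) {A : Op H} (hA : A ∈ S.dfAlgebra) {m : ℝ}
    (hm : 0 < m) :
    trp m (Gam S.sigmaTr (1 / m) A) = (tr (S.sigmaTr * (star A * A) ^ (m / 2))).re := by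
  have hσ := sigmaTr_strictlyPositive hS
  have h1 : star (S.sigmaTr ^ (1 / m) * A) * (S.sigmaTr ^ (1 / m) * A)
      = S.sigmaTr ^ (2 / m) * (star A * A) := by
    rw [star_mul, (CFC.rpow_nonneg (a := S.sigmaTr)).isSelfAdjoint.star_eq,
      ← (commute_sigmaTr_rpow hS (star_mem hA) _).eq, ← mul_assoc,
      mul_assoc _ (star A) (S.sigmaTr ^ (1 / m)),
      ← (commute_sigmaTr_rpow hS (star_mem hA) _).eq, ← mul_assoc, rpow_mul_rpow hσ, mul_assoc]
    congr 2
    ring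
  rw [Gam_of_commute hσ _ (commute_sigmaTr_rpow hS hA), trp_eq hm.le, h1,
    mul_rpow_of_commute (strictlyPositive_rpow hσ _) (star_mul_self_nonneg A)
      (commute_sigmaTr_rpow hS (mul_mem (star_mem hA) hA) _) (by positivity),
    CFC.rpow_rpow _ _ _ (by positivity) hσ, div_mul_div_comm, mul_comm 2 m,
    div_self (by positivity), CFC.rpow_one _ hσ.nonneg]

/-- Every nonzero element of the algebra is, up to its norm, a power of a density. -/
theorem exists_density (hS : S.IsDecohering) {A : Op H} (hA : A ∈ S.dfAlgebra) (hA0 : A ≠ 0)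
    {m : ℝ} (hm : 0 < m) :
    0 < wnorm S.sigmaTr (ENNReal.ofReal m) A ∧ ∃ R ∈ S.dfAlgebra, 0 ≤ R ∧
      (tr (S.sigmaTr * R)).re = 1 ∧
      star A * A = wnorm S.sigmaTr (ENNReal.ofReal m) A ^ 2 • R ^ (2 / m) := by
  have hσ := sigmaTr_strictlyPositive hS
  set n := wnorm S.sigmaTr (ENNReal.ofReal m) A with hn
  have hnm : n ^ m = (tr (S.sigmaTr * (star A * A) ^ (m / 2))).re := by
    rw [hn, wnorm_rpow _ _ hm, trp_Gam_of_mem hS hA hm]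
  have hinv : ((star A * A) ^ (m / 2)) ^ (2 / m) = star A * A := by
    rw [CFC.rpow_rpow_of_exponent_nonneg _ _ _ (by positivity) (by positivity)
      (star_mul_self_nonneg A), div_mul_div_comm, mul_comm m 2, div_self (by positivity),
      CFC.rpow_one _ (star_mul_self_nonneg A)]
  have hQ : (star A * A) ^ (m / 2) ∈ S.dfAlgebra :=
    rpow_mem (A := star A * A) (mul_mem (star_mem hA) hA) (star_mul_self_nonneg A) (m / 2)
  have hQ0 : 0 ≤ (star A * A) ^ (m / 2) := CFC.rpow_nonneg
  have hn0 : 0 < n := by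
    refine (wnorm_nonneg _ _ _).lt_of_ne' fun h => hA0 ?_
    have h0 : n = 0 := h
    rw [h0, Real.zero_rpow hm.ne'] at hnm
    have h1 := eq_zero_of_re_tr_mul hσ (D := (star A * A) ^ (m / 2)) hQ0 hnm.symm.le
    have h2 : star A * A = 0 := by
      rw [← hinv, h1, rpow_eq_cfc le_rfl, cfc_apply_zero, Real.zero_rpow (by positivity), map_zero]
    exact CStarRing.star_mul_self_eq_zero_iff A |>.1 h2
  have hpos : 0 < n ^ m := Real.rpow_pos_of_pos hn0 _
  -- The density is `|A|^m` normalised by its `σ`-mass `n ^ m`.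
  refine ⟨hn0, (n ^ m)⁻¹ • (star A * A) ^ (m / 2),
    real_smul_mem hQ _,
    smul_nonneg (inv_nonneg.2 hpos.le) hQ0, ?_, ?_⟩
  · rw [mul_smul_comm, tr_real_smul, Complex.re_ofReal_mul, ← hnm, inv_mul_cancel₀ hpos.ne']
  · rw [smul_rpow hQ0 (inv_pos.2 hpos), hinv, smul_smul,
      Real.inv_rpow hpos.le, ← Real.rpow_mul hn0.le, mul_div_cancel₀ _ hm.ne', Real.rpow_two,
      mul_inv_cancel₀ (by positivity), one_smul]

/-- Logarithms of densities of the algebra, regularised by `δ`. -/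
def logSet (S : QMS H) (δ : ℝ) : Set (Op H) :=
  {L | ∃ R ∈ S.dfAlgebra, 0 ≤ R ∧ (tr (S.sigmaTr * R)).re = 1 ∧ L = CFC.log (R + δ • (1 : Op H))}

/-- From `c ≤ σ` and `Tr σR = 1` follows `R ≤ 1/c`, so `R + δ` stays between `δ` and `1/c + δ`
uniformly in `R`. -/
theorem exists_norm_le_of_mem_logSet (hS : S.IsDecohering) {δ : ℝ} (hδ : 0 < δ) :
    ∃ C, ∀ L ∈ S.logSet δ, ‖L‖ ≤ C := by
  obtain ⟨c, hc, hle⟩ := exists_pos_smul_one_le (sigmaTr_strictlyPositive hS)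
  refine ⟨max |Real.log δ| |Real.log (c⁻¹ + δ)|, ?_⟩
  rintro L ⟨R, -, hR0, hR1, rfl⟩
  have h1 : (tr R).re ≤ c⁻¹ := by
    have := re_tr_mul_nonneg (sub_nonneg.2 hle) hR0
    rw [sub_mul, tr_sub, smul_mul_assoc, one_mul, tr_real_smul, Complex.sub_re, hR1,
      Complex.re_ofReal_mul] at this
    rw [← one_div, le_div_iff₀ hc]
    linarith
  refine norm_log_le hδ (le_add_of_nonneg_left hR0) ?_
  rw [add_smul]
  exact add_le_add_left ((le_tr_smul_one hR0).trans (smul_le_smul_of_nonneg_right h1 zero_le_one)) _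

theorem isSelfAdjoint_of_mem_logSet {δ : ℝ} {L : Op H} (hL : L ∈ S.logSet δ) :
    IsSelfAdjoint L := by
  obtain ⟨R, -, -, -, rfl⟩ := hL
  exact IsSelfAdjoint.log

/-- The density of the functional `Tr (V ·)` on the algebra. -/
def density (S : QMS H) (V : Op H) : Op H := S.dfExp (Gam S.sigmaTr (-1) V)

theorem density_mem (hS : S.IsDecohering) (V : Op H) : S.density V ∈ S.dfAlgebra :=
  (dfExp_spec hS).mem _

theorem density_strictlyPositive (hS : S.IsDecohering) {V : Op H} (hV : IsStrictlyPositive V) :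
    IsStrictlyPositive (S.density V) :=
  (dfExp_spec hS).cp.map_strictlyPositive (dfExp_spec hS).unital
    (strictlyPositive_Gam (sigmaTr_strictlyPositive hS) hV _)

theorem tr_mul_of_mem (hS : S.IsDecohering) (V : Op H) {A : Op H} (hA : A ∈ S.dfAlgebra) :
    tr (V * A) = tr (S.sigmaTr * (S.density V * A)) := by
  have hσ := sigmaTr_strictlyPositive hS
  have h1 := tr_sigmaTr_mul_dfExp hS one_mem (Gam S.sigmaTr (-1) V * A)
  rw [one_mul, one_mul, dfExp_mul_right hS hA] at h1
  have h2 : S.sigmaTr ^ (-1 / 2 : ℝ) * S.sigmaTr * S.sigmaTr ^ (-1 / 2 : ℝ) = 1 := by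
    rw [rpow_mul_self hσ, rpow_mul_rpow hσ]
    norm_num
    exact CFC.rpow_zero _ hσ.nonneg
  rw [density, h1, Gam, mul_assoc _ _ A, (commute_sigmaTr_rpow hS hA _).eq, ← mul_assoc,
    ← mul_assoc, ← mul_assoc, tr_mul_comm _ (S.sigmaTr ^ (-1 / 2 : ℝ)), ← mul_assoc, ← mul_assoc, ← mul_assoc, h2, one_mul]

end QMS

section

variable {H : Type*} [NormedAddCommGroup H] [InnerProductSpace ℂ H] [CompleteSpace H]
  [FiniteDimensional ℂ H]

theorem star_exp_smul {L : Op H} (hL : IsSelfAdjoint L) (u : ℝ) :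
    star (NormedSpace.exp (u • L)) = NormedSpace.exp (u • L) :=
  (strictlyPositive_exp (by rw [isSelfAdjoint_iff, star_smul, hL.star_eq,
    star_trivial])).nonneg.isSelfAdjoint.star_eq

theorem exp_smul_mul_exp_smul (L : Op H) (u v : ℝ) :
    NormedSpace.exp (u • L) * NormedSpace.exp (v • L) = NormedSpace.exp ((u + v) • L) := by
  rw [add_smul, exp_add_of_commute (((Commute.refl L).smul_left u).smul_right v)]

theorem smul_star_mul_self (n : ℝ) (C : Op H) :
    star (n • C) * (n • C) = n ^ 2 • (star C * C) := by
  simp [smul_smul, sq]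

theorem smul_mul_star_self (n : ℝ) (C : Op H) :
    (n • C) * star (n • C) = n ^ 2 • (C * star C) := by
  simp [smul_smul, sq]

/-- `Tr |A K B|^p` for `A^* A ≤ a² C^* C` and `B B^* ≤ b² D D^*`. -/
theorem trp_mul_mul_le {A B C D : Op H} {a b p : ℝ} (ha : 0 ≤ a) (hb : 0 ≤ b) (hp : 0 < p)
    (hA : star A * A ≤ a ^ 2 • (star C * C)) (hB : B * star B ≤ b ^ 2 • (D * star D)) (K : Op H) :
    trp p (A * K * B) ≤ (a * b) ^ p * trp p (C * K * D) := by
  calc trp p (A * K * B) = trp p (A * (K * B)) := by rw [mul_assoc]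
    _ ≤ trp p ((a • C) * (K * B)) :=
      trp_mul_mono_left hp.le (by rwa [smul_star_mul_self]) _
    _ = trp p (((a • C) * K) * B) := by rw [mul_assoc]
    _ ≤ trp p (((a • C) * K) * (b • D)) :=
      trp_mul_mono_right hp (by rwa [smul_mul_star_self]) _
    _ = trp p ((a * b) • (C * K * D)) := by
      rw [smul_mul_assoc, smul_mul_assoc, mul_smul_comm, smul_smul]
    _ = (a * b) ^ p * trp p (C * K * D) := trp_real_smul hp (mul_nonneg ha hb) _

end

/-! ### The variational problem for `Tr(V log R)` and bounds for factors in the algebra. -/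

namespace QMS

variable {H : Type*} [NormedAddCommGroup H] [InnerProductSpace ℂ H] [CompleteSpace H]
  [FiniteDimensional ℂ H] {S : QMS H}

theorem add_smul_one_mem {R : Op H} (hR : R ∈ S.dfAlgebra) (δ : ℝ) :
    R + δ • (1 : Op H) ∈ S.dfAlgebra := by
  rw [← mem_dfSubmodule]
  exact S.dfSubmodule.add_mem hR (real_smul_mem one_mem δ)

theorem strictlyPositive_add_smul_one {R : Op H} (hR : 0 ≤ R) {δ : ℝ} (hδ : 0 < δ) :
    IsStrictlyPositive (R + δ • (1 : Op H)) :=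
  IsStrictlyPositive.nonneg_add hR (strictlyPositive_smul_one hδ)

/-- The maximum of `Tr (V log R)` over the densities `R` of the algebra. -/
def maxLog (S : QMS H) (V : Op H) : ℝ :=
  (tr (V * CFC.log (S.density V))).re - (tr V).re * Real.log (tr V).re

theorem re_tr_pos (hS : S.IsDecohering) {V : Op H} (hV : IsStrictlyPositive V) :
    0 < (tr V).re := by
  refine (re_tr_nonneg hV.nonneg).lt_of_ne' fun h => ?_
  have h0 := eq_zero_of_re_tr_eq_zero hV.nonneg h.le
  obtain ⟨r, hr, hle⟩ := exists_pos_smul_one_le hV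
  have h1 := re_tr_mul_nonneg (sigmaTr_strictlyPositive hS).nonneg (sub_nonneg.2 hle)
  rw [h0, zero_sub, mul_neg, mul_smul_comm, mul_one, tr_neg, tr_real_smul, tr_sigmaTr hS] at h1
  simp at h1
  linarith

theorem re_tr_sigmaTr_mul_density (hS : S.IsDecohering) (V : Op H) :
    tr (S.sigmaTr * S.density V) = tr V := by
  simpa using (tr_mul_of_mem hS V one_mem).symm

theorem log_mem {A : Op H} (hA : A ∈ S.dfAlgebra) : CFC.log A ∈ S.dfAlgebra := cfc_mem hA _

theorem log_real_smul {T : Op H} (hT : IsStrictlyPositive T) {c : ℝ} (hc : 0 < c) :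
    CFC.log (c • T) = Real.log c • (1 : Op H) + CFC.log T := by
  rw [CFC.log_smul' T hc hT, Algebra.algebraMap_eq_smul_one]

/-- Gibbs' inequality with weight `σ^{1/2}`, between the density of `V` and `(Tr V)(R + δ)`. Their
`σ`-masses differ by exactly `(Tr V) δ`, the error term. -/
theorem re_tr_mul_le_of_mem_logSet (hS : S.IsDecohering) {V : Op H} (hV : IsStrictlyPositive V)
    {δ : ℝ} (hδ : 0 < δ) {L : Op H} (hL : L ∈ S.logSet δ) :
    (tr (V * L)).re ≤ S.maxLog V + (tr V).re * δ := by
  obtain ⟨R, hR, hR0, hR1, rfl⟩ := hL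
  have hσ := sigmaTr_strictlyPositive hS
  have hΦ := re_tr_pos hS hV
  have hT := strictlyPositive_add_smul_one hR0 hδ
  have hTp : IsStrictlyPositive ((tr V).re • (R + δ • (1 : Op H))) := by
    have := strictlyPositive_mul_of_commute (strictlyPositive_smul_one hΦ) hT
      ((Commute.one_left _).smul_left _)
    rwa [smul_mul_assoc, one_mul] at this
  have hG := density_strictlyPositive hS hV
  have h := gibbs hG.nonneg hTp (C := S.sigmaTr ^ (1 / 2 : ℝ)) CFC.rpow_nonneg.isSelfAdjoint
    (commute_sigmaTr_rpow hS (density_mem hS V) _)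
  rw [rpow_mul_rpow hσ, add_halves, CFC.rpow_one _ hσ.nonneg, log_real_smul hT hΦ, mul_add,
    mul_add, mul_smul_comm, mul_one, mul_smul_comm, tr_add, tr_real_smul, mul_smul_comm,
    tr_real_smul, mul_add, tr_add, mul_smul_comm, mul_one, tr_real_smul, tr_sigmaTr hS,
    ← tr_mul_of_mem hS V (log_mem (add_smul_one_mem hR δ)),
    ← tr_mul_of_mem hS V (log_mem (density_mem hS V)), re_tr_sigmaTr_mul_density hS,
    Complex.add_re, Complex.re_ofReal_mul, Complex.re_ofReal_mul, Complex.add_re, hR1,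
    Complex.re_ofReal_mul, Complex.one_re] at h
  rw [maxLog]
  linarith

/-- The density attaining `maxLog`. -/
def maxDensity (S : QMS H) (V : Op H) : Op H := (tr V).re⁻¹ • S.density V

theorem maxDensity_spec (hS : S.IsDecohering) {V : Op H} (hV : IsStrictlyPositive V) :
    S.maxDensity V ∈ S.dfAlgebra ∧ IsStrictlyPositive (S.maxDensity V) ∧
      (tr (S.sigmaTr * S.maxDensity V)).re = 1 ∧
      (tr (V * CFC.log (S.maxDensity V))).re = S.maxLog V := by
  have hΦ := re_tr_pos hS hV
  have hG := density_strictlyPositive hS hV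
  refine ⟨real_smul_mem (density_mem hS V) _, ?_, ?_, ?_⟩
  · have := strictlyPositive_mul_of_commute (strictlyPositive_smul_one (inv_pos.2 hΦ)) hG
      ((Commute.one_left _).smul_left _)
    rwa [smul_mul_assoc, one_mul] at this
  · rw [maxDensity, mul_smul_comm, tr_real_smul, re_tr_sigmaTr_mul_density hS,
      Complex.re_ofReal_mul, inv_mul_cancel₀ hΦ.ne']
  · rw [maxDensity, log_real_smul hG (inv_pos.2 hΦ), mul_add, mul_smul_comm, mul_one, tr_add,
      tr_real_smul, Complex.add_re, Complex.re_ofReal_mul, Real.log_inv, maxLog]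
    ring

/-- From `A^*A = ‖A‖² R^{2/m} ≤ ‖A‖² (R + δ)^{2/m}`, split symmetrically into two exponentials. -/
theorem exists_log_le (hS : S.IsDecohering) {A : Op H} (hA : A ∈ S.dfAlgebra) (hA0 : A ≠ 0)
    {m δ : ℝ} (hm : 0 < m) (hδ : 0 < δ) :
    ∃ L ∈ S.logSet δ, star A * A ≤ wnorm S.sigmaTr (ENNReal.ofReal m) A ^ 2 •
      (NormedSpace.exp (m⁻¹ • L) * NormedSpace.exp (m⁻¹ • L)) := by
  obtain ⟨-, R, hR, hR0, hR1, h⟩ := exists_density hS hA hA0 hm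
  refine ⟨_, ⟨R, hR, hR0, hR1, rfl⟩, ?_⟩
  rw [h, exp_smul_mul_exp_smul, ← rpow_eq_exp (strictlyPositive_add_smul_one hR0 hδ)]
  have h2 := rpow_le_add_rpow hR0 hδ (y := 2 / m) (by positivity)
  have h3 : m⁻¹ + m⁻¹ = 2 / m := by ring
  rw [h3]
  exact smul_le_smul_of_nonneg_left h2 (sq_nonneg _)

theorem trp_mul_mul_le_exp (hS : S.IsDecohering) {A B : Op H} (hA : A ∈ S.dfAlgebra)
    (hB : B ∈ S.dfAlgebra) (hA0 : A ≠ 0) (hB0 : B ≠ 0) {m δ p : ℝ} (hm : 0 < m) (hδ : 0 < δ)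
    (hp : 0 < p) (K : Op H) : ∃ L ∈ S.logSet δ, ∃ L' ∈ S.logSet δ,
      trp p (A * K * B) ≤ (wnorm S.sigmaTr (ENNReal.ofReal m) A *
        wnorm S.sigmaTr (ENNReal.ofReal m) B) ^ p *
        trp p (NormedSpace.exp (m⁻¹ • L) * K * NormedSpace.exp (m⁻¹ • L')) := by
  obtain ⟨L, hL, h⟩ := exists_log_le hS hA hA0 hm hδ
  obtain ⟨L', hL', h'⟩ := exists_log_le hS (star_mem hB) (star_ne_zero.2 hB0) hm hδ
  refine ⟨L, hL, L', hL', trp_mul_mul_le (wnorm_nonneg _ _ _) (wnorm_nonneg _ _ _) hp ?_ ?_ K⟩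
  · rwa [star_exp_smul (isSelfAdjoint_of_mem_logSet hL)]
  · rw [star_exp_smul (isSelfAdjoint_of_mem_logSet hL')]
    rwa [star_star, wnorm_star _ _ hm] at h'

theorem exp_neg_mul_le {A L : Op H} {n u : ℝ} (hL : IsSelfAdjoint L)
    (h : A * star A ≤ n ^ 2 • (NormedSpace.exp (u • L) * NormedSpace.exp (u • L))) :
    star (NormedSpace.exp (-u • L) * A) * (NormedSpace.exp (-u • L) * A) ≤ n ^ 2 • (1 : Op H) := by
  apply star_mul_self_le_of_mul_star_self_le
  have h1 := star_right_conjugate_le_conjugate h (NormedSpace.exp (-u • L))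
  have h2 : NormedSpace.exp (-u • L) * NormedSpace.exp (u • L) = 1 := by
    rw [exp_smul_mul_exp_smul, neg_add_cancel, zero_smul, NormedSpace.exp_zero]
  have h3 : NormedSpace.exp (u • L) * NormedSpace.exp (-u • L) = 1 := by
    rw [exp_smul_mul_exp_smul, add_neg_cancel, zero_smul, NormedSpace.exp_zero]
  rw [mul_smul_comm, smul_mul_assoc,
    ← mul_assoc (NormedSpace.exp (-u • L)) (NormedSpace.exp (u • L)), h2, one_mul,
    star_exp_smul hL, h3] at h1
  rw [star_mul, star_exp_smul hL]
  simpa only [mul_assoc] using h1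

/-- After removal of the exponentials, `exp(-L/m) A` and `B exp(-L'/m)` have operator norms at most
`‖A‖` and `‖B‖` in the weighted `m`-norm. This bounds below what any factorisation can achieve. -/
theorem trp_exp_neg_le (hS : S.IsDecohering) {A B : Op H} (hA : A ∈ S.dfAlgebra)
    (hB : B ∈ S.dfAlgebra) (hA0 : A ≠ 0) (hB0 : B ≠ 0) {m δ p : ℝ} (hm : 0 < m) (hδ : 0 < δ)
    (hp : 0 < p) (K : Op H) : ∃ L ∈ S.logSet δ, ∃ L' ∈ S.logSet δ,
      trp p (NormedSpace.exp (-m⁻¹ • L) * (A * K * B) * NormedSpace.exp (-m⁻¹ • L')) ≤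
      (wnorm S.sigmaTr (ENNReal.ofReal m) A * wnorm S.sigmaTr (ENNReal.ofReal m) B) ^ p *
        trp p K := by
  obtain ⟨L, hL, h⟩ := exists_log_le hS (star_mem hA) (star_ne_zero.2 hA0) hm hδ
  obtain ⟨L', hL', h'⟩ := exists_log_le hS hB hB0 hm hδ
  refine ⟨L, hL, L', hL', ?_⟩
  rw [star_star, wnorm_star _ _ hm] at h
  have h1 := exp_neg_mul_le (isSelfAdjoint_of_mem_logSet hL) h
  have h2 := exp_neg_mul_le (A := star B) (isSelfAdjoint_of_mem_logSet hL') (by rwa [star_star])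
  rw [star_mul, star_star, star_exp_smul (isSelfAdjoint_of_mem_logSet hL')] at h2
  have h3 := trp_mul_mul_le (A := NormedSpace.exp (-m⁻¹ • L) * A)
    (B := B * NormedSpace.exp (-m⁻¹ • L')) (C := 1) (D := 1)
    (a := wnorm S.sigmaTr (ENNReal.ofReal m) A) (b := wnorm S.sigmaTr (ENNReal.ofReal m) B)
    (wnorm_nonneg _ _ _) (wnorm_nonneg _ _ _) hp (by rwa [star_one, mul_one])
    (by rwa [star_mul, star_exp_smul (isSelfAdjoint_of_mem_logSet hL'), star_one, mul_one]) K
  simpa only [mul_assoc, one_mul, mul_one] using h3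

/-- The element is `R^{1/m}`; it serves as a normalised test element. -/
theorem wnorm_exp_log (hS : S.IsDecohering) {R : Op H} (hR : R ∈ S.dfAlgebra)
    (hR0 : IsStrictlyPositive R) (hR1 : (tr (S.sigmaTr * R)).re = 1) {m : ℝ} (hm : 0 < m) :
    NormedSpace.exp (m⁻¹ • CFC.log R) ∈ S.dfAlgebra ∧
      wnorm S.sigmaTr (ENNReal.ofReal m) (NormedSpace.exp (m⁻¹ • CFC.log R)) = 1 := by
  rw [← rpow_eq_exp hR0]
  have hmem := rpow_mem hR hR0.nonneg m⁻¹
  refine ⟨hmem, ?_⟩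
  rw [wnorm_ofReal _ _ hm, trp_Gam_of_mem hS hmem hm,
    (strictlyPositive_rpow hR0 _).nonneg.isSelfAdjoint.star_eq, mul_self_rpow
      (strictlyPositive_rpow hR0 _), CFC.rpow_rpow _ _ _ (inv_ne_zero hm.ne') hR0]
  have : m⁻¹ * (2 * (m / 2)) = 1 := by field_simp
  rw [this, CFC.rpow_one _ hR0.nonneg, hR1, Real.one_rpow]

end QMS

/-! ### Two-sided bounds on the amalgamated norm. -/

namespace QMS

variable {H : Type*} [NormedAddCommGroup H] [InnerProductSpace ℂ H] [CompleteSpace H]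
  [FiniteDimensional ℂ H] {S : QMS H}

theorem twoR_of_ne {q p : ℝ} (h : 1 / q - 1 / p ≠ 0) :
    twoR q p = ENNReal.ofReal (2 / |1 / q - 1 / p|) := by
  rw [twoR, ENNReal.ofReal_div_of_pos (abs_pos.2 h), ENNReal.ofReal_ofNat,
    ENNReal.div_eq_inv_mul, mul_comm]

theorem twoR_self (q : ℝ) : twoR q q = ∞ := by
  simp [twoR]

theorem nontrivial (hS : S.IsDecohering) : Nontrivial (Op H) := by
  have : Nontrivial H := Module.nontrivial_of_finrank_pos (R := ℂ) (finrank_pos hS)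
  infer_instance

theorem Gam_mul_mul_of_mem (hS : S.IsDecohering) {A B : Op H} (hA : A ∈ S.dfAlgebra)
    (hB : B ∈ S.dfAlgebra) (s : ℝ) (X : Op H) :
    Gam S.sigmaTr s (A * X * B) = A * Gam S.sigmaTr s X * B :=
  Gam_mul_mul s (commute_sigmaTr_rpow hS hA) (commute_sigmaTr_rpow hS hB) X

theorem one_div_sub_pos {q p : ℝ} (hq : 0 < q) (h : q < p) : 0 < 1 / q - 1 / p :=
  sub_pos.2 (one_div_lt_one_div_of_lt hq h)

theorem amalgNorm_nonneg (q p : ℝ) (X : Op H) : 0 ≤ S.amalgNorm q p X := by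
  rw [amalgNorm]
  split_ifs
  · refine Real.sInf_nonneg ?_
    rintro x ⟨A, -, B, -, Y, -, rfl⟩
    exact mul_nonneg (mul_nonneg (wnorm_nonneg _ _ _) (wnorm_nonneg _ _ _)) (wnorm_nonneg _ _ _)
  · refine Real.sSup_nonneg ?_
    rintro x ⟨A, -, B, -, -, -, rfl⟩
    exact div_nonneg (wnorm_nonneg _ _ _) (mul_nonneg (wnorm_nonneg _ _ _) (wnorm_nonneg _ _ _))

theorem le_rpow_of_forall_sInf {s : Set ℝ} (hs : s.Nonempty) (h0 : ∀ x ∈ s, 0 ≤ x) {p c : ℝ}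
    (hp : 0 < p) (h : ∀ x ∈ s, c ≤ x ^ p) : c ≤ sInf s ^ p := by
  rcases le_or_gt c 0 with hc | hc
  · exact hc.trans (Real.rpow_nonneg (Real.sInf_nonneg h0) _)
  · rw [← Real.rpow_inv_le_iff_of_pos hc.le (Real.sInf_nonneg h0) hp]
    refine le_csInf hs fun x hx => ?_
    rw [Real.rpow_inv_le_iff_of_pos hc.le (h0 x hx) hp]
    exact h x hx

theorem sInf_rpow_le {s : Set ℝ} (h0 : ∀ x ∈ s, 0 ≤ x) {p x : ℝ} (hp : 0 < p) (hx : x ∈ s) :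
    sInf s ^ p ≤ x ^ p :=
  Real.rpow_le_rpow (Real.sInf_nonneg h0) (csInf_le ⟨0, h0⟩ hx) hp.le

theorem le_amalgNorm_rpow (hS : S.IsDecohering) {q p : ℝ} (hq : 0 < q) (h : q < p) {X : Op H}
    (hX : X ≠ 0) {δ c : ℝ} (hδ : 0 < δ)
    (hc : ∀ L ∈ S.logSet δ, ∀ L' ∈ S.logSet δ,
      c ≤ trp p (NormedSpace.exp ((-((1 / q - 1 / p) / 2)) • L) * Gam S.sigmaTr (1 / p) X *
        NormedSpace.exp ((-((1 / q - 1 / p) / 2)) • L'))) :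
    c ≤ S.amalgNorm q p X ^ p := by
  have hp : 0 < p := hq.trans h
  have hs := one_div_sub_pos hq h
  rw [amalgNorm, if_pos h.le]
  refine le_rpow_of_forall_sInf ?_ ?_ hp ?_
  · exact ⟨_, 1, one_mem, 1, one_mem, X, by simp, rfl⟩
  · rintro x ⟨A, -, B, -, Y, -, rfl⟩
    exact mul_nonneg (mul_nonneg (wnorm_nonneg _ _ _) (wnorm_nonneg _ _ _)) (wnorm_nonneg _ _ _)
  · rintro x ⟨A, hA, B, hB, Y, rfl, rfl⟩
    have hA0 : A ≠ 0 := by rintro rfl; simp at hX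
    have hB0 : B ≠ 0 := by rintro rfl; simp at hX
    rw [twoR_of_ne hs.ne', abs_of_pos hs, Real.mul_rpow (mul_nonneg (wnorm_nonneg _ _ _)
      (wnorm_nonneg _ _ _)) (wnorm_nonneg _ _ _), wnorm_rpow _ _ hp]
    -- Here `m = 2r`, so that `1/m` is half of `1/q - 1/p`.
    obtain ⟨L, hL, L', hL', hle⟩ := trp_exp_neg_le hS hA hB hA0 hB0 (m := 2 / (1 / q - 1 / p))
      (div_pos two_pos hs) hδ hp (Gam S.sigmaTr (1 / p) Y)
    refine (hc L hL L' hL').trans ?_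
    rwa [inv_div, ← Gam_mul_mul_of_mem hS hA hB] at hle

theorem amalgNorm_rpow_le (hS : S.IsDecohering) {q p : ℝ} (hq : 0 < q) (h : q < p) (X : Op H)
    {R : Op H} (hR : R ∈ S.dfAlgebra) (hR0 : IsStrictlyPositive R)
    (hR1 : (tr (S.sigmaTr * R)).re = 1) :
    S.amalgNorm q p X ^ p ≤ trp p (NormedSpace.exp ((-((1 / q - 1 / p) / 2)) • CFC.log R) *
      Gam S.sigmaTr (1 / p) X * NormedSpace.exp ((-((1 / q - 1 / p) / 2)) • CFC.log R)) := by
  have hp : 0 < p := hq.trans h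
  have hs := one_div_sub_pos hq h
  set u := (1 / q - 1 / p) / 2 with hu
  obtain ⟨hmem, hone⟩ := wnorm_exp_log hS hR hR0 hR1 (m := 2 / (1 / q - 1 / p))
    (div_pos two_pos hs)
  rw [inv_div, ← hu] at hmem hone
  have hmem' : NormedSpace.exp ((-u) • CFC.log R) ∈ S.dfAlgebra := by
    rw [← rpow_eq_exp hR0]; exact rpow_mem hR hR0.nonneg _
  rw [amalgNorm, if_pos h.le, ← Gam_mul_mul_of_mem hS hmem' hmem', ← wnorm_rpow _ _ hp]
  -- The trial factorisation has `A = B = R^{u}` and middle factor `R^{-u} X R^{-u}`.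
  refine sInf_rpow_le ?_ hp ⟨_, hmem, _, hmem,
    NormedSpace.exp ((-u) • CFC.log R) * X * NormedSpace.exp ((-u) • CFC.log R), ?_, ?_⟩
  · rintro x ⟨A, -, B, -, Y, -, rfl⟩
    exact mul_nonneg (mul_nonneg (wnorm_nonneg _ _ _) (wnorm_nonneg _ _ _)) (wnorm_nonneg _ _ _)
  · rw [mul_assoc, mul_assoc _ _ (NormedSpace.exp (u • CFC.log R)), exp_smul_mul_exp_smul,
      mul_assoc _ X, ← mul_assoc, exp_smul_mul_exp_smul]
    simp
  · rw [twoR_of_ne hs.ne', abs_of_pos hs, hone, one_mul, one_mul]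

/-- The two bounds come together because the lower one needs the set to be bounded above, which `hc`
supplies; the real `sSup` of an unbounded set is `0`. -/
theorem amalgNorm_rpow_of_lt (hS : S.IsDecohering) {q p : ℝ} (hp : 0 < p) (h : p < q) (X : Op H)
    {δ c : ℝ} (hδ : 0 < δ)
    (hc : ∀ L ∈ S.logSet δ, ∀ L' ∈ S.logSet δ,
      trp p (NormedSpace.exp ((-((1 / q - 1 / p) / 2)) • L) * Gam S.sigmaTr (1 / p) X *
        NormedSpace.exp ((-((1 / q - 1 / p) / 2)) • L')) ≤ c)
    {R : Op H} (hR : R ∈ S.dfAlgebra) (hR0 : IsStrictlyPositive R)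
    (hR1 : (tr (S.sigmaTr * R)).re = 1) :
    S.amalgNorm q p X ^ p ≤ c ∧
      trp p (NormedSpace.exp ((-((1 / q - 1 / p) / 2)) • CFC.log R) * Gam S.sigmaTr (1 / p) X *
        NormedSpace.exp ((-((1 / q - 1 / p) / 2)) • CFC.log R)) ≤ S.amalgNorm q p X ^ p := by
  have hs : 1 / q - 1 / p < 0 := by have := one_div_sub_pos hp h; linarith
  have hs' : 0 < -(1 / q - 1 / p) := neg_pos.2 hs
  have hm : 0 < 2 / -(1 / q - 1 / p) := div_pos two_pos hs'
  have hinv : (2 / -(1 / q - 1 / p))⁻¹ = -((1 / q - 1 / p) / 2) := by rw [inv_div, neg_div]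
  have := nontrivial hS
  set T := {x : ℝ | ∃ A ∈ S.dfAlgebra, ∃ B ∈ S.dfAlgebra, A ≠ 0 ∧ B ≠ 0 ∧
      x = wnorm S.sigmaTr (ENNReal.ofReal p) (A * X * B) /
        (wnorm S.sigmaTr (twoR q p) A * wnorm S.sigmaTr (twoR q p) B)} with hT
  have hF : S.amalgNorm q p X = sSup T := by rw [amalgNorm, if_neg (not_le.2 h)]
  have h0 : ∀ x ∈ T, 0 ≤ x := by
    rintro x ⟨A, -, B, -, -, -, rfl⟩
    exact div_nonneg (wnorm_nonneg _ _ _) (mul_nonneg (wnorm_nonneg _ _ _) (wnorm_nonneg _ _ _))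
  have hTc : ∀ x ∈ T, x ^ p ≤ c := by
    rintro x ⟨A, hA, B, hB, hA0, hB0, rfl⟩
    rw [twoR_of_ne hs.ne, abs_of_neg hs]
    have hnA := (exists_density hS hA hA0 hm).1
    have hnB := (exists_density hS hB hB0 hm).1
    rw [Real.div_rpow (wnorm_nonneg _ _ _) (mul_pos hnA hnB).le, wnorm_rpow _ _ hp,
      div_le_iff₀ (Real.rpow_pos_of_pos (mul_pos hnA hnB) _), mul_comm c]
    obtain ⟨L, hL, L', hL', hle⟩ := trp_mul_mul_le_exp hS hA hB hA0 hB0 hm hδ hp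
      (Gam S.sigmaTr (1 / p) X)
    rw [Gam_mul_mul_of_mem hS hA hB]
    refine hle.trans (mul_le_mul_of_nonneg_left ?_ (Real.rpow_nonneg (mul_pos hnA hnB).le _))
    rw [hinv]
    exact hc L hL L' hL'
  have hne : T.Nonempty := ⟨_, 1, one_mem, 1, one_mem, one_ne_zero, one_ne_zero, rfl⟩
  have hc0 : 0 ≤ c := by
    obtain ⟨x, hx⟩ := hne
    exact (Real.rpow_nonneg (h0 x hx) _).trans (hTc x hx)
  have hTc' : ∀ x ∈ T, x ≤ c ^ p⁻¹ := fun x hx =>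
    (Real.le_rpow_inv_iff_of_pos (h0 x hx) hc0 hp).2 (hTc x hx)
  rw [hF]
  constructor
  · exact (Real.le_rpow_inv_iff_of_pos (Real.sSup_nonneg h0) hc0 hp).1 (csSup_le hne hTc')
  · obtain ⟨hmem, hone⟩ := wnorm_exp_log hS hR hR0 hR1 hm
    rw [hinv] at hmem hone
    rw [← Gam_mul_mul_of_mem hS hmem hmem, ← wnorm_rpow _ _ hp]
    have hE : NormedSpace.exp (-((1 / q - 1 / p) / 2) • CFC.log R) ≠ 0 := by
      rw [← rpow_eq_exp hR0]; exact (isUnit_rpow hR0 _).ne_zero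
    refine Real.rpow_le_rpow (wnorm_nonneg _ _ _) (le_csSup ⟨_, hTc'⟩ ⟨_, hmem, _, hmem, hE, hE, ?_⟩)
      hp.le
    rw [twoR_of_ne hs.ne, abs_of_neg hs, hone, one_mul, div_one]

/-- At `p = q` the factors carry the operator norm, and `Tr |AKB|^q ≤ (‖A‖‖B‖)^q Tr |K|^q` makes the
trivial factorisation optimal. -/
theorem amalgNorm_self_rpow (hS : S.IsDecohering) {q : ℝ} (hq : 0 < q) (X : Op H) :
    S.amalgNorm q q X ^ q = trp q (Gam S.sigmaTr (1 / q) X) := by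
  have := nontrivial hS
  rw [amalgNorm, if_pos le_rfl]
  have hinf : ∀ A : Op H, wnorm S.sigmaTr (twoR q q) A = ‖A‖ := fun A => by
    rw [twoR_self, wnorm, if_pos rfl]
  simp only [hinf]
  refine le_antisymm ?_ (le_rpow_of_forall_sInf ?_ ?_ hq ?_)
  · rw [← wnorm_rpow _ _ hq]
    refine sInf_rpow_le ?_ hq ⟨1, one_mem, 1, one_mem, X, by simp, by simp⟩
    rintro x ⟨A, -, B, -, Y, -, rfl⟩
    exact mul_nonneg (by positivity) (wnorm_nonneg _ _ _)
  · exact ⟨_, 1, one_mem, 1, one_mem, X, by simp, rfl⟩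
  · rintro x ⟨A, -, B, -, Y, -, rfl⟩
    exact mul_nonneg (by positivity) (wnorm_nonneg _ _ _)
  · rintro x ⟨A, hA, B, hB, Y, rfl, rfl⟩
    rw [Real.mul_rpow (by positivity) (wnorm_nonneg _ _ _), wnorm_rpow _ _ hq,
      Gam_mul_mul_of_mem hS hA hB]
    have h := trp_mul_mul_le (A := A) (B := B) (C := 1) (D := 1) (norm_nonneg A) (norm_nonneg B) hq
      (by rw [star_one, one_mul, ← Algebra.algebraMap_eq_smul_one]
          exact CStarAlgebra.star_mul_le_algebraMap_norm_sq)
      (by rw [star_one, one_mul, ← Algebra.algebraMap_eq_smul_one]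
          exact CStarAlgebra.mul_star_le_algebraMap_norm_sq)
      (Gam S.sigmaTr (1 / q) Y)
    rwa [one_mul, mul_one] at h

end QMS

/-! ### Derivative of the weighting map. -/

section

variable {H : Type*} [NormedAddCommGroup H] [InnerProductSpace ℂ H] [CompleteSpace H]
  [FiniteDimensional ℂ H]

theorem hasDerivWithinAt_rpow_const {σ : Op H} (hσ : IsStrictlyPositive σ) {y : ℝ → ℝ} {y' : ℝ}
    {T : Set ℝ} {t : ℝ} (hy : HasDerivWithinAt y y' T t) :
    HasDerivWithinAt (fun t => σ ^ y t) (y' • (σ ^ y t * CFC.log σ)) T t := by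
  simp only [rpow_eq_exp hσ]
  exact (hasDerivAt_exp_smul_const (𝕂 := ℝ) (CFC.log σ) (y t)).scomp_hasDerivWithinAt t hy

theorem commute_rpow_log {σ : Op H} (hσ : IsStrictlyPositive σ) (y : ℝ) :
    Commute (σ ^ y) (CFC.log σ) := by
  rw [rpow_eq_cfc hσ.nonneg]
  exact (((Commute.refl σ).cfc_real Real.log).symm.cfc_real _)

theorem hasDerivWithinAt_Gam {σ : Op H} (hσ : IsStrictlyPositive σ) {y : ℝ → ℝ} {y' : ℝ}
    {Y : ℝ → Op H} {Y' : Op H} {T : Set ℝ} {t : ℝ} (hy : HasDerivWithinAt y y' T t)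
    (hY : HasDerivWithinAt Y Y' T t) :
    HasDerivWithinAt (fun t => Gam σ (y t) (Y t))
      ((y' / 2) • (CFC.log σ * Gam σ (y t) (Y t) + Gam σ (y t) (Y t) * CFC.log σ)
        + Gam σ (y t) Y') T t := by
  have h := hasDerivWithinAt_rpow_const hσ (hy.div_const 2)
  refine ((h.fun_mul hY).fun_mul h).congr_deriv ?_
  have hc := (commute_rpow_log hσ (y t / 2)).eq
  simp only [Gam, add_mul, smul_add, mul_smul_comm, smul_mul_assoc]
  simp only [hc, mul_assoc]
  abel

theorem tr_rpow_mul_log_add {M L : Op H} (hM : IsStrictlyPositive M) (q : ℝ) :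
    tr (M ^ (q - 1) * (L * M + M * L)) = 2 * tr (M ^ q * L) := by
  rw [mul_add, tr_add, ← mul_assoc, ← mul_assoc, rpow_mul_self hM, tr_mul_comm _ M, ← mul_assoc,
    self_mul_rpow hM, sub_add_cancel]
  ring

end

/-! ### First-order expansion and derivative of the amalgamated norm. -/

namespace QMS

variable {H : Type*} [NormedAddCommGroup H] [InnerProductSpace ℂ H] [CompleteSpace H]
  [FiniteDimensional ℂ H] {S : QMS H}

/-- Both signs of `1/q - 1/p` give the same linear coefficient: an infimum with negative exponents
on `R` and a supremum with positive ones both select the maximum of `Tr(V log R)`. -/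
theorem amalgNorm_rpow_isLittleO (hS : S.IsDecohering) {ι : Type*} {l : Filter ι} {q : ℝ}
    (hq : 0 < q) {p : ι → ℝ} {X : ι → Op H} {M₀ : Op H} (hp : Tendsto p l (𝓝 q))
    (hM : Tendsto (fun i => Gam S.sigmaTr (1 / p i) (X i)) l (𝓝 M₀)) (hM₀ : IsStrictlyPositive M₀)
    (hpos : ∀ᶠ i in l, IsStrictlyPositive (X i)) :
    (fun i => S.amalgNorm q (p i) (X i) ^ p i - trp (p i) (Gam S.sigmaTr (1 / p i) (X i))
      + q * S.maxLog (M₀ ^ q) * (1 / q - 1 / p i)) =o[l] fun i => 1 / q - 1 / p i := by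
  have hσ := sigmaTr_strictlyPositive hS
  have := nontrivial hS
  have hV := strictlyPositive_rpow hM₀ q
  have hΦ := re_tr_pos hS hV
  set V := M₀ ^ q with hVdef
  have hMpos : ∀ᶠ i in l, IsStrictlyPositive (Gam S.sigmaTr (1 / p i) (X i)) :=
    hpos.mono fun i hi => strictlyPositive_Gam hσ hi _
  have hs : Tendsto (fun i => -((1 / q - 1 / p i) / 2)) l (𝓝 0) := by
    have h1 : Tendsto (fun i => 1 / p i) l (𝓝 (1 / q)) :=
      tendsto_const_nhds.div hp hq.ne'
    have := ((h1.const_sub (1 / q)).div_const 2).neg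
    simpa using this
  obtain ⟨hR, hR0, hR1, hRκ⟩ := maxDensity_spec hS hV
  set L₀ := CFC.log (S.maxDensity V) with hL₀
  have hatt := trp_exp_conj_isLittleO hM hM₀ hMpos hp hq hs (L := fun _ => L₀) (L' := fun _ => L₀)
    (C := ‖L₀‖) (Eventually.of_forall fun _ => le_rfl) (Eventually.of_forall fun _ => le_rfl)
  rw [isLittleO_iff] at hatt ⊢
  intro ε hε
  -- Half of the tolerance pays for the regularisation, the other half for the uniform expansion.
  set δ := ε / 2 / (q * (tr V).re) with hδdef
  have hδ : 0 < δ := by positivity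
  have hδε : q * (tr V).re * δ = ε / 2 := by
    rw [hδdef]; exact mul_div_cancel₀ _ (by positivity)
  obtain ⟨C, hC⟩ := exists_norm_le_of_mem_logSet hS hδ
  -- The product with a principal filter turns the expansion into one that is uniform over all pairs
  -- of logarithms.
  have hunif := trp_exp_conj_isLittleO (l := l ×ˢ 𝓟 (S.logSet δ ×ˢ S.logSet δ))
    (M := fun i => Gam S.sigmaTr (1 / p i.1) (X i.1)) (p := fun i => p i.1)
    (s := fun i => -((1 / q - 1 / p i.1) / 2)) (L := fun i => i.2.1) (L' := fun i => i.2.2) (C := C)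
    (hM.comp tendsto_fst) hM₀ (tendsto_fst.eventually hMpos) (hp.comp tendsto_fst) hq
    (hs.comp tendsto_fst)
    (eventually_prod_principal_iff.2 (Eventually.of_forall fun _ y hy => hC _ hy.1))
    (eventually_prod_principal_iff.2 (Eventually.of_forall fun _ y hy => hC _ hy.2))
  rw [isLittleO_iff] at hunif
  have hunif' := eventually_prod_principal_iff.1 (hunif hε)
  filter_upwards [hatt hε, hunif', hpos, hp.eventually_const_lt hq] with i h1 h2 h3 h4
  set s := 1 / q - 1 / p i with hsdef
  set Φ := trp (p i) (Gam S.sigmaTr (1 / p i) (X i)) with hΦdef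
  have htr : ∀ L L' : Op H, (tr (V * (L + L'))).re = (tr (V * L)).re + (tr (V * L')).re :=
    fun L L' => by rw [mul_add, tr_add, Complex.add_re]
  rw [htr, hRκ, Real.norm_eq_abs, Real.norm_eq_abs, abs_neg, abs_div, abs_two, abs_le] at h1
  rw [Real.norm_eq_abs, Real.norm_eq_abs, abs_le]
  have hb : ∀ L ∈ S.logSet δ, q * (tr (V * L)).re ≤ q * S.maxLog V + ε / 2 := fun L hL => by
    have := mul_le_mul_of_nonneg_left (re_tr_mul_le_of_mem_logSet hS hV hδ hL) hq.le
    rw [← hδε]; linarith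
  have h2' : ∀ L ∈ S.logSet δ, ∀ L' ∈ S.logSet δ, _ := fun L hL L' hL' => h2 (L, L') ⟨hL, hL'⟩
  simp only [← hVdef, htr, Real.norm_eq_abs, abs_neg, abs_div, abs_two] at h2'
  rcases lt_trichotomy q (p i) with hlt | heq | hgt
  · have hs0 : 0 < s := one_div_sub_pos hq hlt
    rw [abs_of_pos hs0] at h1 ⊢
    have hup := amalgNorm_rpow_le hS hq hlt (X i) hR hR0 hR1
    have hlow : Φ - q * S.maxLog V * s - ε * s ≤ S.amalgNorm q (p i) (X i) ^ p i := by
      refine le_amalgNorm_rpow hS hq hlt h3.isUnit.ne_zero hδ fun L hL L' hL' => ?_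
      have h5 := h2' L hL L' hL'
      rw [abs_of_pos hs0, abs_le] at h5
      have h6 := mul_le_mul_of_nonneg_left (add_le_add (hb L hL) (hb L' hL')) hs0.le
      rw [← hsdef]
      linarith [h5.1]
    rw [← hsdef, ← hL₀] at hup
    constructor
    · linarith
    · linarith [h1.2]
  -- When `p i = q` the little-o bound has right side `0`, so an exact identity is required.
  · have : s = 0 := by rw [hsdef, heq, sub_self]
    have hJ : S.amalgNorm q (p i) (X i) ^ p i = Φ := by
      rw [hΦdef, ← heq, amalgNorm_self_rpow hS hq]
    rw [this, hJ]
    simp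
  · have hs0 : s < 0 := by have := one_div_sub_pos h4 hgt; rw [hsdef]; linarith
    rw [abs_of_neg hs0] at h1 ⊢
    have hc : ∀ L ∈ S.logSet δ, ∀ L' ∈ S.logSet δ,
        trp (p i) (NormedSpace.exp ((-((1 / q - 1 / p i) / 2)) • L) *
          Gam S.sigmaTr (1 / p i) (X i) * NormedSpace.exp ((-((1 / q - 1 / p i) / 2)) • L'))
          ≤ Φ - q * S.maxLog V * s - ε * s := fun L hL L' hL' => by
      have h5 := h2' L hL L' hL'
      rw [abs_of_neg hs0, abs_le] at h5
      have h6 := mul_le_mul_of_nonneg_left (add_le_add (hb L hL) (hb L' hL')) (neg_pos.2 hs0).le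
      rw [← hsdef]
      linarith [h5.2]
    obtain ⟨hup, hlow⟩ := amalgNorm_rpow_of_lt hS h4 hgt (X i) hδ hc hR hR0 hR1
    rw [← hsdef, ← hL₀] at hlow
    constructor
    · linarith [h1.1]
    · linarith

/-- Stated within a set `T` so that one argument serves the two-sided and the right derivative. -/
theorem hasDerivWithinAt_amalgNorm (hS : S.IsDecohering) {q : ℝ} (hq : 0 < q) {p : ℝ → ℝ}
    {p' : ℝ} {Y : ℝ → Op H} {Y' : Op H} {T : Set ℝ} (h0 : 0 ∈ T) (hp0 : p 0 = q)
    (hp : HasDerivWithinAt p p' T 0) (hY : HasDerivWithinAt Y Y' T 0)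
    (hpos : ∀ᶠ t in 𝓝[T] 0, IsStrictlyPositive (Y t)) {M V : Op H}
    (hM : M = Gam S.sigmaTr (1 / q) (Y 0)) (hV : V = M ^ q) :
    HasDerivWithinAt (fun t => S.amalgNorm q (p t) (Y t))
      (1 / (q * wnorm S.sigmaTr (ENNReal.ofReal q) (Y 0) ^ (q - 1)) *
        (p' * ((tr (V * CFC.log M)).re - 1 / q * (tr (V * CFC.log S.sigmaTr)).re
            - 1 / q * (tr (V * CFC.log (S.density V))).re) +
          q * (tr (M ^ (q - 1) * Gam S.sigmaTr (1 / q) Y')).re)) T 0 := by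
  have hσ := sigmaTr_strictlyPositive hS
  have hMp : IsStrictlyPositive M := by
    rw [hM]; exact strictlyPositive_Gam hσ (hpos.self_of_nhdsWithin h0) _
  have hVp : IsStrictlyPositive V := by rw [hV]; exact strictlyPositive_rpow hMp q
  have hΦ := re_tr_pos hS hVp
  have hy : HasDerivWithinAt (fun t => 1 / p t) (-p' / q ^ 2) T 0 := by
    have := hp.fun_inv (by rw [hp0]; exact hq.ne')
    simpa [hp0] using this
  have hMd := hasDerivWithinAt_Gam hσ hy hY
  have hΦd := hasDerivWithinAt_trp h0 hMd hp
    (hpos.mono fun t ht => strictlyPositive_Gam hσ ht _) (by rw [hp0]; exact hq)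
  simp only [hp0] at hMd hΦd
  rw [← hM] at hΦd
  rw [← hV, mul_add, mul_smul_comm, tr_add, tr_real_smul, tr_rpow_mul_log_add hMp, ← hV] at hΦd
  have hpt : Tendsto p (𝓝[T] 0) (𝓝 q) := hp0 ▸ hp.continuousWithinAt.tendsto
  have hMt : Tendsto (fun t => Gam S.sigmaTr (1 / p t) (Y t)) (𝓝[T] 0) (𝓝 M) := by
    have := hMd.continuousWithinAt.tendsto
    simp only [hp0] at this
    rwa [← hM] at this
  have hlo := amalgNorm_rpow_isLittleO hS hq hpt hMt hMp hpos
  rw [← hV] at hlo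
  have hsd : HasDerivWithinAt (fun t => 1 / q - 1 / p t) (p' / q ^ 2) T 0 := by
    refine (hy.const_sub (1 / q)).congr_deriv ?_
    ring
  have hJ0 : S.amalgNorm q (p 0) (Y 0) ^ p 0 = (tr V).re := by
    rw [hp0, amalgNorm_self_rpow hS hq, ← hM, trp_of_nonneg hMp.nonneg, hV]
  have hΦ0 : trp (p 0) (Gam S.sigmaTr (1 / p 0) (Y 0)) = (tr V).re := by
    rw [hp0, ← hM, trp_of_nonneg hMp.nonneg, hV]
  have hbig : (fun t => 1 / q - 1 / p t) =O[𝓝[T] 0] fun t => t - 0 := by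
    have := hsd.hasFDerivWithinAt.isBigO_sub
    simpa [hp0] using this
  have hrest : HasDerivWithinAt (fun t => S.amalgNorm q (p t) (Y t) ^ p t
      - trp (p t) (Gam S.sigmaTr (1 / p t) (Y t)) + q * S.maxLog V * (1 / q - 1 / p t)) 0 T 0 := by
    rw [hasDerivWithinAt_iff_isLittleO, hJ0, hΦ0, hp0]
    simpa using hlo.trans_isBigO hbig
  have hJ : HasDerivWithinAt (fun t => S.amalgNorm q (p t) (Y t) ^ p t) _ T 0 :=
    ((hrest.add hΦd).sub (hsd.const_mul (q * S.maxLog V))).congr_of_eventuallyEq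
      (Eventually.of_forall fun t => by simp only [Pi.add_apply, Pi.sub_apply]; ring)
      (by simp only [Pi.add_apply, Pi.sub_apply]; ring)
  -- The derivative of the outer exponent `1/p` produces a multiple of `Tr V log Tr V`, which
  -- cancels the one inside `maxLog`.
  have hF := hJ.rpow hy (by rw [hJ0]; exact hΦ)
  rw [hp0] at hJ0
  simp only [hp0, hJ0] at hF
  have hFc : (fun t => S.amalgNorm q (p t) (Y t)) =ᶠ[𝓝[T] 0]
      fun t => (S.amalgNorm q (p t) (Y t) ^ p t) ^ (1 / p t) := by
    filter_upwards [hpt.eventually_const_lt hq] with t ht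
    rw [← Real.rpow_mul (amalgNorm_nonneg _ _ _), mul_one_div_cancel ht.ne', Real.rpow_one]
  refine (hF.congr_of_eventuallyEq_of_mem hFc h0).congr_deriv ?_
  have hw : wnorm S.sigmaTr (ENNReal.ofReal q) (Y 0) = (tr V).re ^ (1 / q) := by
    rw [wnorm_ofReal _ _ hq, ← hM, trp_of_nonneg hMp.nonneg, hV]
  rw [hw, ← Real.rpow_mul hΦ.le, maxLog]
  have he : (1 / q) * (q - 1) = -(1 / q - 1) := by field_simp; ring
  have he2 : (tr V).re ^ (1 / q) = (tr V).re ^ (1 / q - 1) * (tr V).re := by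
    rw [← Real.rpow_add_one hΦ.ne', sub_add_cancel]
  rw [he, Real.rpow_neg hΦ.le, he2, Complex.add_re, Complex.re_ofReal_mul, two_mul (tr _),
    Complex.add_re]
  have hz : (tr V).re ^ (1 / q - 1) ≠ 0 := (Real.rpow_pos_of_pos hΦ _).ne'
  field_simp
  ring

end QMS

/-! ### Identification with the entropy and the Dirichlet form. -/

section

variable {H : Type*} [NormedAddCommGroup H] [InnerProductSpace ℂ H] [CompleteSpace H]
  [FiniteDimensional ℂ H]

theorem toReal_holderConj_inv {q : ℝ} (hq : 1 ≤ q) : ((holderConj q)⁻¹).toReal = 1 - 1 / q := by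
  have h1 : 1 ≤ ENNReal.ofReal q := by simpa using hq
  have := ENNReal.HolderConjugate.conjExponent h1
  have h := congrArg ENNReal.toReal
    (ENNReal.HolderConjugate.inv_add_inv_eq_one (ENNReal.ofReal q) (ENNReal.ofReal q).conjExponent)
  have h2 : (ENNReal.ofReal q)⁻¹ ≠ ∞ := by simp; linarith
  have h3 : ((ENNReal.ofReal q).conjExponent)⁻¹ ≠ ∞ := by
    rw [Ne, ENNReal.inv_eq_top, ENNReal.conjExponent]
    simp
  rw [ENNReal.toReal_add h2 h3, ENNReal.toReal_one, ENNReal.toReal_inv,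
    ENNReal.toReal_ofReal (by linarith)] at h
  rw [holderConj, one_div]
  linarith

theorem Gam_Gam {σ : Op H} (hσ : IsStrictlyPositive σ) (s t : ℝ) (X : Op H) :
    Gam σ s (Gam σ t X) = Gam σ (s + t) X := by
  rw [Gam, Gam, Gam, add_div, ← rpow_mul_rpow hσ]
  conv_rhs => rw [(show σ ^ (s / 2) * σ ^ (t / 2) * X * (σ ^ (s / 2) * σ ^ (t / 2)) =
    σ ^ (s / 2) * σ ^ (t / 2) * X * (σ ^ (t / 2) * σ ^ (s / 2)) by
      rw [rpow_mul_rpow hσ (t / 2), add_comm, ← rpow_mul_rpow hσ])]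
  simp only [mul_assoc]

theorem Gam_zero {σ : Op H} (hσ : IsStrictlyPositive σ) (X : Op H) : Gam σ 0 X = X := by
  rw [Gam, zero_div, CFC.rpow_zero _ hσ.nonneg, one_mul, mul_one]

theorem Gam_add (σ : Op H) (s : ℝ) (X Y : Op H) : Gam σ s (X + Y) = Gam σ s X + Gam σ s Y := by
  rw [Gam, mul_add, add_mul]; rfl

theorem Gam_smul (σ : Op H) (s c : ℝ) (X : Op H) : Gam σ s (c • X) = c • Gam σ s X := by
  rw [Gam, mul_smul_comm, smul_mul_assoc]; rfl

theorem Gam_log_mul_add {σ : Op H} (hσ : IsStrictlyPositive σ) (s : ℝ) (X : Op H) :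
    Gam σ s (CFC.log σ * X + X * CFC.log σ) =
      CFC.log σ * Gam σ s X + Gam σ s X * CFC.log σ := by
  have hc := (commute_rpow_log hσ (s / 2)).eq
  simp only [Gam, mul_add, add_mul]
  rw [← mul_assoc, hc, mul_assoc, mul_assoc, mul_assoc, mul_assoc, mul_assoc, mul_assoc, mul_assoc,
    hc]

/-- The weight of the inner product and that of `I` combine to `Γ^{1 - (1 - 1/q)} = Γ^{1/q}`. For `q
= 1` the conjugate exponent is `∞` with reciprocal `0`. -/
theorem innerσ_Imap {σ X : Op H} (hσ : IsStrictlyPositive σ) (hX : IsStrictlyPositive X) {q : ℝ}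
    (hq : 1 ≤ q) (Z : Op H) :
    innerσ σ (Imap σ (holderConj q) q X) Z =
      tr (Gam σ (1 / q) X ^ (q - 1) * Gam σ (1 / q) Z) := by
  have hq0 : q ≠ 0 := by positivity
  have hM := strictlyPositive_Gam hσ hX (1 / q)
  have he : q * (1 - 1 / q) = q - 1 := by field_simp
  rw [innerσ, Imap, toReal_holderConj_inv hq, CFC.abs_of_nonneg _ hM.nonneg, he, star_Gam,
    CFC.rpow_nonneg.isSelfAdjoint.star_eq]
  have h1 : σ ^ (1 / 2 : ℝ) * Gam σ (-(1 - 1 / q)) (Gam σ (1 / q) X ^ (q - 1)) * σ ^ (1 / 2 : ℝ)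
      = Gam σ (1 / q) (Gam σ (1 / q) X ^ (q - 1)) := by
    have := Gam_Gam hσ 1 (-(1 - 1 / q)) (Gam σ (1 / q) X ^ (q - 1))
    rw [Gam] at this
    rw [this]
    congr 1
    ring
  rw [h1, Gam, Gam, Gam]
  simp only [mul_assoc]
  rw [tr_mul_comm]
  simp only [mul_assoc]

/-- Near `s = 0` the map is `Γ^{-1/(q+s)}(M^{q/(q+s)})`; the two terms come from differentiating the
weight and the power. -/
theorem opEntropy_eq {σ X : Op H} (hσ : IsStrictlyPositive σ) (hX : IsStrictlyPositive X) {q : ℝ}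
    (hq : 0 < q) :
    opEntropy σ q X = (-q) • ((1 / q ^ 2 / 2) • (CFC.log σ * X + X * CFC.log σ) +
      Gam σ (-(1 / q)) ((-(1 / q)) • (Gam σ (1 / q) X * CFC.log (Gam σ (1 / q) X)))) := by
  have hM := strictlyPositive_Gam hσ hX (1 / q)
  set M := Gam σ (1 / q) X with hMdef
  have hi : HasDerivWithinAt (fun s : ℝ => (q + s)⁻¹) (-1 / q ^ 2) univ 0 := by
    have := ((hasDerivAt_id (0 : ℝ)).const_add q).fun_inv (by simpa using hq.ne')
    simpa using this.hasDerivWithinAt (s := univ)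
  have hW := hasDerivWithinAt_rpow_const hM (hi.const_mul q)
  have h := (hasDerivWithinAt_Gam hσ hi.fun_neg hW).hasDerivAt univ_mem
  have hev : (fun s : ℝ => Imap σ (ENNReal.ofReal (q + s)) q X) =ᶠ[𝓝 0]
      fun s => Gam σ (-(q + s)⁻¹) (M ^ (q * (q + s)⁻¹)) := by
    have : Tendsto (fun s : ℝ => q + s) (𝓝 0) (𝓝 (q + 0)) := tendsto_id.const_add q
    rw [add_zero] at this
    filter_upwards [this.eventually_const_lt hq] with s hs
    rw [Imap, ENNReal.toReal_inv, ENNReal.toReal_ofReal hs.le, ← hMdef,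
      CFC.abs_of_nonneg _ hM.nonneg]
  have hX' : Gam σ (-q⁻¹) M = X := by
    rw [hMdef, Gam_Gam hσ, one_div, neg_add_cancel, Gam_zero hσ]
  rw [opEntropy, hev.deriv_eq, HasDerivAt.deriv h]
  simp only [add_zero, mul_inv_cancel₀ hq.ne', CFC.rpow_one _ hM.nonneg, hX']
  have e1 : -(-1 / q ^ 2) / 2 = 1 / q ^ 2 / 2 := by ring
  have e2 : q * (-1 / q ^ 2) = -(1 / q) := by field_simp
  rw [e1, e2, ← one_div]

theorem innerσ_opEntropy {σ X : Op H} (hσ : IsStrictlyPositive σ) (hX : IsStrictlyPositive X)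
    {q : ℝ} (hq : 1 ≤ q) {M : Op H} (hM : M = Gam σ (1 / q) X) :
    (innerσ σ (Imap σ (holderConj q) q X) (opEntropy σ q X)).re =
      (tr (M ^ q * CFC.log M)).re - 1 / q * (tr (M ^ q * CFC.log σ)).re := by
  have hMp : IsStrictlyPositive M := hM ▸ strictlyPositive_Gam hσ hX (1 / q)
  have hq0 : q ≠ 0 := by positivity
  rw [innerσ_Imap hσ hX hq, opEntropy_eq hσ hX (by positivity), Gam_smul, Gam_add, Gam_smul,
    Gam_log_mul_add hσ, Gam_Gam hσ, add_neg_cancel, Gam_zero hσ, ← hM, mul_smul_comm, mul_add,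
    mul_smul_comm, mul_smul_comm, tr_real_smul, tr_add, tr_real_smul, tr_real_smul,
    tr_rpow_mul_log_add hMp, ← mul_assoc (M ^ (q - 1)), rpow_mul_self hMp, sub_add_cancel, two_mul,
    Complex.re_ofReal_mul, Complex.add_re, Complex.re_ofReal_mul, Complex.re_ofReal_mul,
    Complex.add_re]
  field_simp
  ring

end

namespace QMS

variable {H : Type*} [NormedAddCommGroup H] [InnerProductSpace ℂ H] [CompleteSpace H]
  [FiniteDimensional ℂ H] {S : QMS H}

theorem Ent_eq (hS : S.IsDecohering) {q : ℝ} (hq : 1 ≤ q) {X : Op H} (hX : IsStrictlyPositive X)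
    {M : Op H} (hM : M = Gam S.sigmaTr (1 / q) X) :
    S.Ent q X = (tr (M ^ q * CFC.log M)).re - 1 / q * (tr (M ^ q * CFC.log S.sigmaTr)).re
      - 1 / q * (tr (M ^ q * CFC.log (S.density (M ^ q)))).re := by
  rw [Ent, innerσ_opEntropy (sigmaTr_strictlyPositive hS) hX hq hM, ← hM, density]

/-- For `q > 1` the prefactors cancel. For `q = 1` the right side is zero and the left side is `Tr
σL(X)`, zero by invariance. -/
theorem tr_generator_eq_dirichlet (hS : S.IsDecohering) {q : ℝ} (hq : 1 ≤ q) {X : Op H}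
    (hX : IsStrictlyPositive X) :
    q * (tr (Gam S.sigmaTr (1 / q) X ^ (q - 1) * Gam S.sigmaTr (1 / q) (S.generator X))).re =
      -(2 * (q - 1) * S.dirichlet q X) := by
  have hσ := sigmaTr_strictlyPositive hS
  rcases hq.eq_or_lt with rfl | hq1
  · rw [sub_self, CFC.rpow_zero _ (strictlyPositive_Gam hσ hX _).nonneg, one_mul, one_mul, Gam, tr_mul_comm,
      ← mul_assoc, rpow_mul_rpow hσ, add_halves, div_one, CFC.rpow_one _ hσ.nonneg,
      tr_sigmaTr_mul_generator hS]
    simp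
  · rw [dirichlet, dirichletAux, if_neg hq1.ne', innerσ_Imap hσ hX hq]
    have : q - 1 ≠ 0 := by linarith
    field_simp

theorem hasDerivWithinAt_amalgNorm_Ent (hS : S.IsDecohering) {q : ℝ} (hq : 1 ≤ q) {p : ℝ → ℝ}
    {p' : ℝ} {Y : ℝ → Op H} {Y' : Op H} {T : Set ℝ} (h0 : 0 ∈ T) (hp0 : p 0 = q)
    (hp : HasDerivWithinAt p p' T 0) (hY : HasDerivWithinAt Y Y' T 0)
    (hpos : ∀ᶠ t in 𝓝[T] 0, IsStrictlyPositive (Y t)) :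
    HasDerivWithinAt (fun t => S.amalgNorm q (p t) (Y t))
      (1 / (q * wnorm S.sigmaTr (ENNReal.ofReal q) (Y 0) ^ (q - 1)) *
        (p' * S.Ent q (Y 0) +
          q * (tr (Gam S.sigmaTr (1 / q) (Y 0) ^ (q - 1) * Gam S.sigmaTr (1 / q) Y')).re)) T 0 := by
  rw [Ent_eq hS hq (hpos.self_of_nhdsWithin h0) rfl]
  exact hasDerivWithinAt_amalgNorm hS (by positivity) h0 hp0 hp hY hpos rfl rfl

end QMS

end DFNorm

end

theorem mainTheorem9 {H : Type*} [NormedAddCommGroup H] [InnerProductSpace ℂ H]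
    [CompleteSpace H] [FiniteDimensional ℂ H]
    (S : DFNorm.QMS H) (hS : S.IsDecohering)
    (q : ℝ) (hq : 1 ≤ q) (p : ℝ → ℝ) (hp : ContDiffAt ℝ 2 p 0)
    (hmono : ∃ η > 0, MonotoneOn p (Set.Ioo (-η) η)) (hp0 : p 0 = q) :
    (∀ Y : ℝ → DFNorm.Op H, ContDiffAt ℝ 2 Y 0 →
      (∀ᶠ t in nhds (0 : ℝ), IsStrictlyPositive (Y t)) →
      let D : ℝ :=
        1 / (q * DFNorm.wnorm S.sigmaTr (ENNReal.ofReal q) (Y 0) ^ (q - 1)) *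
          (deriv p 0 * S.Ent q (Y 0) +
            q * (DFNorm.tr (DFNorm.Gam S.sigmaTr (1 / q) (Y 0) ^ (q - 1) *
              DFNorm.Gam S.sigmaTr (1 / q) (deriv Y 0))).re)
      (1 < q → HasDerivAt (fun t => S.amalgNorm q (p t) (Y t)) D 0) ∧
      HasDerivWithinAt (fun t => S.amalgNorm q (p t) (Y t)) D (Set.Ici 0) 0) ∧
    (∀ X : DFNorm.Op H, IsStrictlyPositive X →
      HasDerivWithinAt (fun t => S.amalgNorm q (p t) (S.P t X))
        (1 / (q * DFNorm.wnorm S.sigmaTr (ENNReal.ofReal q) X ^ (q - 1)) *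
          (deriv p 0 * S.Ent q X - 2 * (q - 1) * S.dirichlet q X)) (Set.Ici 0) 0) := by
  have hpd : HasDerivAt p (deriv p 0) 0 := (hp.differentiableAt (by norm_num)).hasDerivAt
  refine ⟨fun Y hY hpos => ?_, fun X hX => ?_⟩
  · have hYd : HasDerivAt Y (deriv Y 0) 0 := (hY.differentiableAt (by norm_num)).hasDerivAt
    -- The set `univ` gives the two-sided derivative and `Ici 0` the right one.
    exact ⟨fun _ => (DFNorm.QMS.hasDerivWithinAt_amalgNorm_Ent hS hq (Set.mem_univ 0) hp0
        hpd.hasDerivWithinAt hYd.hasDerivWithinAt (by rwa [nhdsWithin_univ])).hasDerivAt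
          Filter.univ_mem,
      DFNorm.QMS.hasDerivWithinAt_amalgNorm_Ent hS hq Set.self_mem_Ici hp0 hpd.hasDerivWithinAt
        hYd.hasDerivWithinAt (hpos.filter_mono nhdsWithin_le_nhds)⟩
  · have h0 : S.P 0 X = X := by rw [S.zero]; rfl
    have h := DFNorm.QMS.hasDerivWithinAt_amalgNorm_Ent hS hq (Set.self_mem_Ici (a := (0 : ℝ))) hp0
      hpd.hasDerivWithinAt (S.hasDerivWithinAt_map X)
      (eventually_nhdsWithin_of_forall fun t ht =>
        (S.cp t ht).map_strictlyPositive (S.unital t ht) hX)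
    rw [h0, DFNorm.QMS.tr_generator_eq_dirichlet hS hq hX, ← sub_eq_add_neg] at h
    exact h
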